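/- **Proposition (Voronoi–Delaunay decomposition).** Let $F$ be a totally real number field with ring of integers $\mathfrak o$ and different $\mathfrak d$. Identify $F_{\mathbb R}=F\otimes\mathbb R$ with $\mathbb R^{\mathrm{Hom}(F,\mathbb R)}$, let $(F_{\mathbb R})_+$ be the open cone of vectors with all coordinates positive, and write $\mathrm{Tr}:F_{\mathbb R}\to\mathbb R$ for the trace. Let $\mathfrak b\subseteq\mathfrak b'$ and $\mathfrak c$ be non-zero fractional ideals, $\mathfrak a=\mathfrak b\mathfrak c$, $X=\mathfrak a\mathfrak b'$, and put $\mathfrak f^*=\mathfrak f^{-1}\mathfrak d^{-1}$ for a fractional ideal $\mathfrak f$. Let $s\ge 1$, let $\mu_1,\dots,\mu_s\in\mathfrak c$ be totally positive, and let $U\subseteq\mathfrak o^\times$ be a subgroup of finite index (for instance $U=\mathfrak o^\times$). Put $$C=\{0\}\cup (F_{\mathbb R})_+,\qquad \widetilde C=\{0\}\cup\big((F_{\mathbb R})_+\times F_{\mathbb R}^s\big),$$ with the lattices $X^*\subset F_{\mathbb R}$ and $X^*\times(\mathfrak a^*)^s\subset F_{\mathbb R}\times F_{\mathbb R}^s$.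 The group $U$ acts on $C$ by $u\cdot q=u^2q$, and $\mathfrak b^s\rtimes U$, with the law $(\beta;u)(\beta';u')=(\beta+u^{-1}\beta';uu')$, acts on $\widetilde C$ by $(\beta;u)\cdot(q;l)=(u^2q;\,ul+u^2q\beta)$. A *fan* is a set of closed strongly convex cones, each generated by finitely many lattice vectors, that contains all faces of its members and in which any two members meet in a common face. It is *complete* if its union is $C$ (resp. $\widetilde C$), *admissible* for a group if it is stable under it with finitely many orbits, and *smooth* if each cone is generated by a part of a $\mathbb Z$-basis of the lattice. A *subdivision* of a fan is a fan with the same union, each cone of which is contained in a cone of the given one. Let $\Sigma$ be a complete $U$-admissible fan of $C$. A fan $\widetilde\Sigma$ of $\widetilde C$ is *equidimensional* over $\Sigma$ if the projection $(q,l)\mapsto q$ maps each cone of $\widetilde\Sigma$ onto a cone of $\Sigma$. For $\beta\in\mathfrak b^s$ and $(q,l)\in\widetilde C$ put $$\chi_\beta(q,l)=\sum_{i=1}^s\mathrm{Tr}(q\mu_i\beta_i^2+2l_i\mu_i\beta_i),\qquad \varphi(q,l)=\min_{\beta\in\mathfrak b^s}\chi_\beta(q,l).$$ For $k\ge1$,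 a *$k$-twisted polarization function* on a complete $\mathfrak b^s\rtimes U$-admissible fan $\widetilde\Sigma$ of $\widetilde C$, over $\Sigma$, is a function $f:\widetilde C\to\mathbb R$ that is continuous on $\widetilde C\setminus\{0\}$, concave (so $f(x+y)\ge f(x)+f(y)$; "convex" in the convention of toroidal geometry), integer-valued on $\widetilde C\cap(X^*\times(\mathfrak a^*)^s)$, linear on each cone of $\widetilde\Sigma$, positively homogeneous, $U$-invariant, such that $f(\beta\cdot w)=f(w)-k\chi_\beta(w)$ for all $\beta\in\mathfrak b^s$ and $w\in\widetilde C$, and strictly convex over $\Sigma$: for each $\tau\in\widetilde\Sigma$ there are $\sigma\in\Sigma$, an integer $n\ge1$ and $(\xi,\alpha)\in X\times\mathfrak a^s$ with $$\tau=\{(q,l)\in\widetilde C:\ q\in\sigma,\ nf(q,l)=\mathrm{Tr}(\xi q)+\textstyle\sum_i\mathrm{Tr}(\alpha_il_i)\}.$$ Then the minimum defining $\varphi$ is attained on $\widetilde C$. For every complete $U$-admissible fan $\Sigma$ of $C$, let $\widetilde\Sigma$ be the set of the cones $$\tau_{\sigma,\mathfrak B}=\{(q,l)\in\widetilde C:\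 q\in\sigma,\ \chi_\beta(q,l)=\varphi(q,l)\ \text{for all }\beta\in\mathfrak B\},$$ for $\sigma\in\Sigma$ and $\mathfrak B\subset\mathfrak b^s$ finite and non-empty. 1. $\widetilde\Sigma$ is a complete $\mathfrak b^s\rtimes U$-admissible fan of $\widetilde C$, and each of its cones projects into a cone of $\Sigma$. 2. $\varphi$ is a $1$-twisted polarization function on $\widetilde\Sigma$ over $\Sigma$. 3. If, for each $\sigma\in\Sigma$, the Delaunay decomposition of $\mathfrak b^s$ for the quadratic form $\beta\mapsto\sum_i\mathrm{Tr}(q\mu_i\beta_i^2)$ is the same for all $q$ in the relative interior of $\sigma$, then $\widetilde\Sigma$ is equidimensional over $\Sigma$. Every complete $U$-admissible fan of $C$ has a complete $U$-admissible subdivision $\Sigma_1$ with this property, so that $\widetilde\Sigma_1$ is equidimensional over $\Sigma_1$. 4. $\widetilde\Sigma$ has a smooth (complete, $\mathfrak b^s\rtimes U$-admissible) subdivision that carries a $k$-twisted polarization function over $\Sigma$ for some $k\ge1$. -/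

import Mathlib

open NumberField
open scoped nonZeroDivisors Pointwise

noncomputable section

namespace VoronoiDelaunay

/-! ### Rational polyhedral fans -/

section Fans

variable {E : Type*} [AddCommGroup E] [Module ℝ E]

/-- A set of (closed) cones is a fan with respect to the lattice `N`: every member is a strongly
convex cone generated by finitely many vectors of `N`, faces of members are members, and the
intersection of two members is a face of both (of the second one by symmetry). -/
structure IsFan (N : AddSubgroup E) (S : Set (Set E)) : Prop where
  rational : ∀ σ ∈ S, ∃ A : Finset E, (A : Set E) ⊆ N ∧ σ = (PointedCone.hull ℝ (A : Set E) : Set E)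
  salient : ∀ σ ∈ S, ∀ x ∈ σ, -x ∈ σ → x = 0
  face_mem : ∀ C D : PointedCone ℝ E, (C : Set E) ∈ S → D.IsFaceOf C → (D : Set E) ∈ S
  inter_isFaceOf : ∀ C D : PointedCone ℝ E, (C : Set E) ∈ S → (D : Set E) ∈ S →
    (C ⊓ D).IsFaceOf C

/-- Stability of a set of cones under a linear action of a group, with finitely many orbits. -/
structure IsAdmissible {G : Type*} [Group G] (ρ : G →* Module.End ℝ E) (S : Set (Set E)) :
    Prop where
  stable : ∀ g : G, ∀ σ ∈ S, ρ g '' σ ∈ S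
  finite_orbits : ∃ T : Set (Set E), T.Finite ∧ T ⊆ S ∧ ∀ σ ∈ S, ∃ g : G, ∃ τ ∈ T, σ = ρ g '' τ

/-- A complete admissible fan with support `C`. -/
structure IsCompleteAdmissibleFan {G : Type*} [Group G] (N : AddSubgroup E) (C : Set E)
    (ρ : G →* Module.End ℝ E) (S : Set (Set E)) : Prop where
  isFan : IsFan N S
  complete : ⋃₀ S = C
  admissible : IsAdmissible ρ S

/-- A fan is smooth if each of its cones is generated by a part of a `ℤ`-basis of the lattice. -/
def IsSmooth (N : AddSubgroup E) (S : Set (Set E)) : Prop :=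
  ∀ σ ∈ S, ∃ (n : ℕ) (B : Module.Basis (Fin n) ℤ N) (J : Set (Fin n)),
    σ = (PointedCone.hull ℝ ((fun j => (B j : E)) '' J) : Set E)

/-- `S'` is a subdivision of `S`. -/
def IsSubdivision (S' S : Set (Set E)) : Prop :=
  (∀ σ' ∈ S', ∃ σ ∈ S, σ' ⊆ σ) ∧ ⋃₀ S' = ⋃₀ S

end Fans

section Equidimensional

variable {E E' : Type*}

/-- Every cone of `S'` projects into a cone of `S`. -/
def LiesOver (S : Set (Set E)) (S' : Set (Set (E × E'))) : Prop :=
  ∀ τ ∈ S', ∃ σ ∈ S, Prod.fst '' τ ⊆ σ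

/-- Every cone of `S'` projects onto a cone of `S`. -/
def IsEquidimensional (S : Set (Set E)) (S' : Set (Set (E × E'))) : Prop :=
  ∀ τ ∈ S', ∃ σ ∈ S, Prod.fst '' τ = σ

end Equidimensional

/-! ### The number-theoretic data -/

section Field

variable (F : Type*) [Field F] [NumberField F]

/-- For `F` totally real this is `F ⊗ ℝ`, identified with `ℝ ^ Hom(F, ℝ)`. -/
abbrev V : Type _ := (F →+* ℝ) → ℝ

/-- `(F ⊗ ℝ) × (F ⊗ ℝ) ^ s`. -/
abbrev W (s : ℕ) : Type _ := V F × (Fin s → V F)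

variable {F}

/-- The embedding `F → F ⊗ ℝ`. -/
def emb : F →+* V F := RingHom.pi fun τ => τ

/-- The trace `F ⊗ ℝ → ℝ`. -/
def tr (x : V F) : ℝ := ∑ τ, x τ

/-- The image in `F ⊗ ℝ` of `I* = I⁻¹ 𝔡⁻¹`, the dual of `I` under the trace form of `F / ℚ`. -/
def dualLattice (I : FractionalIdeal (𝓞 F)⁰ F) : AddSubgroup (V F) :=
  ((FractionalIdeal.dual ℤ ℚ I : FractionalIdeal (𝓞 F)⁰ F) :
    Submodule (𝓞 F) F).toAddSubgroup.map (emb : F →+* V F).toAddMonoidHom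

variable (F) in
/-- The cone `{0} ∪ (F ⊗ ℝ)₊`. -/
def cone : Set (V F) := {q | q = 0 ∨ ∀ τ, 0 < q τ}

variable (F) in
/-- The cone `{0} ∪ (F ⊗ ℝ)₊ × (F ⊗ ℝ) ^ s`. -/
def coneTilde (s : ℕ) : Set (W F s) := {w | w = 0 ∨ ∀ τ, 0 < w.1 τ}

/-- The action of units on `F ⊗ ℝ`: `u · q = u² q`. -/
def unitAction (U : Subgroup (𝓞 F)ˣ) : U →* Module.End ℝ (V F) where
  toFun u := LinearMap.mulLeft ℝ (emb ((u : (𝓞 F)ˣ) : F) ^ 2)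
  map_one' := by ext; simp
  map_mul' u v := by
    apply LinearMap.ext
    intro q
    simp only [Subgroup.coe_mul, Units.val_mul, map_mul, LinearMap.mulLeft_apply,
      Module.End.mul_apply]
    ring

/-- The data at a cusp: fractional ideals `𝔟 ⊆ 𝔟'` and `𝔠`, and totally positive elements
`μ₁, …, μ_s` of `𝔠` (the polarizations `β ↦ μᵢ β`). -/
structure CuspData (F : Type*) [Field F] [NumberField F] (s : ℕ) where
  b : FractionalIdeal (𝓞 F)⁰ F
  b' : FractionalIdeal (𝓞 F)⁰ F
  c : FractionalIdeal (𝓞 F)⁰ F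
  b_ne_zero : b ≠ 0
  c_ne_zero : c ≠ 0
  b_le : b ≤ b'
  μ : Fin s → F
  μ_mem : ∀ i, μ i ∈ c
  μ_pos : ∀ i, ∀ τ : F →+* ℝ, 0 < τ (μ i)

namespace CuspData

variable {s : ℕ} (D : CuspData F s)

/-- `𝔞 = 𝔟𝔠`. -/
def a : FractionalIdeal (𝓞 F)⁰ F := D.b * D.c

/-- `X = 𝔞𝔟' = 𝔠𝔟𝔟'`. -/
def X : FractionalIdeal (𝓞 F)⁰ F := D.a * D.b'

/-- The group `𝔟 ^ s`. -/
abbrev Bs : Type _ := Fin s → (D.b : Submodule (𝓞 F) F)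

/-- The lattice `X*` in `F ⊗ ℝ`. -/
def lattice : AddSubgroup (V F) := dualLattice D.X

/-- The lattice `X* × (𝔞*) ^ s` in `(F ⊗ ℝ) × (F ⊗ ℝ) ^ s`. -/
def latticeTilde : AddSubgroup (W F s) :=
  D.lattice.prod (AddSubgroup.pi Set.univ fun _ => dualLattice D.a)

/-- The action of units on `𝔟 ^ s` that defines the semidirect product: `u` acts by
multiplication by `u⁻¹`. -/
def twistAction (U : Subgroup (𝓞 F)ˣ) : U →* MulAut (Multiplicative D.Bs) where
  toFun u :=
    { toFun := fun β => Multiplicative.ofAdd ((u : (𝓞 F)ˣ)⁻¹ • β.toAdd)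
      invFun := fun β => Multiplicative.ofAdd ((u : (𝓞 F)ˣ) • β.toAdd)
      left_inv := fun β => by simp
      right_inv := fun β => by simp
      map_mul' := fun β γ => by simp [smul_add] }
  map_one' := by ext; simp
  map_mul' u v := by
    ext β : 1
    simp [mul_smul, smul_comm (u : (𝓞 F)ˣ)⁻¹]

/-- The group `𝔟 ^ s ⋊ U`, with `(β; u) (β'; u') = (β + u⁻¹ β'; u u')`. -/
abbrev Gp (U : Subgroup (𝓞 F)ˣ) : Type _ := Multiplicative D.Bs ⋊[D.twistAction U] U

/-- The action `(β; u) · (q; l) = (u² q; u l + u² q β)` of `𝔟 ^ s ⋊ U`. -/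
def action (U : Subgroup (𝓞 F)ˣ) : D.Gp U →* Module.End ℝ (W F s) where
  toFun g :=
    { toFun := fun w =>
        (emb ((g.right : (𝓞 F)ˣ) : F) ^ 2 * w.1,
          fun i => emb ((g.right : (𝓞 F)ˣ) : F) * w.2 i +
            emb ((g.right : (𝓞 F)ˣ) : F) ^ 2 * w.1 * emb (g.left.toAdd i : F))
      map_add' := fun w w' => by
        ext <;> simp <;> ring
      map_smul' := fun r w => by
        ext <;> simp <;> ring }
  map_one' := by
    apply LinearMap.ext
    intro w
    ext <;> simp
  map_mul' g h := by
    have key : (emb ((g.right : (𝓞 F)ˣ) : F) : V F) *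
        emb (((g.right : (𝓞 F)ˣ)⁻¹ : (𝓞 F)ˣ) : F) = 1 := by
      rw [← map_mul, ← map_mul, Units.mul_inv, map_one, map_one]
    apply LinearMap.ext
    intro w
    refine Prod.ext ?_ (funext fun i => ?_)
    · simp only [LinearMap.coe_mk, AddHom.coe_mk, Module.End.mul_apply, SemidirectProduct.mul_right,
        Subgroup.coe_mul, Units.val_mul, map_mul]
      ring
    · have hl : ((g * h).left.toAdd i : F) = (g.left.toAdd i : F) +
          (((g.right : (𝓞 F)ˣ)⁻¹ : (𝓞 F)ˣ) : F) * (h.left.toAdd i : F) := rfl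
      simp only [LinearMap.coe_mk, AddHom.coe_mk, Module.End.mul_apply, SemidirectProduct.mul_right,
        Subgroup.coe_mul, Units.val_mul, map_mul, hl, map_add]
      linear_combination (emb ((g.right : (𝓞 F)ˣ) : F) * emb ((h.right : (𝓞 F)ˣ) : F) ^ 2 *
        w.1 * emb (h.left.toAdd i : F)) * key

/-- The pairing of `(ξ, α) ∈ F × F ^ s` with `(q, l)`. -/
def pairing (ξ : F) (α : Fin s → F) (w : W F s) : ℝ :=
  tr (emb ξ * w.1) + ∑ i, tr (emb (α i) * w.2 i)

/-! ### The functions `χ_β` and `φ` and the cones `τ_{σ,𝔅}` -/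

/-- `χ_β (q, l) = ∑ᵢ Tr (q μᵢ βᵢ² + 2 lᵢ μᵢ βᵢ)`. -/
def χ (β : D.Bs) (w : W F s) : ℝ :=
  ∑ i, tr (w.1 * emb (D.μ i) * emb (β i : F) ^ 2 + 2 * w.2 i * emb (D.μ i) * emb (β i : F))

/-- `φ = min_β χ_β`. That the minimum is attained on `coneTilde` is part of the theorem. -/
def φ (w : W F s) : ℝ := ⨅ β : D.Bs, D.χ β w

/-- The cone `τ_{σ,𝔅}`. -/
def tau (σ : Set (V F)) (A : Finset D.Bs) : Set (W F s) :=
  {w | w ∈ coneTilde F s ∧ w.1 ∈ σ ∧ ∀ β ∈ A, D.χ β w = D.φ w}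

/-- The set of the cones `τ_{σ,𝔅}`, for `σ` in `S` and `𝔅` a non-empty finite subset of `𝔟 ^ s`. -/
def tildeFan (S : Set (Set (V F))) : Set (Set (W F s)) :=
  {τ | ∃ σ ∈ S, ∃ A : Finset D.Bs, A.Nonempty ∧ τ = D.tau σ A}

/-- The Delaunay decomposition of `𝔟 ^ s` for the quadratic form `∑ᵢ Tr (q μᵢ βᵢ²)`, each cell
being given by its set of vertices: these are the sets of minimizers of
`β ↦ ∑ᵢ Tr (q μᵢ βᵢ² + 2 lᵢ μᵢ βᵢ)`, for `l` in `(F ⊗ ℝ) ^ s`. -/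
def delaunay (q : V F) : Set (Set D.Bs) :=
  Set.range fun l : Fin s → V F => {β | ∀ γ, D.χ β (q, l) ≤ D.χ γ (q, l)}

/-- The Delaunay decomposition is constant on the relative interior of each cone of `S`. -/
def IsDelaunayConstant (S : Set (Set (V F))) : Prop :=
  ∀ σ ∈ S, ∀ q ∈ intrinsicInterior ℝ σ, ∀ q' ∈ intrinsicInterior ℝ σ, D.delaunay q = D.delaunay q'

/-! ### Twisted polarization functions -/

/-- `f` is a `k`-twisted support function on the fan `S'`. As usual for fans, "convex" means
`f (x + y) ≥ f x + f y`. -/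
structure IsTwistedSupportFunction (U : Subgroup (𝓞 F)ˣ) (k : ℕ) (S' : Set (Set (W F s)))
    (f : W F s → ℝ) : Prop where
  continuousOn : ContinuousOn f (coneTilde F s \ {0})
  concaveOn : ConcaveOn ℝ (coneTilde F s) f
  integral : ∀ w ∈ coneTilde F s, w ∈ D.latticeTilde → ∃ m : ℤ, f w = m
  linear : ∀ τ ∈ S', ∃ L : W F s →ₗ[ℝ] ℝ, ∀ w ∈ τ, f w = L w
  homogeneous : ∀ w ∈ coneTilde F s, ∀ r : ℝ, 0 ≤ r → f (r • w) = r * f w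
  unit_invariant : ∀ u : U, ∀ w ∈ coneTilde F s,
    f (D.action U (SemidirectProduct.inr u) w) = f w
  twisted : ∀ β : D.Bs, ∀ w ∈ coneTilde F s,
    f (D.action U (SemidirectProduct.inl (Multiplicative.ofAdd β)) w) = f w - k * D.χ β w

/-- `f` is a `k`-twisted polarization function on the fan `S'` over the fan `S`: a `k`-twisted
support function that is strictly convex over each cone of `S`. -/
structure IsTwistedPolarization (U : Subgroup (𝓞 F)ˣ) (k : ℕ) (S : Set (Set (V F)))
    (S' : Set (Set (W F s))) (f : W F s → ℝ) : Prop
    extends IsTwistedSupportFunction D U k S' f where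
  strict : ∀ τ ∈ S', ∃ σ ∈ S, ∃ n : ℕ, 1 ≤ n ∧ ∃ ξ ∈ D.X, ∃ α : Fin s → F, (∀ i, α i ∈ D.a) ∧
    τ = {w | w ∈ coneTilde F s ∧ w.1 ∈ σ ∧ n * f w = pairing ξ α w}

/-- `S` is a complete `U`-admissible fan of `{0} ∪ (F ⊗ ℝ)₊`, rational for `X*`. -/
abbrev IsBaseFan (U : Subgroup (𝓞 F)ˣ) (S : Set (Set (V F))) : Prop :=
  IsCompleteAdmissibleFan D.lattice (cone F) (unitAction U) S

/-- `S'` is a complete `𝔟 ^ s ⋊ U`-admissible fan of `{0} ∪ (F ⊗ ℝ)₊ × (F ⊗ ℝ) ^ s`, rational for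
`X* × (𝔞*) ^ s`. -/
abbrev IsTotalFan (U : Subgroup (𝓞 F)ˣ) (S' : Set (Set (W F s))) : Prop :=
  IsCompleteAdmissibleFan D.latticeTilde (coneTilde F s) (D.action U) S'

end CuspData

end Field

end VoronoiDelaunay

end

open VoronoiDelaunay

noncomputable section

set_option linter.unusedSectionVars false

namespace VoronoiDelaunay

/-! ### Polyhedral cones -/

section Cones

variable {E E' : Type*} [AddCommGroup E] [Module ℝ E] [AddCommGroup E'] [Module ℝ E']

/-! For totally positive `q`, completing the square shows that `β ↦ χ_β(q,l)` is a positive definite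
quadratic polynomial on a lattice, so its minimum is attained. Over a finitely generated cone of
totally positive vectors the growth is uniform (`exists_finset_pos`): if some `β` is minimal, then
after translation by `β` only a fixed finite set of lattice points can compete. Hence `φ` is, over
each base cone, cut into rational cones by finitely many inequalities at a time, and these cones
form finitely many orbits. `CellData` isolates this argument; it is used for `φ` over the base fan
and again for a refinement of the base fan. Summing the `χ_β` that define a cone gives the
functional required by strict convexity (`sum_χ_eq_iff`).

A Delaunay cell at `q` is the set of minimizers at some `(q,l)`. If the decomposition is constant on
the relative interior of a base cone, a cone of the total fan whose interior lies over one such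
point meets the fibre over every such point, which gives equidimensionality. To reach this
situation, the base fan has to be cut along the projections of the cones of the total fan, finitely
many up to the group. The cuts come from minima of `q ↦ Tr(ξq)` over orbits of totally positive `ξ`
under squares of units. For `ξ` close to the inverse of `q₀` and small `ε`, both `ξ ± εη` are
minimal in their orbit near `q₀` along the hyperplane `Tr(ηq) = 0`, because a unit square other than
`1` raises the trace from `n` to at least `n + 1` (`tr_unit_sq`). Compactness and sums of families
give one family that breaks along all required walls (`exists_refines`).

For the smooth subdivision, adding the minimum over this family to `φ` gives a function that is
strictly concave in all directions, not only over the base. `TwistedCone` abstracts the situation.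
The infimum `ψ` of `χ_β` over real `β` transforms like `φ`, and differences `L - kψ` that dominate
all rational functionals supply the finiteness that the infinite group takes away
(`Good.finite_le`). A `State` is a decomposition with heights at its vertices and support
functionals; it survives equivariant stellar subdivision after the heights are scaled
(`State.star`). Starring at barycenters from the top dimension down makes the cells simplicial,
starring at lattice points of half-open parallelepipeds brings all multiplicities down to one, and a
multiple of the resulting piecewise linear function is integral. -/

theorem mem_hull_finset {A : Finset E} {x : E} :
    x ∈ PointedCone.hull ℝ (A : Set E) ↔
      ∃ c : E → ℝ, (∀ a ∈ A, 0 ≤ c a) ∧ x = ∑ a ∈ A, c a • a := by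
  classical
  constructor
  · intro hx
    induction hx using Submodule.span_induction with
    | mem x hx =>
      refine ⟨fun a => if a = x then 1 else 0, fun a _ => by dsimp only; split_ifs <;> norm_num, ?_⟩
      simp [Finset.mem_coe.1 hx]
    | zero => exact ⟨0, by simp, by simp⟩
    | add x y _ _ hx hy =>
      obtain ⟨c, hc, rfl⟩ := hx
      obtain ⟨d, hd, rfl⟩ := hy
      exact ⟨c + d, fun a ha => add_nonneg (hc a ha) (hd a ha), by
        simp [add_smul, Finset.sum_add_distrib]⟩
    | smul r x _ hx =>
      obtain ⟨c, hc, rfl⟩ := hx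
      refine ⟨fun a => (r : ℝ) * c a, fun a ha => mul_nonneg r.2 (hc a ha), ?_⟩
      simp only [mul_smul, Finset.smul_sum]
      rfl
  · rintro ⟨c, hc, rfl⟩
    exact Submodule.sum_mem _ fun a ha =>
      PointedCone.smul_mem _ (hc a ha) (Submodule.subset_span ha)

theorem sum_smul_mem_hull {A : Finset E} {c : E → ℝ} (hc : ∀ a ∈ A, 0 ≤ c a) :
    ∑ a ∈ A, c a • a ∈ PointedCone.hull ℝ (A : Set E) :=
  mem_hull_finset.2 ⟨c, hc, rfl⟩

/-- A common denominator for finitely many rational real numbers. -/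
theorem exists_common_denominator {ι : Type*} (A : Finset ι) (h : ι → ℝ)
    (hr : ∀ a ∈ A, ∃ r : ℚ, h a = r) : ∃ M : ℕ, 0 < M ∧ ∀ a ∈ A, ∃ z : ℤ, M * h a = z := by
  classical
  induction A using Finset.induction_on with
  | empty => exact ⟨1, one_pos, by simp⟩
  | insert a A _ ih =>
    obtain ⟨M, hM, H⟩ := ih fun a ha => hr a (Finset.mem_insert_of_mem ha)
    obtain ⟨r, hr⟩ := hr a (Finset.mem_insert_self _ _)
    refine ⟨M * r.den, Nat.mul_pos hM r.den_pos, fun b hb => ?_⟩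
    rcases Finset.mem_insert.1 hb with rfl | hb
    · refine ⟨M * r.num, ?_⟩
      have : (r.den : ℝ) * r = r.num := by exact_mod_cast Rat.den_mul_eq_num r
      rw [hr]; push_cast; rw [mul_assoc, this]
    · obtain ⟨z, hz⟩ := H b hb
      refine ⟨r.den * z, ?_⟩
      push_cast
      rw [← hz]; ring

theorem sum_eq_sum_pos_add_sum_neg_add_sum_zero {ι M : Type*} [AddCommMonoid M] (A : Finset ι)
    (h : ι → ℝ) (f : ι → M) : ∑ a ∈ A, f a = ∑ a ∈ A.filter (fun a => 0 < h a), f a +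
      ∑ a ∈ A.filter (fun a => h a < 0), f a + ∑ a ∈ A.filter (fun a => h a = 0), f a := by
  simp only [Finset.sum_filter, ← Finset.sum_add_distrib]
  refine Finset.sum_congr rfl fun a _ => ?_
  rcases lt_trichotomy (h a) 0 with h1 | h1 | h1
  · simp [h1, h1.ne, h1.le.not_gt]
  · simp [h1]
  · simp [h1, h1.ne', h1.le.not_gt]

/-- The intersection of a rational cone with a rational half-space is a rational cone. -/
theorem exists_hull_eq_inter_halfspace (N : AddSubgroup E) (A : Finset E) (hA : (A : Set E) ⊆ N)
    (h : E →ₗ[ℝ] ℝ) (hr : ∀ a ∈ N, ∃ r : ℚ, h a = r) :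
    ∃ A' : Finset E, (A' : Set E) ⊆ N ∧
      ∀ x, x ∈ PointedCone.hull ℝ (A' : Set E) ↔
        x ∈ PointedCone.hull ℝ (A : Set E) ∧ 0 ≤ h x := by
  classical
  obtain ⟨M, hM, H⟩ := exists_common_denominator A h fun a ha => hr a (hA ha)
  have hM' : (0 : ℝ) < M := Nat.cast_pos.2 hM
  choose! k hk using H
  have hka : ∀ a ∈ A, (k a : ℝ) = M * h a := fun a ha => (hk a ha).symm
  let P := A.filter fun a => 0 < h a
  let Q := A.filter fun a => h a < 0
  let A₀ := A.filter fun a => 0 ≤ h a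
  -- Fourier–Motzkin elimination for generators: each pair on opposite sides of the hyperplane
  -- contributes its positive combination on the hyperplane. The integers `k a = M h(a)` keep this
  -- combination in the lattice.
  let B := (P ×ˢ Q).image fun p => k p.1 • p.2 - k p.2 • p.1
  have hB : ∀ a ∈ P, ∀ b ∈ Q, (k a • b - k b • a : E) = (M : ℝ) • (h a • b - h b • a) := by
    intro a ha b hb
    rw [← Int.cast_smul_eq_zsmul ℝ, ← Int.cast_smul_eq_zsmul ℝ,
      hka a (Finset.mem_filter.1 ha).1, hka b (Finset.mem_filter.1 hb).1, smul_sub, smul_smul,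
      smul_smul]
  refine ⟨A₀ ∪ B, ?_, fun x => ⟨fun hx => ?_, ?_⟩⟩
  · intro x hx
    rcases Finset.mem_union.1 (Finset.mem_coe.1 hx) with hx | hx
    · exact hA (Finset.mem_filter.1 hx).1
    · obtain ⟨p, hp, rfl⟩ := Finset.mem_image.1 hx
      obtain ⟨h1, h2⟩ := Finset.mem_product.1 hp
      exact sub_mem (zsmul_mem (hA (Finset.mem_filter.1 h2).1) _)
        (zsmul_mem (hA (Finset.mem_filter.1 h1).1) _)
  · induction hx using Submodule.span_induction with
    | mem x hx =>
      rcases Finset.mem_union.1 (Finset.mem_coe.1 hx) with hx | hx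
      · exact ⟨Submodule.subset_span (Finset.mem_filter.1 hx).1, (Finset.mem_filter.1 hx).2⟩
      · obtain ⟨⟨a, b⟩, hp, rfl⟩ := Finset.mem_image.1 hx
        obtain ⟨ha, hb⟩ := Finset.mem_product.1 hp
        simp only at ha hb ⊢
        have ha' := Finset.mem_filter.1 ha
        have hb' := Finset.mem_filter.1 hb
        rw [hB a ha b hb]
        constructor
        · refine PointedCone.smul_mem _ hM'.le ?_
          rw [sub_eq_add_neg, ← neg_smul]
          exact add_mem (PointedCone.smul_mem _ ha'.2.le (Submodule.subset_span hb'.1))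
            (PointedCone.smul_mem _ (neg_nonneg.2 hb'.2.le) (Submodule.subset_span ha'.1))
        · simp only [map_smul, map_sub, smul_eq_mul]
          apply le_of_eq
          ring
    | zero => exact ⟨zero_mem _, by simp⟩
    | add x y _ _ hx hy =>
      exact ⟨add_mem hx.1 hy.1, by rw [map_add]; exact add_nonneg hx.2 hy.2⟩
    | smul r x _ hx =>
      exact ⟨Submodule.smul_mem _ r hx.1, by
        change 0 ≤ h ((r : ℝ) • x)
        rw [map_smul]; exact mul_nonneg r.2 hx.2⟩
  · rintro ⟨hx, hx0⟩
    obtain ⟨c, hc, rfl⟩ := mem_hull_finset.1 hx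
    set p := ∑ a ∈ P, c a * h a with hp
    set n := ∑ b ∈ Q, c b * h b with hn
    have hpn : 0 ≤ p + n := by
      have h1 : h (∑ a ∈ A, c a • a) = ∑ a ∈ A, c a * h a := by simp
      rw [h1, sum_eq_sum_pos_add_sum_neg_add_sum_zero A h fun a => c a * h a] at hx0
      have h2 : ∑ a ∈ A.filter (fun a => h a = 0), c a * h a = 0 :=
        Finset.sum_eq_zero fun a ha => by rw [(Finset.mem_filter.1 ha).2, mul_zero]
      rwa [h2, add_zero] at hx0
    have hzero : ∑ a ∈ A.filter (fun a => h a = 0), c a • a ∈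
        PointedCone.hull ℝ ((A₀ ∪ B : Finset E) : Set E) := by
      refine Submodule.sum_mem _ fun a ha => ?_
      have ha := Finset.mem_filter.1 ha
      exact PointedCone.smul_mem _ (hc a ha.1) (Submodule.subset_span
        (Finset.mem_coe.2 (Finset.mem_union_left _ (Finset.mem_filter.2 ⟨ha.1, ha.2.ge⟩))))
    have hPmem : ∀ a ∈ P, (a : E) ∈ PointedCone.hull ℝ ((A₀ ∪ B : Finset E) : Set E) := by
      intro a ha
      have ha := Finset.mem_filter.1 ha
      exact Submodule.subset_span
        (Finset.mem_coe.2 (Finset.mem_union_left _ (Finset.mem_filter.2 ⟨ha.1, ha.2.le⟩)))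
    have hp0 : 0 ≤ p := Finset.sum_nonneg fun a ha =>
      mul_nonneg (hc a (Finset.mem_filter.1 ha).1) (Finset.mem_filter.1 ha).2.le
    rw [sum_eq_sum_pos_add_sum_neg_add_sum_zero A h fun a => c a • a]
    refine add_mem ?_ hzero
    rcases hp0.eq_or_lt with h0 | h0
    -- If the positive mass `p` vanishes, then `p + n ≥ 0` forces the negative mass `n` to vanish as
    -- well.
    · have hQ : ∀ b ∈ Q, c b * h b = 0 := by
        have hle : ∀ b ∈ Q, c b * h b ≤ 0 := fun b hb =>
          mul_nonpos_of_nonneg_of_nonpos (hc b (Finset.mem_filter.1 hb).1)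
            (Finset.mem_filter.1 hb).2.le
        have : n = 0 := le_antisymm (Finset.sum_nonpos hle) (by linarith)
        exact (Finset.sum_eq_zero_iff_of_nonpos hle).1 this
      have : ∑ b ∈ Q, c b • b = 0 := Finset.sum_eq_zero fun b hb => by
        have := (mul_eq_zero.1 (hQ b hb)).resolve_right (Finset.mem_filter.1 hb).2.ne
        rw [this, zero_smul]
      rw [this, add_zero]
      exact Submodule.sum_mem _ fun a ha => PointedCone.smul_mem _
        (hc a (Finset.mem_filter.1 ha).1) (hPmem a ha)
    -- The fraction `-n/p` of the positive part is used up to cancel the negative part, distributed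
    -- over all pairs in proportion to the coefficients; the fraction `(p + n)/p` is left over.
    · have key : ∑ a ∈ P, c a • a + ∑ b ∈ Q, c b • b =
          ((p + n) / p) • ∑ a ∈ P, c a • a +
            ∑ a ∈ P, ∑ b ∈ Q, (c a * c b / p / M) • (k a • b - k b • a : E) := by
        have h1 : ∑ a ∈ P, ∑ b ∈ Q, (c a * c b / p / M) • (k a • b - k b • a : E) =
            ∑ a ∈ P, ∑ b ∈ Q, ((c a * h a / p) • c b • b - (c b * h b / p) • c a • a) := by
          refine Finset.sum_congr rfl fun a ha => Finset.sum_congr rfl fun b hb => ?_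
          rw [hB a ha b hb, smul_smul, smul_sub, smul_smul, smul_smul, smul_smul, smul_smul]
          congr 2 <;> field_simp
        rw [h1]
        simp only [Finset.sum_sub_distrib, ← Finset.smul_sum, ← Finset.sum_smul]
        rw [← Finset.sum_div, ← Finset.sum_div, ← hp, ← hn, div_self h0.ne',
          one_smul, add_div, div_self h0.ne', add_smul, one_smul]
        abel
      rw [key]
      refine add_mem (PointedCone.smul_mem _ (by positivity) (Submodule.sum_mem _ fun a ha =>
        PointedCone.smul_mem _ (hc a (Finset.mem_filter.1 ha).1) (hPmem a ha))) ?_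
      refine Submodule.sum_mem _ fun a ha => Submodule.sum_mem _ fun b hb => ?_
      have hca := hc a (Finset.mem_filter.1 ha).1
      have hcb := hc b (Finset.mem_filter.1 hb).1
      refine PointedCone.smul_mem _ (by positivity) (Submodule.subset_span
        (Finset.mem_coe.2 (Finset.mem_union_right _ (Finset.mem_image.2
          ⟨(a, b), Finset.mem_product.2 ⟨ha, hb⟩, rfl⟩))))

/-- The intersection of a rational cone with finitely many rational half-spaces is a rational
cone. -/
theorem exists_hull_eq_inter_halfspaces (N : AddSubgroup E) (A : Finset E)
    (hA : (A : Set E) ⊆ N) (H : Finset (E →ₗ[ℝ] ℝ)) (hr : ∀ h ∈ H, ∀ a ∈ N, ∃ r : ℚ, h a = r) :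
    ∃ A' : Finset E, (A' : Set E) ⊆ N ∧
      ∀ x, x ∈ PointedCone.hull ℝ (A' : Set E) ↔
        x ∈ PointedCone.hull ℝ (A : Set E) ∧ ∀ h ∈ H, 0 ≤ h x := by
  classical
  induction H using Finset.induction_on with
  | empty => exact ⟨A, hA, by simp⟩
  | insert h H _ ih =>
    obtain ⟨A', hA', H'⟩ := ih fun g hg => hr g (Finset.mem_insert_of_mem hg)
    obtain ⟨A'', hA'', H''⟩ := exists_hull_eq_inter_halfspace N A' hA' h
      (hr h (Finset.mem_insert_self _ _))
    refine ⟨A'', hA'', fun x => ?_⟩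
    rw [H'', H', Finset.forall_mem_insert, and_assoc, and_comm (b := 0 ≤ h x)]

/-- A finitely generated cone is an intersection of finitely many half-spaces, defined by
functionals in a given `ℚ`-space of functionals that are rational on the generators and separate
points. -/
theorem exists_halfspaces (R : Submodule ℚ (E →ₗ[ℝ] ℝ)) (H₀ : Finset (E →ₗ[ℝ] ℝ))
    (hH₀ : (H₀ : Set (E →ₗ[ℝ] ℝ)) ⊆ R) (hsep : ∀ x, (∀ h ∈ H₀, h x = 0) → x = 0)
    (A : Finset E) (hr : ∀ h ∈ R, ∀ a ∈ A, ∃ r : ℚ, h a = r) :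
    ∃ H : Finset (E →ₗ[ℝ] ℝ), (H : Set (E →ₗ[ℝ] ℝ)) ⊆ R ∧
      ∀ x, x ∈ PointedCone.hull ℝ (A : Set E) ↔ ∀ h ∈ H, 0 ≤ h x := by
  classical
  induction A using Finset.induction_on with
  | empty =>
    refine ⟨H₀ ∪ H₀.image fun h => -h, ?_, fun x => ?_⟩
    · intro h hh
      rcases Finset.mem_union.1 (Finset.mem_coe.1 hh) with hh | hh
      · exact hH₀ hh
      · obtain ⟨g, hg, rfl⟩ := Finset.mem_image.1 hh
        exact neg_mem (hH₀ hg)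
    · simp only [Finset.coe_empty, Submodule.span_empty, Submodule.mem_bot]
      constructor
      · rintro rfl h _
        simp
      · intro H
        refine hsep x fun h hh => le_antisymm ?_ (H h (Finset.mem_union_left _ hh))
        have := H (-h) (Finset.mem_union_right _ (Finset.mem_image_of_mem _ hh))
        simpa using this
  | insert a A _ ih =>
    obtain ⟨H, hH, Hx⟩ := ih fun h hh b hb => hr h hh b (Finset.mem_insert_of_mem hb)
    have hra : ∀ h ∈ R, ∃ r : ℚ, h a = r := fun h hh => hr h hh a (Finset.mem_insert_self _ _)
    -- The eliminated functionals have coefficients `g(a)`, which are rational, so they stay in the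
    -- `ℚ`-space `R`.
    have hsmul : ∀ g ∈ R, ∀ h ∈ R, g a • h ∈ R := by
      intro g hg h hh
      obtain ⟨r, hr⟩ := hra g hg
      have : g a • h = r • h := by
        ext x; simp [hr, Rat.smul_def]
      rw [this]
      exact R.smul_mem r hh
    let P := H.filter fun h => 0 < h a
    let Q := H.filter fun h => h a < 0
    refine ⟨H.filter (fun h => 0 ≤ h a) ∪ (P ×ˢ Q).image fun p => p.1 a • p.2 - p.2 a • p.1,
      ?_, fun x => ?_⟩
    · intro h hh
      rcases Finset.mem_union.1 (Finset.mem_coe.1 hh) with hh | hh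
      · exact hH (Finset.mem_filter.1 hh).1
      · obtain ⟨p, hp, rfl⟩ := Finset.mem_image.1 hh
        obtain ⟨h1, h2⟩ := Finset.mem_product.1 hp
        have h1 := hH (Finset.mem_filter.1 h1).1
        have h2 := hH (Finset.mem_filter.1 h2).1
        exact sub_mem (hsmul _ h1 _ h2) (hsmul _ h2 _ h1)
    · rw [Finset.coe_insert, Submodule.mem_span_insert]
      constructor
      · rintro ⟨t, z, hz, rfl⟩ h hh
        have hz := (Hx z).1 hz
        have ht : (0 : ℝ) ≤ t := t.2
        have hta : ∀ g : E →ₗ[ℝ] ℝ, g (t • a + z) = (t : ℝ) * g a + g z := by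
          intro g
          rw [map_add]
          congr 1
          exact g.map_smul (t : ℝ) a
        rcases Finset.mem_union.1 hh with hh | hh
        · have hh := Finset.mem_filter.1 hh
          rw [hta]
          exact add_nonneg (mul_nonneg ht hh.2) (hz h hh.1)
        · obtain ⟨⟨f, g⟩, hp, rfl⟩ := Finset.mem_image.1 hh
          obtain ⟨h1, h2⟩ := Finset.mem_product.1 hp
          have h1 := Finset.mem_filter.1 h1
          have h2 := Finset.mem_filter.1 h2
          simp only [LinearMap.sub_apply, LinearMap.smul_apply, hta, smul_eq_mul] at h1 h2 ⊢
          have := mul_nonneg h1.2.le (hz g h2.1)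
          have := mul_nonneg (neg_nonneg.2 h2.2.le) (hz f h1.1)
          nlinarith
      · intro hx
        -- A `t ≥ 0` is sought with `x - t a` in the old cone. Functionals negative at `a` bound `t`
        -- from below, those positive at `a` bound it from above; the largest lower bound works,
        -- since the mixed functionals say that every lower bound is at most every upper bound.
        let T : Finset ℝ := insert 0 (Q.image fun h => h x / h a)
        have hT : T.Nonempty := Finset.insert_nonempty _ _
        have ht0 : 0 ≤ T.max' hT := T.le_max' 0 (Finset.mem_insert_self _ _)
        refine ⟨⟨T.max' hT, ht0⟩, x - (T.max' hT) • a, (Hx _).2 fun h hh => ?_, by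
          change x = (T.max' hT) • a + _
          abel⟩
        rw [map_sub, map_smul, smul_eq_mul, sub_nonneg]
        rcases lt_trichotomy (h a) 0 with h1 | h1 | h1
        · have := T.le_max' (h x / h a) (Finset.mem_insert_of_mem
            (Finset.mem_image_of_mem (fun h => h x / h a) (Finset.mem_filter.2 ⟨hh, h1⟩)))
          rwa [div_le_iff_of_neg h1] at this
        · rw [h1, mul_zero]
          exact hx h (Finset.mem_union_left _ (Finset.mem_filter.2 ⟨hh, h1.ge⟩))
        · rw [← le_div_iff₀ h1]
          refine T.max'_le hT _ fun y hy => ?_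
          rcases Finset.mem_insert.1 hy with rfl | hy
          · exact div_nonneg (hx h (Finset.mem_union_left _
              (Finset.mem_filter.2 ⟨hh, h1.le⟩))) h1.le
          · obtain ⟨g, hg, rfl⟩ := Finset.mem_image.1 hy
            have hga := (Finset.mem_filter.1 hg).2
            have := hx _ (Finset.mem_union_right _ (Finset.mem_image.2
              ⟨(h, g), Finset.mem_product.2 ⟨Finset.mem_filter.2 ⟨hh, h1⟩, hg⟩, rfl⟩))
            simp only [LinearMap.sub_apply, LinearMap.smul_apply, smul_eq_mul] at this
            rw [div_le_iff_of_neg hga, div_mul_eq_mul_div, div_le_iff₀ h1]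
            linarith

/-- The algebraic relative interior of a set. -/
def IsCore (C : Set E) (w : E) : Prop := w ∈ C ∧ ∀ v ∈ C, ∃ ε : ℝ, 0 < ε ∧ w - ε • v ∈ C

theorem exists_pos_mul_le {ι : Type*} (A : Finset ι) (c d : ι → ℝ) (hd : ∀ a ∈ A, 0 < d a) :
    ∃ ε : ℝ, 0 < ε ∧ ∀ a ∈ A, ε * c a ≤ d a := by
  classical
  induction A using Finset.induction_on with
  | empty => exact ⟨1, one_pos, by simp⟩
  | insert a A _ ih =>
    obtain ⟨ε, hε, H⟩ := ih fun b hb => hd b (Finset.mem_insert_of_mem hb)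
    have hda := hd a (Finset.mem_insert_self _ _)
    have h1 : (0 : ℝ) < |c a| + 1 := by positivity
    refine ⟨min ε (d a / (|c a| + 1)), lt_min hε (div_pos hda h1), fun b hb => ?_⟩
    rcases Finset.mem_insert.1 hb with rfl | hb
    · calc _ ≤ min ε (d b / (|c b| + 1)) * (|c b| + 1) :=
          mul_le_mul_of_nonneg_left (by linarith [le_abs_self (c b)])
            (lt_min hε (div_pos hda h1)).le
        _ ≤ d b / (|c b| + 1) * (|c b| + 1) :=
          mul_le_mul_of_nonneg_right (min_le_right _ _) h1.le
        _ = d b := div_mul_cancel₀ _ h1.ne'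
    · rcases le_total (c b) 0 with h0 | h0
      · exact (mul_nonpos_of_nonneg_of_nonpos (lt_min hε (div_pos hda h1)).le h0).trans
          (hd b (Finset.mem_insert_of_mem hb)).le
      · exact (mul_le_mul_of_nonneg_right (min_le_left _ _) h0).trans (H b hb)

theorem isCore_hull {A : Finset E} {d : E → ℝ} (hd : ∀ a ∈ A, 0 < d a) :
    IsCore (PointedCone.hull ℝ (A : Set E) : Set E) (∑ a ∈ A, d a • a) := by
  refine ⟨sum_smul_mem_hull fun a ha => (hd a ha).le, fun v hv => ?_⟩
  obtain ⟨c, hc, rfl⟩ := mem_hull_finset.1 hv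
  obtain ⟨ε, hε, H⟩ := exists_pos_mul_le A c d hd
  refine ⟨ε, hε, mem_hull_finset.2 ⟨fun a => d a - ε * c a, fun a ha => sub_nonneg.2 (H a ha), ?_⟩⟩
  simp [sub_smul, Finset.sum_sub_distrib, Finset.smul_sum, smul_smul]

/-- A small multiple of the sum of all generators can be subtracted from `w`; adding it back makes
every coefficient positive. -/
theorem IsCore.exists_pos {A : Finset E} {w : E}
    (h : IsCore (PointedCone.hull ℝ (A : Set E) : Set E) w) :
    ∃ d : E → ℝ, (∀ a ∈ A, 0 < d a) ∧ w = ∑ a ∈ A, d a • a := by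
  obtain ⟨ε, hε, H⟩ := h.2 (∑ a ∈ A, (1 : ℝ) • a)
    (sum_smul_mem_hull (c := fun _ => 1) fun _ _ => zero_le_one)
  obtain ⟨c, hc, hw⟩ := mem_hull_finset.1 H
  refine ⟨fun a => c a + ε, fun a ha => add_pos_of_nonneg_of_pos (hc a ha) hε, ?_⟩
  rw [sub_eq_iff_eq_add] at hw
  rw [hw]
  simp [add_smul, Finset.sum_add_distrib, Finset.smul_sum]

theorem exists_isCore_hull (A : Finset E) :
    ∃ w, IsCore (PointedCone.hull ℝ (A : Set E) : Set E) w :=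
  ⟨_, isCore_hull (d := fun _ => 1) fun _ _ => one_pos⟩

/-- A face that contains a nonnegative combination contains each generator with a positive
coefficient. -/
theorem hull_inter_of_isFaceOf {A : Finset E} {D : PointedCone ℝ E}
    (hD : D.IsFaceOf (PointedCone.hull ℝ (A : Set E))) :
    D = PointedCone.hull ℝ ((A : Set E) ∩ D) := by
  refine le_antisymm (fun x hx => ?_) (Submodule.span_le.2 fun x hx => hx.2)
  obtain ⟨c, hc, rfl⟩ := mem_hull_finset.1 (hD.le hx)
  classical
  refine Submodule.sum_mem _ fun a ha => ?_
  rcases (hc a ha).eq_or_lt with h0 | h0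
  · rw [← h0, zero_smul]; exact zero_mem _
  · refine PointedCone.smul_mem _ h0.le (Submodule.subset_span ⟨ha, ?_⟩)
    refine hD.mem_of_smul_add_mem (a := c a) (y := ∑ b ∈ A.erase a, c b • b)
      (Submodule.subset_span ha) ?_ h0 (by rwa [Finset.add_sum_erase A (fun b => c b • b) ha])
    exact Submodule.sum_mem _ fun b hb => PointedCone.smul_mem _
      (hc b (Finset.mem_of_mem_erase hb)) (Submodule.subset_span (Finset.mem_of_mem_erase hb))

theorem exists_hull_of_isFaceOf {A : Finset E} {D : PointedCone ℝ E}
    (hD : D.IsFaceOf (PointedCone.hull ℝ (A : Set E))) :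
    ∃ B ⊆ A, D = PointedCone.hull ℝ (B : Set E) := by
  classical
  refine ⟨A.filter (· ∈ D), Finset.filter_subset _ _, ?_⟩
  rw [Finset.coe_filter]
  exact hull_inter_of_isFaceOf hD

/-- The smallest face of a cone that contains a given point. -/
def minFace (C : PointedCone ℝ E) (q : E) (hq : q ∈ C) : PointedCone ℝ E where
  carrier := {x | x ∈ C ∧ ∃ ε : ℝ, 0 < ε ∧ q - ε • x ∈ C}
  zero_mem' := ⟨zero_mem _, 1, one_pos, by simpa⟩
  add_mem' := by
    rintro x y ⟨hx, ε, hε, hx'⟩ ⟨hy, δ, hδ, hy'⟩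
    -- With this constant, `q` minus the multiple of `x + y` is a convex combination of `q - εx` and
    -- `q - δy`.
    refine ⟨add_mem hx hy, ε * δ / (ε + δ), by positivity, ?_⟩
    have : q - (ε * δ / (ε + δ)) • (x + y) =
        (δ / (ε + δ)) • (q - ε • x) + (ε / (ε + δ)) • (q - δ • y) := by
      have h1 : (δ / (ε + δ)) • q + (ε / (ε + δ)) • q = q := by
        rw [← add_smul, ← add_div, add_comm δ, div_self (by positivity), one_smul]
      simp only [smul_sub, smul_add, smul_smul]
      rw [show δ / (ε + δ) * ε = ε * δ / (ε + δ) by ring,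
        show ε / (ε + δ) * δ = ε * δ / (ε + δ) by ring]
      nth_rewrite 1 [← h1]
      abel
    rw [this]
    exact add_mem (PointedCone.smul_mem _ (by positivity) hx')
      (PointedCone.smul_mem _ (by positivity) hy')
  smul_mem' := by
    rintro ⟨r, hr⟩ x ⟨hx, ε, hε, hx'⟩
    refine ⟨PointedCone.smul_mem C hr hx, ?_⟩
    change ∃ ε : ℝ, 0 < ε ∧ q - ε • r • x ∈ C
    have hr0 : (0 : ℝ) ≤ r := hr
    rcases hr0.eq_or_lt with rfl | hr'
    · exact ⟨1, one_pos, by simpa⟩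
    · exact ⟨ε / r, by positivity, by rwa [smul_smul, div_mul_cancel₀ _ hr'.ne']⟩

theorem mem_minFace {C : PointedCone ℝ E} {q : E} {hq : q ∈ C} {x : E} :
    x ∈ minFace C q hq ↔ x ∈ C ∧ ∃ ε : ℝ, 0 < ε ∧ q - ε • x ∈ C := Iff.rfl

theorem self_mem_minFace {C : PointedCone ℝ E} {q : E} (hq : q ∈ C) : q ∈ minFace C q hq :=
  ⟨hq, 1, one_pos, by simp⟩

theorem minFace_isFaceOf {C : PointedCone ℝ E} {q : E} (hq : q ∈ C) :
    (minFace C q hq).IsFaceOf C where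
  le := fun _ h => h.1
  mem_of_smul_add_mem := by
    rintro x y a hx hy ha ⟨_, ε, hε, h⟩
    refine ⟨hx, ε * a, by positivity, ?_⟩
    have : q - (ε * a) • x = (q - ε • (a • x + y)) + ε • y := by
      rw [smul_add, smul_smul]; abel
    rw [this]
    exact add_mem h (PointedCone.smul_mem _ hε.le hy)

theorem isCore_minFace {C : PointedCone ℝ E} {q : E} (hq : q ∈ C) :
    IsCore (minFace C q hq : Set E) q := by
  refine ⟨self_mem_minFace hq, ?_⟩
  rintro v ⟨hv, ε, hε, h⟩
  refine ⟨ε / 2, by positivity, ⟨?_, 1, one_pos, ?_⟩⟩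
  · have : q - (ε / 2) • v = (1 / 2 : ℝ) • q + (1 / 2 : ℝ) • (q - ε • v) := by
      rw [smul_sub, smul_smul, ← add_sub_assoc, ← add_smul]
      norm_num
      ring_nf
    rw [this]
    exact add_mem (PointedCone.smul_mem _ (by norm_num) hq)
      (PointedCone.smul_mem _ (by norm_num) h)
  · rw [one_smul, sub_sub_cancel]
    exact PointedCone.smul_mem _ (by positivity) hv

end Cones

/-! ### Algebraic and topological relative interior of a cone -/

section Interior

variable {E : Type*} [NormedAddCommGroup E] [NormedSpace ℝ E]

/-- The line from `v` through `q` stays in the affine span, so it can be prolonged a little beyond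
`q` inside the cone; rescaling the point `q + t(q - v)` gives `q` minus a multiple of `v`. -/
theorem IsCore.of_mem_intrinsicInterior {σ : PointedCone ℝ E} {q : E}
    (hq : q ∈ intrinsicInterior ℝ (σ : Set E)) : IsCore (σ : Set E) q := by
  have hqσ : q ∈ σ := intrinsicInterior_subset hq
  refine ⟨hqσ, fun v hv => ?_⟩
  obtain ⟨y, hy, rfl⟩ := _root_.mem_intrinsicInterior.1 hq
  have hvS : v ∈ affineSpan ℝ (σ : Set E) := subset_affineSpan ℝ _ hv
  let g : ℝ → affineSpan ℝ (σ : Set E) := fun t =>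
    ⟨t • ((y : E) -ᵥ v) +ᵥ (y : E), AffineSubspace.smul_vsub_vadd_mem _ t y.2 hvS y.2⟩
  have hg : Continuous g := by
    refine Continuous.subtype_mk ?_ _
    simp only [vsub_eq_sub, vadd_eq_add]
    fun_prop
  have hg0 : g 0 = y := by
    apply Subtype.ext
    simp [g]
  have hnear : ∀ᶠ t in nhds (0 : ℝ), g t ∈ (Subtype.val ⁻¹' (σ : Set E) :
      Set (affineSpan ℝ (σ : Set E))) := by
    apply hg.continuousAt
    rw [hg0]
    exact mem_interior_iff_mem_nhds.1 hy
  obtain ⟨δ, hδ, H⟩ := Metric.eventually_nhds_iff.1 hnear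
  have ht := H (y := δ / 2) (by
    rw [Real.dist_eq, sub_zero, abs_of_pos (by positivity)]; linarith)
  have ht' : (δ / 2) • ((y : E) - v) + y ∈ σ := ht
  refine ⟨δ / 2 / (1 + δ / 2), by positivity, ?_⟩
  have : (y : E) - (δ / 2 / (1 + δ / 2)) • v =
      (1 / (1 + δ / 2)) • ((δ / 2) • ((y : E) - v) + y) := by
    have h1 : (1 / (1 + δ / 2)) • ((1 + δ / 2) • (y : E)) = y := by
      rw [smul_smul, one_div_mul_cancel (by positivity), one_smul]
    nth_rewrite 1 [← h1]
    module
  rw [this]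
  exact PointedCone.smul_mem _ (by positivity) ht'

/-- Write `q = εp + c` with `p` in the relative interior and `c` in the cone. The homothety `x ↦ εx
+ c`, whose inverse is `g`, carries the cone into itself and a neighbourhood of `p` to one of `q`.
-/
theorem IsCore.mem_intrinsicInterior [FiniteDimensional ℝ E] {σ : PointedCone ℝ E} {q : E}
    (hq : IsCore (σ : Set E) q) : q ∈ intrinsicInterior ℝ (σ : Set E) := by
  obtain ⟨p, hp⟩ := Set.Nonempty.intrinsicInterior σ.convex ⟨q, hq.1⟩
  obtain ⟨ε, hε, hc⟩ := hq.2 p (intrinsicInterior_subset hp)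
  obtain ⟨p, hp', rfl⟩ := _root_.mem_intrinsicInterior.1 hp
  set c := q - ε • (p : E) with hcdef
  have hsub := subset_affineSpan ℝ (σ : Set E)
  let g : affineSpan ℝ (σ : Set E) → affineSpan ℝ (σ : Set E) := fun x =>
    ⟨ε⁻¹ • ((x : E) -ᵥ c) +ᵥ (0 : E), AffineSubspace.smul_vsub_vadd_mem _ _ x.2 (hsub hc)
      (hsub σ.zero_mem)⟩
  have hg : Continuous g := by
    refine Continuous.subtype_mk ?_ _
    simp only [vsub_eq_sub, vadd_eq_add]
    fun_prop
  refine _root_.mem_intrinsicInterior.2 ⟨⟨q, hsub hq.1⟩, ?_, rfl⟩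
  have hgq : g ⟨q, hsub hq.1⟩ = p := by
    apply Subtype.ext
    simp [g, hcdef, smul_smul, inv_mul_cancel₀ hε.ne']
  have hopen : IsOpen (g ⁻¹' interior (Subtype.val ⁻¹' (σ : Set E))) :=
    isOpen_interior.preimage hg
  refine interior_maximal ?_ hopen (by rw [Set.mem_preimage, hgq]; exact hp')
  intro x hx
  have hx' : ε⁻¹ • ((x : E) - c) + 0 ∈ σ := by
    exact interior_subset (s := (Subtype.val ⁻¹' (σ : Set E) :
      Set (affineSpan ℝ (σ : Set E)))) hx
  have : (x : E) = ε • (ε⁻¹ • ((x : E) - c) + 0) + c := by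
    rw [add_zero, smul_smul, mul_inv_cancel₀ hε.ne', one_smul, sub_add_cancel]
  change (x : E) ∈ σ
  rw [this]
  exact add_mem (PointedCone.smul_mem _ hε.le hx') hc

end Interior

/-! ### The fan of the linearity domains of a minimum of linear functions -/

section CellFan

variable {E E₀ I : Type*} [AddCommGroup E] [Module ℝ E] [AddCommGroup E₀] [Module ℝ E₀]

/-- A minimum `φ` of rational linear functions `χ i` on a set `C`, together with a map `π` to a
space that carries a fan, such that over each cone of the fan the domain where `χ i` is minimal is
cut out by finitely many of the inequalities `χ i ≤ χ γ`. -/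
structure CellData (N : AddSubgroup E) (N₀ : AddSubgroup E₀) (S : Set (Set E₀)) (C : Set E)
    (π : E →ₗ[ℝ] E₀) (χ : I → E →ₗ[ℝ] ℝ) (φ : E → ℝ) : Prop where
  fan : IsFan N₀ S
  salient : ∀ w ∈ C, -w ∈ C → w = 0
  complete : ∀ w ∈ C, ∃ σ ∈ S, π w ∈ σ
  le : ∀ w ∈ C, ∀ i, φ w ≤ χ i w
  attained : ∀ w ∈ C, ∃ i, χ i w = φ w
  rational : ∀ i, ∀ x ∈ N, ∃ r : ℚ, χ i x = r
  preimage : ∀ σ ∈ S, ∃ A : Finset E, (A : Set E) ⊆ N ∧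
    ∀ x, x ∈ PointedCone.hull ℝ (A : Set E) ↔ π x ∈ σ
  cut : ∀ σ ∈ S, ∀ i, ∃ F : Finset I, ∀ w, π w ∈ σ → (∀ γ ∈ F, χ i w ≤ χ γ w) →
    w ∈ C ∧ χ i w = φ w

/-- The points of `C` over `σ` at which all `χ i`, for `i` in `A`, are minimal. -/
def cell (C : Set E) (π : E →ₗ[ℝ] E₀) (χ : I → E →ₗ[ℝ] ℝ) (φ : E → ℝ) (σ : Set E₀)
    (A : Finset I) : Set E :=
  {w | w ∈ C ∧ π w ∈ σ ∧ ∀ i ∈ A, χ i w = φ w}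

/-- The set of all cells. -/
def cells (S : Set (Set E₀)) (C : Set E) (π : E →ₗ[ℝ] E₀) (χ : I → E →ₗ[ℝ] ℝ) (φ : E → ℝ) :
    Set (Set E) :=
  {τ | ∃ σ ∈ S, ∃ A : Finset I, A.Nonempty ∧ τ = cell C π χ φ σ A}

theorem IsFan.exists_coe {N : AddSubgroup E} {S : Set (Set E)} (hS : IsFan N S) {σ : Set E}
    (hσ : σ ∈ S) : ∃ P : PointedCone ℝ E, (P : Set E) = σ := by
  obtain ⟨A, _, h⟩ := hS.rational σ hσ
  exact ⟨_, h.symm⟩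

namespace CellData

variable {N : AddSubgroup E} {N₀ : AddSubgroup E₀} {S : Set (Set E₀)} {C : Set E}
  {π : E →ₗ[ℝ] E₀} {χ : I → E →ₗ[ℝ] ℝ} {φ : E → ℝ}

/-- Finitely many inequalities imply both membership in `C` and minimality; this is what makes a
cell polyhedral although infinitely many indices compete. -/
theorem exists_cut (h : CellData N N₀ S C π χ φ) {σ : Set E₀} (hσ : σ ∈ S) {A : Finset I}
    (hA : A.Nonempty) : ∃ F : Finset I, ∀ w, w ∈ cell C π χ φ σ A ↔
      π w ∈ σ ∧ ∀ i ∈ A, ∀ γ ∈ F, χ i w ≤ χ γ w := by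
  classical
  choose F hF using h.cut σ hσ
  refine ⟨A.biUnion F, fun w => ⟨fun hw => ⟨hw.2.1, fun i hi γ _ => ?_⟩, fun hw => ?_⟩⟩
  · rw [hw.2.2 i hi]
    exact h.le w hw.1 γ
  · have key : ∀ i ∈ A, w ∈ C ∧ χ i w = φ w := fun i hi =>
      hF i w hw.1 fun γ hγ => hw.2 i hi γ (Finset.mem_biUnion.2 ⟨i, hi, hγ⟩)
    obtain ⟨i, hi⟩ := hA
    exact ⟨(key i hi).1, hw.1, fun j hj => (key j hj).2⟩

theorem exists_eq_hull (h : CellData N N₀ S C π χ φ) {τ : Set E} (hτ : τ ∈ cells S C π χ φ) :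
    ∃ B : Finset E, (B : Set E) ⊆ N ∧ τ = (PointedCone.hull ℝ (B : Set E) : Set E) := by
  classical
  obtain ⟨σ, hσ, A, hA, rfl⟩ := hτ
  obtain ⟨F, hF⟩ := h.exists_cut hσ hA
  obtain ⟨B, hB, hBσ⟩ := h.preimage σ hσ
  obtain ⟨B', hB', H⟩ := exists_hull_eq_inter_halfspaces N B hB
    ((A ×ˢ F).image fun p => χ p.2 - χ p.1) (by
      intro f hf a ha
      obtain ⟨p, _, rfl⟩ := Finset.mem_image.1 hf
      obtain ⟨r, hr⟩ := h.rational p.1 a ha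
      obtain ⟨r', hr'⟩ := h.rational p.2 a ha
      exact ⟨r' - r, by simp [hr, hr']⟩)
  refine ⟨B', hB', Set.ext fun w => ?_⟩
  rw [SetLike.mem_coe, H, hF, hBσ]
  refine and_congr_right fun _ => ?_
  simp only [Finset.forall_mem_image, Finset.mem_product, and_imp, Prod.forall,
    LinearMap.sub_apply, sub_nonneg]
  exact ⟨fun H a b ha hb => H a ha b hb, fun H a ha b hb => H a b ha hb⟩

theorem exists_coe (h : CellData N N₀ S C π χ φ) {τ : Set E} (hτ : τ ∈ cells S C π χ φ) :
    ∃ P : PointedCone ℝ E, (P : Set E) = τ := by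
  obtain ⟨B, _, hB⟩ := h.exists_eq_hull hτ
  exact ⟨_, hB.symm⟩

theorem cells_subset {τ : Set E} (hτ : τ ∈ cells S C π χ φ) : τ ⊆ C := by
  obtain ⟨σ, _, A, _, rfl⟩ := hτ
  exact fun w hw => hw.1

/-- A function `χ i` that is minimal at a relative interior point of a cell is minimal on the
cell. -/
theorem eq_of_isCore (h : CellData N N₀ S C π χ φ) {τ : Set E} (hτ : τ ∈ cells S C π χ φ) {w : E}
    (hw : IsCore τ w) {i : I} (hi : χ i w = φ w) {v : E} (hv : v ∈ τ) : χ i v = φ v := by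
  obtain ⟨σ, hσ, A, ⟨j, hj⟩, rfl⟩ := hτ
  obtain ⟨ε, hε, H⟩ := hw.2 v hv
  have h1 := h.le _ H.1 i
  rw [← H.2.2 j hj] at h1
  have h2 := h.le _ hv.1 i
  have h3 := hv.2.2 j hj
  have h4 := hw.1.2.2 j hj
  simp only [map_sub, map_smul, smul_eq_mul] at h1
  nlinarith

/-- Choose `w` in the relative interior of the face. The face is the cell over the smallest base
face containing `π w`, with the defining indices enlarged by all indices of the finite cut that are
also minimal at `w`. -/
theorem face_mem (h : CellData N N₀ S C π χ φ) {P Q : PointedCone ℝ E}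
    (hP : (P : Set E) ∈ cells S C π χ φ) (hQ : Q.IsFaceOf P) : (Q : Set E) ∈ cells S C π χ φ := by
  classical
  obtain ⟨B, hB, hBP⟩ := h.exists_eq_hull hP
  have hBP' : P = PointedCone.hull ℝ (B : Set E) := SetLike.coe_injective hBP
  obtain ⟨B', _, hQB⟩ := exists_hull_of_isFaceOf (hBP' ▸ hQ)
  obtain ⟨w, hw⟩ := exists_isCore_hull B'
  rw [← hQB] at hw
  obtain ⟨σ, hσ, A, hA, hPA⟩ := hP
  obtain ⟨F, hF⟩ := h.exists_cut hσ hA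
  obtain ⟨T, rfl⟩ := h.fan.exists_coe hσ
  have hwP : w ∈ cell C π χ φ T A := by rw [← hPA]; exact hQ.le hw.1
  have hwT : π w ∈ T := hwP.2.1
  obtain ⟨j, hj⟩ := hA
  refine ⟨_, h.fan.face_mem T (minFace T (π w) hwT) hσ (minFace_isFaceOf hwT),
    A ∪ F.filter (fun γ => χ γ w = φ w), ⟨j, Finset.mem_union_left _ hj⟩, Set.ext fun v => ?_⟩
  have hmem : ∀ v, v ∈ P ↔ v ∈ cell C π χ φ T A := fun v => by rw [← hPA]; rfl
  constructor
  · intro hv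
    have hvP : v ∈ cell C π χ φ T A := (hmem v).1 (hQ.le hv)
    obtain ⟨ε, hε, H⟩ := hw.2 v hv
    have H' := (hmem _).1 (hQ.le H)
    refine ⟨hvP.1, mem_minFace.2 ⟨hvP.2.1, ε, hε, by simpa using H'.2.1⟩, fun i hi => ?_⟩
    rcases Finset.mem_union.1 hi with hi | hi
    · exact hvP.2.2 i hi
    · have hi := (Finset.mem_filter.1 hi).2
      have h1 := h.le _ H'.1 i
      rw [← H'.2.2 j hj] at h1
      have h2 := h.le _ hvP.1 i
      have h3 := hvP.2.2 j hj
      have h4 := hwP.2.2 j hj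
      simp only [map_sub, map_smul, smul_eq_mul] at h1
      nlinarith
  · intro hv
    obtain ⟨hvT, ε, hε, hεT⟩ := mem_minFace.1 (SetLike.mem_coe.1 hv.2.1)
    have hvA : v ∈ cell C π χ φ T A :=
      ⟨hv.1, hvT, fun i hi => hv.2.2 i (Finset.mem_union_left _ hi)⟩
    -- `δ` is so small that the inequalities that are strict at `w` survive the subtraction of `δv`.
    -- Then `w` is the sum of a positive multiple of `v` and a point of `P`, so the face property
    -- yields `v`.
    obtain ⟨δ, hδ, Hδ⟩ := exists_pos_mul_le (F.filter fun γ => χ γ w ≠ φ w)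
      (fun γ => χ γ v - φ v) (fun γ => χ γ w - φ w) fun γ hγ => by
        have := (Finset.mem_filter.1 hγ).2
        exact sub_pos.2 (lt_of_le_of_ne (h.le w hwP.1 γ) this.symm)
    have hη : 0 < min ε δ := lt_min hε hδ
    have key : w - (min ε δ) • v ∈ P := by
      rw [hmem, hF]
      constructor
      · have : π (w - min ε δ • v) = (π w - ε • π v) + (ε - min ε δ) • π v := by
          rw [map_sub, map_smul, sub_smul]; abel
        rw [this]
        exact add_mem hεT (PointedCone.smul_mem _ (sub_nonneg.2 (min_le_left _ _)) hvT)
      · intro i hi γ hγ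
        have h1 := hvA.2.2 i hi
        have h2 := hwP.2.2 i hi
        simp only [map_sub, map_smul, smul_eq_mul]
        by_cases hγw : χ γ w = φ w
        · have h3 := hv.2.2 γ (Finset.mem_union_right _ (Finset.mem_filter.2 ⟨hγ, hγw⟩))
          rw [h1, h2, h3, hγw]
        · have h3 := Hδ γ (Finset.mem_filter.2 ⟨hγ, hγw⟩)
          have h4 : min ε δ * (χ γ v - φ v) ≤ δ * (χ γ v - φ v) :=
            mul_le_mul_of_nonneg_right (min_le_right _ _) (sub_nonneg.2 (h.le v hv.1 γ))
          rw [h1, h2]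
          linarith
    exact hQ.mem_of_smul_add_mem ((hmem v).2 hvA) key hη (by
      rw [add_sub_cancel]; exact hw.1)

theorem isFan (h : CellData N N₀ S C π χ φ) : IsFan N (cells S C π χ φ) where
  rational := fun τ hτ => h.exists_eq_hull hτ
  salient := fun τ hτ x hx hx' => h.salient x (cells_subset hτ hx) (cells_subset hτ hx')
  face_mem := fun P Q hP hQ => h.face_mem hP hQ
  inter_isFaceOf := by
    rintro P Q ⟨σ, hσ, A, ⟨j, hj⟩, hP⟩ ⟨σ', hσ', A', -, hQ⟩
    refine ⟨inf_le_left, ?_⟩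
    intro x y a hx hy ha hxy
    have hmemP : ∀ v, v ∈ P ↔ v ∈ cell C π χ φ σ A := fun v => by rw [← hP]; rfl
    have hmemQ : ∀ v, v ∈ Q ↔ v ∈ cell C π χ φ σ' A' := fun v => by rw [← hQ]; rfl
    have h1 := (hmemP x).1 hx
    have h2 := (hmemP y).1 hy
    have h3 := (hmemP _).1 hxy.1
    have h4 := (hmemQ _).1 hxy.2
    refine ⟨hx, (hmemQ x).2 ⟨h1.1, ?_, fun i hi => ?_⟩⟩
    · obtain ⟨T, rfl⟩ := h.fan.exists_coe hσ
      obtain ⟨T', rfl⟩ := h.fan.exists_coe hσ'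
      have := (h.fan.inter_isFaceOf T T' hσ hσ').mem_of_smul_add_mem (x := π x) (y := π y)
        (a := a) h1.2.1 h2.2.1 ha (by
          rw [← map_smul, ← map_add]
          exact ⟨h3.2.1, h4.2.1⟩)
      exact this.2
    -- On `x`, `y` and `ax + y` the minimum is given by the single linear function `χ j`. Another
    -- index that attains it at `ax + y` and is nowhere smaller must attain it at `x`.
    · have e1 := h.le x h1.1 i
      have e2 := h.le y h2.1 i
      have e3 := h4.2.2 i hi
      rw [← h3.2.2 j hj] at e3
      have e4 := h1.2.2 j hj
      have e5 := h2.2.2 j hj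
      simp only [map_add, map_smul, smul_eq_mul] at e3
      nlinarith

theorem sUnion_cells (h : CellData N N₀ S C π χ φ) : ⋃₀ cells S C π χ φ = C := by
  refine subset_antisymm (Set.sUnion_subset fun τ hτ => cells_subset hτ) fun w hw => ?_
  obtain ⟨σ, hσ, hwσ⟩ := h.complete w hw
  obtain ⟨i, hi⟩ := h.attained w hw
  exact ⟨_, ⟨σ, hσ, {i}, Finset.singleton_nonempty i, rfl⟩, hw, hwσ, by simpa⟩

theorem exists_isCore (h : CellData N N₀ S C π χ φ) {w : E} (hw : w ∈ C) :
    ∃ τ ∈ cells S C π χ φ, IsCore τ w := by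
  rw [← h.sUnion_cells] at hw
  obtain ⟨τ, hτ, hwτ⟩ := hw
  obtain ⟨P, rfl⟩ := h.exists_coe hτ
  exact ⟨_, h.face_mem hτ (minFace_isFaceOf hwτ), isCore_minFace hwτ⟩

variable {G : Type*} [Group G]

theorem image_image_inv (ρ : G →* Module.End ℝ E) (g : G) (X : Set E) :
    ρ g '' (ρ g⁻¹ '' X) = X := by
  rw [← Set.image_comp, ← Module.End.coe_mul, ← map_mul, mul_inv_cancel, map_one]
  simp

theorem map_map_inv (ρ : G →* Module.End ℝ E) (g : G) (x : E) : ρ g (ρ g⁻¹ x) = x := by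
  rw [← Module.End.mul_apply, ← map_mul, mul_inv_cancel, map_one]; rfl

theorem map_inv_map (ρ : G →* Module.End ℝ E) (g : G) (x : E) : ρ g⁻¹ (ρ g x) = x := by
  rw [← Module.End.mul_apply, ← map_mul, inv_mul_cancel, map_one]; rfl

theorem image_cell [DecidableEq I] (ρ : G →* Module.End ℝ E) (ρ₀ : G →* Module.End ℝ E₀)
    (hπ : ∀ g w, π (ρ g w) = ρ₀ g (π w)) (hC : ∀ g, ∀ w ∈ C, ρ g w ∈ C) (e : G → I → I)
    (he : ∀ g i, ∀ w ∈ C, χ i w = φ w ↔ χ (e g i) (ρ g w) = φ (ρ g w)) (g : G) (σ : Set E₀)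
    (A : Finset I) :
    ρ g '' cell C π χ φ σ A = cell C π χ φ (ρ₀ g '' σ) (A.image (e g)) := by
  ext w
  constructor
  · rintro ⟨v, hv, rfl⟩
    refine ⟨hC g v hv.1, ⟨π v, hv.2.1, (hπ g v).symm⟩, fun i hi => ?_⟩
    obtain ⟨j, hj, rfl⟩ := Finset.mem_image.1 hi
    exact (he g j v hv.1).1 (hv.2.2 j hj)
  · rintro ⟨hw, ⟨x, hx, hxw⟩, H⟩
    have hvC := hC g⁻¹ w hw
    refine ⟨ρ g⁻¹ w, ⟨hvC, ?_, fun i hi => ?_⟩, map_map_inv ρ g w⟩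
    · rw [hπ, ← hxw, map_inv_map]
      exact hx
    · rw [he g i _ hvC, map_map_inv]
      exact H _ (Finset.mem_image_of_mem _ hi)

/-- First the base cone is moved to one of finitely many representatives. The hypothesis `hfin` then
provides an element acting trivially on the base that moves all indices minimal together with a
given one into a fixed finite set, so that only its subsets remain as index sets. -/
theorem isAdmissible (h : CellData N N₀ S C π χ φ) (ρ : G →* Module.End ℝ E)
    (ρ₀ : G →* Module.End ℝ E₀) (hπ : ∀ g w, π (ρ g w) = ρ₀ g (π w))
    (hC : ∀ g, ∀ w ∈ C, ρ g w ∈ C) (e : G → I → I)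
    (he : ∀ g i, ∀ w ∈ C, χ i w = φ w ↔ χ (e g i) (ρ g w) = φ (ρ g w))
    (hS : IsAdmissible ρ₀ S)
    (hfin : ∀ σ ∈ S, ∃ F : Finset I, ∀ i₀, ∃ g, ρ₀ g = 1 ∧ ∀ w ∈ C, w ≠ 0 → π w ∈ σ →
      χ i₀ w = φ w → ∀ i, χ i w = φ w → e g i ∈ F) :
    IsAdmissible ρ (cells S C π χ φ) := by
  classical
  have himg := image_cell (χ := χ) (φ := φ) (π := π) ρ ρ₀ hπ hC e he
  have hstable : ∀ g : G, ∀ σ ∈ cells S C π χ φ, ρ g '' σ ∈ cells S C π χ φ := by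
    rintro g _ ⟨σ, hσ, A, hA, rfl⟩
    exact ⟨_, hS.stable g σ hσ, _, hA.image (e g), himg g σ A⟩
  refine ⟨hstable, ?_⟩
  obtain ⟨T, hT, hTS, HT⟩ := hS.finite_orbits
  choose! F hF using hfin
  refine ⟨cells S C π χ φ ∩ ({{0}} ∪ ⋃ σ ∈ T, (cell C π χ φ σ) '' (F σ).powerset),
    Set.Finite.inter_of_right ((Set.finite_singleton _).union (hT.biUnion fun σ _ =>
      (Finset.finite_toSet _).image _)) _, Set.inter_subset_left, ?_⟩
  rintro _ ⟨σ, hσ, A, hA, rfl⟩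
  obtain ⟨g, t, ht, rfl⟩ := HT σ hσ
  have h1 : ρ g⁻¹ '' cell C π χ φ (ρ₀ g '' t) A = cell C π χ φ t (A.image (e g⁻¹)) := by
    rw [himg]
    congr 1
    have := image_image_inv ρ₀ g⁻¹ t
    rwa [inv_inv] at this
  obtain ⟨i₀, hi₀⟩ : (A.image (e g⁻¹)).Nonempty := hA.image _
  by_cases h0 : ∃ w ∈ cell C π χ φ t (A.image (e g⁻¹)), w ≠ 0
  · obtain ⟨w, hw, hw0⟩ := h0
    obtain ⟨g', hg', H⟩ := hF t (hTS ht) i₀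
    have h2 : ρ g' '' cell C π χ φ t (A.image (e g⁻¹)) =
        cell C π χ φ t ((A.image (e g⁻¹)).image (e g')) := by
      rw [himg, hg', Module.End.one_eq_id]; simp
    refine ⟨g * g'⁻¹, cell C π χ φ t ((A.image (e g⁻¹)).image (e g')), ⟨?_, Or.inr ?_⟩, ?_⟩
    · exact ⟨t, hTS ht, _, (hA.image _).image _, rfl⟩
    · refine Set.mem_biUnion ht ⟨_, Finset.mem_coe.2 (Finset.mem_powerset.2 fun i hi => ?_), rfl⟩
      obtain ⟨j, hj, rfl⟩ := Finset.mem_image.1 hi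
      exact H w hw.1 hw0 hw.2.1 (hw.2.2 _ hi₀) j (hw.2.2 j hj)
    · rw [← h2, ← h1, map_mul, Module.End.coe_mul, Set.image_comp]
      have := image_image_inv ρ g'⁻¹
        (ρ g⁻¹ '' cell C π χ φ (ρ₀ g '' t) A)
      rw [inv_inv] at this
      rw [this, image_image_inv]
  -- A cell reduced to the origin puts no restriction on its indices, so it is listed separately
  -- among the representatives.
  · have hc : ρ g⁻¹ '' cell C π χ φ (ρ₀ g '' t) A ∈ cells S C π χ φ :=
      hstable g⁻¹ _ ⟨_, hσ, A, hA, rfl⟩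
    obtain ⟨P, hP⟩ := h.exists_coe hc
    have h2 : ρ g⁻¹ '' cell C π χ φ (ρ₀ g '' t) A = {0} := by
      refine Set.eq_singleton_iff_unique_mem.2 ⟨hP ▸ P.zero_mem, fun w hw => ?_⟩
      by_contra hne
      exact h0 ⟨w, h1 ▸ hw, hne⟩
    exact ⟨g, {0}, ⟨h2 ▸ hc, Or.inl rfl⟩, by rw [← h2, image_image_inv]⟩

theorem isCompleteAdmissibleFan (h : CellData N N₀ S C π χ φ) (ρ : G →* Module.End ℝ E)
    (ρ₀ : G →* Module.End ℝ E₀) (hπ : ∀ g w, π (ρ g w) = ρ₀ g (π w))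
    (hC : ∀ g, ∀ w ∈ C, ρ g w ∈ C) (e : G → I → I)
    (he : ∀ g i, ∀ w ∈ C, χ i w = φ w ↔ χ (e g i) (ρ g w) = φ (ρ g w))
    (hS : IsAdmissible ρ₀ S)
    (hfin : ∀ σ ∈ S, ∃ F : Finset I, ∀ i₀, ∃ g, ρ₀ g = 1 ∧ ∀ w ∈ C, w ≠ 0 → π w ∈ σ →
      χ i₀ w = φ w → ∀ i, χ i w = φ w → e g i ∈ F) :
    IsCompleteAdmissibleFan N C ρ (cells S C π χ φ) :=
  ⟨h.isFan, h.sUnion_cells, h.isAdmissible ρ ρ₀ hπ hC e he hS hfin⟩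

end CellData

end CellFan

/-! ### Totally real number fields -/

section Span

variable {E : Type*} [AddCommGroup E] [Module ℝ E] [FiniteDimensional ℝ E]

theorem exists_finset_hull_eq_top {N : AddSubgroup E} (hN : Submodule.span ℝ (N : Set E) = ⊤) :
    ∃ A : Finset E, (A : Set E) ⊆ N ∧ ∀ x, x ∈ PointedCone.hull ℝ (A : Set E) := by
  classical
  obtain ⟨b, hb, hspan, hli⟩ := exists_linearIndependent ℝ (N : Set E)
  have hfin : b.Finite := hli.setFinite
  refine ⟨hfin.toFinset ∪ hfin.toFinset.image fun x => -x, ?_, fun x => ?_⟩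
  · intro x hx
    rcases Finset.mem_union.1 (Finset.mem_coe.1 hx) with hx | hx
    · exact hb (hfin.mem_toFinset.1 hx)
    · obtain ⟨y, hy, rfl⟩ := Finset.mem_image.1 hx
      exact neg_mem (hb (hfin.mem_toFinset.1 hy))
  · have hx : x ∈ Submodule.span ℝ b := by rw [hspan, hN]; trivial
    have h1 : ∀ y ∈ b, y ∈ PointedCone.hull ℝ
        ((hfin.toFinset ∪ hfin.toFinset.image fun x => -x : Finset E) : Set E) := fun y hy =>
      Submodule.subset_span (Finset.mem_coe.2 (Finset.mem_union_left _ (hfin.mem_toFinset.2 hy)))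
    have h2 : ∀ y ∈ b, -y ∈ PointedCone.hull ℝ
        ((hfin.toFinset ∪ hfin.toFinset.image fun x => -x : Finset E) : Set E) := fun y hy =>
      Submodule.subset_span (Finset.mem_coe.2 (Finset.mem_union_right _
        (Finset.mem_image_of_mem _ (hfin.mem_toFinset.2 hy))))
    suffices h : x ∈ PointedCone.hull ℝ
        ((hfin.toFinset ∪ hfin.toFinset.image fun x => -x : Finset E) : Set E) ∧
        -x ∈ PointedCone.hull ℝ
        ((hfin.toFinset ∪ hfin.toFinset.image fun x => -x : Finset E) : Set E) from h.1
    induction hx using Submodule.span_induction with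
    | mem y hy => exact ⟨h1 y hy, h2 y hy⟩
    | zero => simp
    | add y z _ _ hy hz =>
      exact ⟨add_mem hy.1 hz.1, by rw [neg_add]; exact add_mem hy.2 hz.2⟩
    | smul r y _ hy =>
      rcases le_total 0 r with hr | hr
      · exact ⟨PointedCone.smul_mem _ hr hy.1, by
          rw [← smul_neg]; exact PointedCone.smul_mem _ hr hy.2⟩
      · refine ⟨?_, ?_⟩
        · rw [← neg_smul_neg]; exact PointedCone.smul_mem _ (neg_nonneg.2 hr) hy.2
        · rw [← neg_smul]; exact PointedCone.smul_mem _ (neg_nonneg.2 hr) hy.1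

end Span

section Field

variable {F : Type*} [Field F] [NumberField F]

@[simp] theorem emb_apply (x : F) (τ : F →+* ℝ) : (emb x : V F) τ = τ x := rfl

theorem tr_add (x y : V F) : tr (x + y) = tr x + tr y := Finset.sum_add_distrib

theorem tr_smul (r : ℝ) (x : V F) : tr (r • x) = r * tr x := (Finset.mul_sum _ _ _).symm

variable (F) in
/-- The trace as a linear map. -/
def trL : V F →ₗ[ℝ] ℝ where
  toFun := tr
  map_add' := tr_add
  map_smul' := tr_smul

@[simp] theorem trL_apply (x : V F) : trL F x = tr x := rfl

/-- Dedekind's independence of characters, applied to the embeddings restricted to the ring of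
integers; a fixed nonzero element of the ideal is multiplied into the coefficients. -/
theorem eq_zero_of_sum_eq_zero {I : FractionalIdeal (𝓞 F)⁰ F} (hI : I ≠ 0)
    {c : (F →+* ℝ) → ℝ} (h : ∀ x ∈ I, ∑ τ, c τ * τ x = 0) : c = 0 := by
  obtain ⟨x₀, hx₀, hx₀'⟩ : ∃ x ∈ I, x ≠ 0 := by
    by_contra! H
    exact hI (FractionalIdeal.eq_zero_iff.2 H)
  have hinj : Function.Injective fun τ : F →+* ℝ =>
      ((τ.comp (algebraMap (𝓞 F) F) : 𝓞 F →+* ℝ) : 𝓞 F →* ℝ) := by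
    intro τ τ' H
    refine IsLocalization.ringHom_ext (𝓞 F)⁰ (RingHom.ext fun x => ?_)
    exact DFunLike.congr_fun H x
  have hli := (linearIndependent_monoidHom (𝓞 F) ℝ).comp _ hinj
  rw [Fintype.linearIndependent_iff] at hli
  have := hli (fun τ => c τ * τ x₀) (by
    ext r
    have := h ((r : F) * x₀) (by
      rw [← Algebra.smul_def]
      exact Submodule.smul_mem (I : Submodule (𝓞 F) F) r hx₀)
    simp only [Finset.sum_apply, Pi.smul_apply, Function.comp_apply, smul_eq_mul,
      Pi.zero_apply]
    rw [← this]
    refine Finset.sum_congr rfl fun τ _ => ?_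
    rw [map_mul]
    change c τ * τ x₀ * τ r = _
    ring)
  funext τ
  have h1 := this τ
  rcases mul_eq_zero.1 h1 with h1 | h1
  · exact h1
  · exact absurd ((map_eq_zero τ).1 h1) hx₀'

theorem span_emb_image {I : FractionalIdeal (𝓞 F)⁰ F} (hI : I ≠ 0) :
    Submodule.span ℝ ((emb : F →+* V F) '' (I : Submodule (𝓞 F) F)) = ⊤ := by
  classical
  by_contra hne
  obtain ⟨f, hf0, hf⟩ := Submodule.exists_le_ker_of_lt_top _ (lt_top_iff_ne_top.2 hne)
  apply hf0
  have h1 : ∀ x : V F, f x = ∑ τ, x τ * f (Pi.single τ 1) := fun x => by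
    rw [LinearMap.pi_apply_eq_sum_univ f x]
    refine Finset.sum_congr rfl fun τ _ => ?_
    rw [smul_eq_mul]
    congr 2
    funext j
    simp [Pi.single_apply, eq_comm]
  have h2 := eq_zero_of_sum_eq_zero hI (c := fun τ => f (Pi.single τ 1)) fun x hx => by
    have := hf (Submodule.subset_span ⟨x, hx, rfl⟩)
    rw [LinearMap.mem_ker, h1] at this
    rw [← this]
    exact Finset.sum_congr rfl fun τ _ => mul_comm _ _
  refine LinearMap.ext fun x => ?_
  rw [h1]
  simp [fun τ => congrFun h2 τ]

theorem eq_zero_of_tr_eq_zero {I : FractionalIdeal (𝓞 F)⁰ F} (hI : I ≠ 0) {q : V F}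
    (h : ∀ x ∈ I, tr (emb x * q) = 0) : q = 0 :=
  eq_zero_of_sum_eq_zero hI fun x hx => by
    rw [← h x hx]
    exact Finset.sum_congr rfl fun τ _ => mul_comm _ _

/-- The closure of the `ℚ`-space `F` is closed under real scalars, and the integers of `F` already
span over `ℝ`. -/
theorem denseRange_emb : DenseRange (emb : F → V F) := by
  have hK : ∀ q ∈ closure (Set.range (emb : F → V F)), ∀ r : ℝ,
      r • q ∈ closure (Set.range (emb : F → V F)) := by
    intro q hq r
    have hcl : IsClosed {r : ℝ | r • q ∈ closure (Set.range (emb : F → V F))} :=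
      isClosed_closure.preimage (by fun_prop)
    have : Dense (Set.range ((↑) : ℚ → ℝ)) := Rat.isDenseEmbedding_coe_real.dense
    have hsub : Set.range ((↑) : ℚ → ℝ) ⊆
        {r : ℝ | r • q ∈ closure (Set.range (emb : F → V F))} := by
      rintro _ ⟨a, rfl⟩
      refine map_mem_closure (f := fun x : V F => (a : ℝ) • x) (by fun_prop) hq ?_
      rintro _ ⟨x, rfl⟩
      refine ⟨(a : F) * x, funext fun τ => ?_⟩
      simp
    exact hcl.closure_subset_iff.2 hsub (this r)
  intro q
  have hq : q ∈ Submodule.span ℝ ((emb : F →+* V F) ''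
      ((1 : FractionalIdeal (𝓞 F)⁰ F) : Submodule (𝓞 F) F)) := by
    rw [span_emb_image (one_ne_zero (α := FractionalIdeal (𝓞 F)⁰ F))]; trivial
  induction hq using Submodule.span_induction with
  | mem x hx =>
    obtain ⟨y, _, rfl⟩ := hx
    exact subset_closure ⟨y, rfl⟩
  | zero => exact subset_closure ⟨0, map_zero _⟩
  | add x y _ _ hx hy =>
    refine map_mem_closure₂ (f := (· + ·)) (by fun_prop) hx hy ?_
    rintro _ ⟨a, rfl⟩ _ ⟨b, rfl⟩
    exact ⟨a + b, map_add _ _ _⟩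
  | smul r x _ hx => exact hK x hx r

/-! ### Traces, dual lattices and units of a totally real field -/

variable [NumberField.IsTotallyReal F]

variable (F) in
/-- The real embeddings of a totally real field are its complex embeddings. -/
def realEmbeddingEquiv : (F →+* ℝ) ≃ (F →+* ℂ) where
  toFun τ := Complex.ofRealHom.comp τ
  invFun ψ := (IsTotallyReal.complexEmbedding_isReal ψ).embedding
  left_inv τ := by ext x; rfl
  right_inv ψ := by
    ext x
    exact ComplexEmbedding.IsReal.coe_embedding_apply
      (IsTotallyReal.complexEmbedding_isReal ψ) x

theorem tr_emb (x : F) : tr (emb x) = (Algebra.trace ℚ F x : ℝ) := by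
  have h := trace_eq_sum_embeddings (K := ℚ) (L := F) ℂ (x := x)
  have h2 : ∑ σ : F →ₐ[ℚ] ℂ, σ x = ∑ τ : F →+* ℝ, ((τ x : ℝ) : ℂ) :=
    (Fintype.sum_equiv ((realEmbeddingEquiv F).trans (RingHom.equivRatAlgHom F ℂ)) _ _
      fun τ => rfl).symm
  rw [h2, ← Complex.ofReal_sum] at h
  have h3 : ((Algebra.trace ℚ F x : ℝ) : ℂ) = ((∑ τ : F →+* ℝ, τ x : ℝ) : ℂ) := by
    rw [← h]; simp
  exact (Complex.ofReal_injective h3).symm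

theorem prod_embeddings (x : F) : ∏ τ : F →+* ℝ, τ x = (Algebra.norm ℚ x : ℝ) := by
  have h := Algebra.norm_eq_prod_embeddings ℚ ℂ x
  have h2 : ∏ σ : F →ₐ[ℚ] ℂ, σ x = ∏ τ : F →+* ℝ, ((τ x : ℝ) : ℂ) :=
    (Fintype.prod_equiv ((realEmbeddingEquiv F).trans (RingHom.equivRatAlgHom F ℂ)) _ _
      fun τ => rfl).symm
  rw [h2, ← Complex.ofReal_prod] at h
  have h3 : ((Algebra.norm ℚ x : ℝ) : ℂ) = ((∏ τ : F →+* ℝ, τ x : ℝ) : ℂ) := by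
    rw [← h]; simp
  exact (Complex.ofReal_injective h3).symm

theorem nonempty_embeddings : Nonempty (F →+* ℝ) :=
  (realEmbeddingEquiv F).nonempty

theorem tr_emb_mul_rational (x y : F) : ∃ r : ℚ, tr (emb x * emb y) = r :=
  ⟨Algebra.trace ℚ F (x * y), by rw [← map_mul, tr_emb]⟩

theorem tr_emb_mul_integer {I : FractionalIdeal (𝓞 F)⁰ F} (hI : I ≠ 0) {x : F} (hx : x ∈ I)
    {y : V F} (hy : y ∈ dualLattice I) : ∃ z : ℤ, tr (emb x * y) = z := by
  obtain ⟨y, hy, rfl⟩ := hy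
  obtain ⟨z, hz⟩ := (FractionalIdeal.mem_dual (A := ℤ) (K := ℚ) hI).1 hy x hx
  refine ⟨z, ?_⟩
  change tr (emb x * emb y) = z
  rw [← map_mul, tr_emb, mul_comm x y]
  rw [Algebra.traceForm_apply] at hz
  rw [← hz]
  simp

theorem dualLattice_rational {I : FractionalIdeal (𝓞 F)⁰ F} (x : F) {y : V F}
    (hy : y ∈ dualLattice I) : ∃ r : ℚ, tr (emb x * y) = r := by
  obtain ⟨y, _, rfl⟩ := hy
  exact tr_emb_mul_rational x y

theorem span_dualLattice {I : FractionalIdeal (𝓞 F)⁰ F} (hI : I ≠ 0) :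
    Submodule.span ℝ (dualLattice I : Set (V F)) = ⊤ :=
  span_emb_image ((FractionalIdeal.dual_ne_zero ℤ ℚ hI))

theorem finite_isIntegral_abs_le (M : ℝ) :
    {x : F | IsIntegral ℤ x ∧ ∀ τ : F →+* ℝ, |τ x| ≤ M}.Finite := by
  refine (Embeddings.finite_of_norm_le F ℂ M).subset fun x hx => ⟨hx.1, fun ψ => ?_⟩
  obtain ⟨τ, rfl⟩ := (realEmbeddingEquiv F).surjective ψ
  change ‖((τ x : ℝ) : ℂ)‖ ≤ M
  rw [Complex.norm_real]
  exact hx.2 τ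

theorem finite_abs_le (I : FractionalIdeal (𝓞 F)⁰ F) (M : ℝ) :
    {x : F | x ∈ I ∧ ∀ τ : F →+* ℝ, |τ x| ≤ M}.Finite := by
  obtain ⟨a, ha, H⟩ := I.isFractional
  have ha0 : (a : F) ≠ 0 := by
    have := nonZeroDivisors.ne_zero ha
    simpa using this
  refine Set.Finite.of_finite_image (f := fun x => (a : F) * x)
    ((finite_isIntegral_abs_le (F := F) ((∑ τ : F →+* ℝ, |τ a|) * M)).subset ?_)
    (mul_right_injective₀ ha0).injOn
  rintro _ ⟨x, ⟨hx, hM⟩, rfl⟩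
  obtain ⟨z, hz⟩ := H x hx
  refine ⟨?_, fun τ => ?_⟩
  · change IsIntegral ℤ ((a : F) * x)
    rw [← Algebra.smul_def] at *
    rw [← hz]
    exact z.2
  · change |τ ((a : F) * x)| ≤ _
    rw [map_mul, abs_mul]
    exact mul_le_mul (Finset.single_le_sum (f := fun τ : F →+* ℝ => |τ a|)
      (fun τ _ => abs_nonneg _) (Finset.mem_univ τ)) (hM τ) (abs_nonneg _)
      (Finset.sum_nonneg fun τ _ => abs_nonneg _)

theorem finite_units_sq_le (M : ℝ) :
    {u : (𝓞 F)ˣ | ∀ τ : F →+* ℝ, τ (u : F) ^ 2 ≤ M}.Finite := by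
  refine Set.Finite.of_finite_image (f := fun u : (𝓞 F)ˣ => ((u : 𝓞 F) : F))
    ((finite_isIntegral_abs_le (F := F) (M + 1)).subset ?_) ?_
  · rintro _ ⟨u, hu, rfl⟩
    refine ⟨(u : 𝓞 F).2, fun τ => abs_le_of_sq_le_sq ?_ ?_⟩
    · have := hu τ
      have h0 := sq_nonneg (τ (u : F))
      nlinarith
    · have := hu τ
      have h0 := sq_nonneg (τ (u : F))
      linarith
  · intro u _ v _ h
    exact Units.ext (RingOfIntegers.ext h)

theorem unit_embedding_ne_zero (u : (𝓞 F)ˣ) (τ : F →+* ℝ) : τ (u : F) ≠ 0 :=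
  (map_ne_zero τ).2 (RingOfIntegers.coe_ne_zero_iff.2 u.ne_zero)

theorem unit_sq_pos (u : (𝓞 F)ˣ) (τ : F →+* ℝ) : 0 < τ (u : F) ^ 2 := by
  have := unit_embedding_ne_zero u τ
  positivity

/-- The conjugates of the square are positive with product `1`. By `log x ≤ x - 1`, strict unless `x
= 1`, their sum exceeds the degree, and being an integer it exceeds it by at least `1`. -/
theorem tr_unit_sq {u : (𝓞 F)ˣ} (hu : (u : F) ^ 2 ≠ 1) :
    (Fintype.card (F →+* ℝ) : ℝ) + 1 ≤ ∑ τ : F →+* ℝ, τ (u : F) ^ 2 := by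
  have hprod : ∏ τ : F →+* ℝ, τ (u : F) ^ 2 = 1 := by
    rw [Finset.prod_pow, prod_embeddings]
    have := (NumberField.isUnit_iff_norm (K := F) (x := (u : 𝓞 F))).1 u.isUnit
    rw [RingOfIntegers.coe_norm] at this
    rw [← sq_abs]
    have h2 : |((Algebra.norm ℚ ((u : 𝓞 F) : F) : ℚ) : ℝ)| = 1 := by
      rw [← Rat.cast_abs]; exact_mod_cast this
    rw [h2, one_pow]
  have hlog : ∑ τ : F →+* ℝ, Real.log (τ (u : F) ^ 2) = 0 := by
    rw [← Real.log_prod fun τ _ => (unit_sq_pos u τ).ne', hprod, Real.log_one]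
  obtain ⟨τ₀, hτ₀⟩ : ∃ τ : F →+* ℝ, τ (u : F) ^ 2 ≠ 1 := by
    obtain ⟨τ₀⟩ := nonempty_embeddings (F := F)
    refine ⟨τ₀, fun h => hu (τ₀.injective ?_)⟩
    rw [map_pow, h, map_one]
  have hlt : (Fintype.card (F →+* ℝ) : ℝ) < ∑ τ : F →+* ℝ, τ (u : F) ^ 2 := by
    have h1 : ∑ τ : F →+* ℝ, Real.log (τ (u : F) ^ 2) <
        ∑ τ : F →+* ℝ, (τ (u : F) ^ 2 - 1) :=
      Finset.sum_lt_sum (fun τ _ => Real.log_le_sub_one_of_pos (unit_sq_pos u τ))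
        ⟨τ₀, Finset.mem_univ _, Real.log_lt_sub_one_of_pos (unit_sq_pos u τ₀) hτ₀⟩
    rw [hlog, Finset.sum_sub_distrib] at h1
    simpa using h1
  obtain ⟨z, hz⟩ : ∃ z : ℤ, ∑ τ : F →+* ℝ, τ (u : F) ^ 2 = z := by
    have hint : IsIntegral ℤ (Algebra.trace ℚ F ((u : F) ^ 2)) :=
      Algebra.isIntegral_trace ((u : 𝓞 F).2.pow 2)
    obtain ⟨z, hz⟩ := IsIntegrallyClosed.isIntegral_iff.1 hint
    refine ⟨z, ?_⟩
    have := tr_emb ((u : F) ^ 2)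
    simp only [tr, emb_apply, map_pow] at this
    rw [this, ← hz]
    simp
  rw [hz] at hlt ⊢
  have : ((Fintype.card (F →+* ℝ) : ℤ)) < z := by exact_mod_cast hlt
  exact_mod_cast this

end Field

/-! ### The functions `χ_β` and their minimum -/

section Quadratic

variable {F : Type*} [Field F] [NumberField F]

theorem tr_nonneg_of_mem_cone {q : V F} (hq : q ∈ cone F) : 0 ≤ tr q := by
  rcases hq with rfl | hq
  · simp [tr]
  · exact Finset.sum_nonneg fun τ _ => (hq τ).le

/-- A finitely generated cone of totally positive vectors is bounded away from the boundary. -/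
theorem exists_mul_tr_le {A : Finset (V F)} (hA : ∀ a ∈ A, a ∈ cone F) :
    ∃ m : ℝ, 0 < m ∧ ∀ q ∈ PointedCone.hull ℝ (A : Set (V F)),
      0 ≤ tr q ∧ ∀ τ, m * tr q ≤ q τ := by
  classical
  suffices h : ∃ m : ℝ, 0 < m ∧ ∀ a ∈ A, ∀ τ, m * tr a ≤ a τ by
    obtain ⟨m, hm, H⟩ := h
    refine ⟨m, hm, fun q hq => ?_⟩
    induction hq using Submodule.span_induction with
    | mem x hx => exact ⟨tr_nonneg_of_mem_cone (hA x hx), H x hx⟩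
    | zero => simp [tr]
    | add x y _ _ hx hy =>
      rw [tr_add]
      exact ⟨add_nonneg hx.1 hy.1, fun τ => by
        rw [mul_add]; exact add_le_add (hx.2 τ) (hy.2 τ)⟩
    | smul r x _ hx =>
      change 0 ≤ tr ((r : ℝ) • x) ∧ ∀ τ, m * tr ((r : ℝ) • x) ≤ (r : ℝ) * x τ
      rw [tr_smul]
      have hr : (0 : ℝ) ≤ r := r.2
      refine ⟨mul_nonneg hr hx.1, fun τ => ?_⟩
      rw [mul_left_comm]
      exact mul_le_mul_of_nonneg_left (hx.2 τ) hr
  induction A using Finset.induction_on with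
  | empty => exact ⟨1, one_pos, by simp⟩
  | insert a A _ ih =>
    obtain ⟨m, hm, H⟩ := ih fun b hb => hA b (Finset.mem_insert_of_mem hb)
    have ha := hA a (Finset.mem_insert_self _ _)
    obtain ⟨ε, hε, Hε⟩ : ∃ ε : ℝ, 0 < ε ∧ ∀ τ, ε * tr a ≤ a τ := by
      rcases ha with rfl | ha
      · exact ⟨1, one_pos, by simp [tr]⟩
      · obtain ⟨ε, hε, Hε⟩ := exists_pos_mul_le Finset.univ (fun _ : F →+* ℝ => tr a) a
          fun τ _ => ha τ
        exact ⟨ε, hε, fun τ => Hε τ (Finset.mem_univ τ)⟩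
    refine ⟨min m ε, lt_min hm hε, fun b hb τ => ?_⟩
    have h0 := tr_nonneg_of_mem_cone (hA b hb)
    rcases Finset.mem_insert.1 hb with rfl | hb
    · exact (mul_le_mul_of_nonneg_right (min_le_right _ _) h0).trans (Hε τ)
    · exact (mul_le_mul_of_nonneg_right (min_le_left _ _) h0).trans (H b hb τ)

theorem eq_zero_of_tr_eq_zero_of_nonneg {q : V F} (h : tr q = 0) (hq : ∀ τ, 0 ≤ q τ) : q = 0 :=
  funext fun τ => (Finset.sum_eq_zero_iff_of_nonneg fun τ _ => hq τ).1 h τ (Finset.mem_univ τ)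

namespace CuspData

variable {s : ℕ} (D : CuspData F s)

theorem χ_eq_sum (β : D.Bs) (w : W F s) : D.χ β w = ∑ i, ∑ τ : F →+* ℝ,
    (w.1 τ * τ (D.μ i) * τ (β i : F) ^ 2 + 2 * w.2 i τ * τ (D.μ i) * τ (β i : F)) := rfl

/-- `χ_β` as a linear map. -/
def χL (β : D.Bs) : W F s →ₗ[ℝ] ℝ where
  toFun := D.χ β
  map_add' w w' := by
    simp only [χ_eq_sum, ← Finset.sum_add_distrib]
    refine Finset.sum_congr rfl fun i _ => Finset.sum_congr rfl fun τ _ => ?_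
    simp only [Prod.fst_add, Prod.snd_add, Pi.add_apply]
    ring
  map_smul' r w := by
    simp only [χ_eq_sum, RingHom.id_apply, smul_eq_mul, Finset.mul_sum]
    refine Finset.sum_congr rfl fun i _ => Finset.sum_congr rfl fun τ _ => ?_
    simp only [Prod.smul_fst, Prod.smul_snd, Pi.smul_apply, smul_eq_mul]
    ring

@[simp] theorem χL_apply (β : D.Bs) (w : W F s) : D.χL β w = D.χ β w := rfl

@[simp] theorem χ_zero_left (w : W F s) : D.χ 0 w = 0 := by
  simp [χ_eq_sum]

@[simp] theorem χ_zero_right (β : D.Bs) : D.χ β 0 = 0 := (D.χL β).map_zero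

theorem coe_unit_smul (u : (𝓞 F)ˣ) (β : D.Bs) (i : Fin s) :
    (((u • β) i : (D.b : Submodule (𝓞 F) F)) : F) = (u : F) * (β i : F) := by
  change (u : 𝓞 F) • (β i : F) = _
  rw [Algebra.smul_def]

/-- The translation of `(q, l)` to `(q, l + q β)`. -/
def shift (β : D.Bs) (w : W F s) : W F s := (w.1, fun i => w.2 i + w.1 * emb (β i : F))

/-- The translation of `l` by `qβ` produces exactly the cross term of `(γ + β)²`. This is the
cocycle relation behind all twisting, and it moves any chosen index to the origin. -/
theorem χ_shift (β γ : D.Bs) (w : W F s) :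
    D.χ γ (D.shift β w) = D.χ (γ + β) w - D.χ β w := by
  simp only [χ_eq_sum, ← Finset.sum_sub_distrib]
  refine Finset.sum_congr rfl fun i _ => Finset.sum_congr rfl fun τ _ => ?_
  simp only [shift, Pi.add_apply, Submodule.coe_add, map_add, Pi.mul_apply, emb_apply]
  ring

theorem χ_unit (u : (𝓞 F)ˣ) (γ : D.Bs) (w : W F s) :
    D.χ γ (emb (u : F) ^ 2 * w.1, fun i => emb (u : F) * w.2 i) = D.χ (u • γ) w := by
  simp only [χ_eq_sum]
  refine Finset.sum_congr rfl fun i _ => Finset.sum_congr rfl fun τ _ => ?_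
  simp only [coe_unit_smul, Pi.mul_apply, Pi.pow_apply, emb_apply, map_mul]
  ring

variable (U : Subgroup (𝓞 F)ˣ)

theorem action_apply (g : D.Gp U) (w : W F s) : D.action U g w =
    D.shift g.left.toAdd (emb ((g.right : (𝓞 F)ˣ) : F) ^ 2 * w.1,
      fun i => emb ((g.right : (𝓞 F)ˣ) : F) * w.2 i) := rfl

theorem χ_action (g : D.Gp U) (γ : D.Bs) (w : W F s) :
    D.χ γ (D.action U g w) = D.χ ((g.right : (𝓞 F)ˣ) • (γ + g.left.toAdd)) w -
      D.χ ((g.right : (𝓞 F)ˣ) • g.left.toAdd) w := by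
  rw [action_apply, χ_shift, χ_unit, χ_unit]

theorem emb_unit_sq_mul_pos {u : (𝓞 F)ˣ} {q : V F} (hq : ∀ τ, 0 < q τ) (τ : F →+* ℝ) :
    0 < (emb (u : F) ^ 2 * q : V F) τ := by
  have : τ (u : F) ≠ 0 := (map_ne_zero τ).2 (RingOfIntegers.coe_ne_zero_iff.2 u.ne_zero)
  have h1 : 0 < τ (u : F) ^ 2 := by positivity
  exact mul_pos h1 (hq τ)

theorem action_mem_coneTilde (g : D.Gp U) {w : W F s} (hw : w ∈ coneTilde F s) :
    D.action U g w ∈ coneTilde F s := by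
  rcases hw with rfl | hw
  · exact Or.inl (map_zero _)
  · exact Or.inr fun τ => emb_unit_sq_mul_pos hw τ

theorem χ_eq_square (β : D.Bs) (w : W F s) (hw : ∀ τ, 0 < w.1 τ) : D.χ β w =
    ∑ i, ∑ τ : F →+* ℝ, w.1 τ * τ (D.μ i) * (τ (β i : F) + w.2 i τ / w.1 τ) ^ 2 -
      ∑ i, ∑ τ : F →+* ℝ, τ (D.μ i) * w.2 i τ ^ 2 / w.1 τ := by
  simp only [χ_eq_sum, ← Finset.sum_sub_distrib]
  refine Finset.sum_congr rfl fun i _ => Finset.sum_congr rfl fun τ _ => ?_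
  have := (hw τ).ne'
  field_simp
  ring

/-! ### Attainment of the minimum and uniform finiteness -/

variable [NumberField.IsTotallyReal F]

theorem finite_Bs (M : ℝ) : {β : D.Bs | ∀ i, ∀ τ : F →+* ℝ, |τ (β i : F)| ≤ M}.Finite := by
  have h : {x : (D.b : Submodule (𝓞 F) F) | ∀ τ : F →+* ℝ, |τ (x : F)| ≤ M}.Finite := by
    refine Set.Finite.of_finite_image (f := Subtype.val)
      ((finite_abs_le D.b M).subset ?_) Subtype.val_injective.injOn
    rintro _ ⟨x, hx, rfl⟩
    exact ⟨x.2, hx⟩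
  refine (Set.Finite.pi fun _ : Fin s => h).subset fun β hβ => ?_
  exact Set.mem_univ_pi.2 fun i => hβ i

/-- After completing the square, a bound on the sum bounds each square, hence every conjugate of
every coordinate of `β`, and a fractional ideal has only finitely many such elements. -/
theorem finite_χ_le (w : W F s) (hw : ∀ τ, 0 < w.1 τ) (M : ℝ) : {β | D.χ β w ≤ M}.Finite := by
  set K := M + ∑ i, ∑ τ : F →+* ℝ, τ (D.μ i) * w.2 i τ ^ 2 / w.1 τ with hK
  have hpos : ∀ i, ∀ τ : F →+* ℝ, 0 < w.1 τ * τ (D.μ i) := fun i τ =>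
    mul_pos (hw τ) (D.μ_pos i τ)
  set K' := ∑ i, ∑ τ : F →+* ℝ, |K| / (w.1 τ * τ (D.μ i)) with hK'
  set L := ∑ i, ∑ τ : F →+* ℝ, |w.2 i τ / w.1 τ| with hL
  refine (D.finite_Bs (K' + 1 + L)).subset fun β hβ i τ => ?_
  have h1 : ∑ i, ∑ τ : F →+* ℝ, w.1 τ * τ (D.μ i) * (τ (β i : F) + w.2 i τ / w.1 τ) ^ 2 ≤ K := by
    have : D.χ β w ≤ M := hβ
    rw [χ_eq_square D β w hw] at this
    rw [hK]; linarith
  have hsingle : ∀ f : Fin s → (F →+* ℝ) → ℝ, (∀ i τ, 0 ≤ f i τ) → f i τ ≤ ∑ i, ∑ τ, f i τ :=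
    fun f hf => (Finset.single_le_sum (f := fun τ => f i τ) (fun τ _ => hf i τ)
      (Finset.mem_univ τ)).trans (Finset.single_le_sum (f := fun i => ∑ τ, f i τ)
        (fun i _ => Finset.sum_nonneg fun τ _ => hf i τ) (Finset.mem_univ i))
  have h2 : w.1 τ * τ (D.μ i) * (τ (β i : F) + w.2 i τ / w.1 τ) ^ 2 ≤ |K| :=
    ((hsingle (fun i τ => w.1 τ * τ (D.μ i) * (τ (β i : F) + w.2 i τ / w.1 τ) ^ 2)
      fun i τ => mul_nonneg (hpos i τ).le (sq_nonneg _)).trans h1).trans (le_abs_self K)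
  have h3 : (τ (β i : F) + w.2 i τ / w.1 τ) ^ 2 ≤ K' := by
    refine le_trans ?_ (hsingle (fun i τ => |K| / (w.1 τ * τ (D.μ i)))
      fun i τ => div_nonneg (abs_nonneg _) (hpos i τ).le)
    rw [le_div_iff₀ (hpos i τ)]
    linarith
  have h4 : |w.2 i τ / w.1 τ| ≤ L := hsingle (fun i τ => |w.2 i τ / w.1 τ|)
    fun i τ => abs_nonneg _
  have h5 : |τ (β i : F) + w.2 i τ / w.1 τ| ≤ K' + 1 := by
    refine abs_le_of_sq_le_sq (h3.trans ?_) ?_ <;> nlinarith [sq_nonneg (τ (β i : F) + w.2 i τ / w.1 τ)]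
  calc |τ (β i : F)| = |(τ (β i : F) + w.2 i τ / w.1 τ) - w.2 i τ / w.1 τ| := by ring_nf
    _ ≤ |τ (β i : F) + w.2 i τ / w.1 τ| + |w.2 i τ / w.1 τ| := abs_sub _ _
    _ ≤ _ := add_le_add h5 h4

theorem exists_χ_le {w : W F s} (hw : w ∈ coneTilde F s) : ∃ β, ∀ γ, D.χ β w ≤ D.χ γ w := by
  rcases hw with rfl | hw
  · exact ⟨0, by simp⟩
  · obtain ⟨β, hβ, H⟩ := Set.exists_min_image _ (fun β => D.χ β w) (D.finite_χ_le w hw 0)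
      ⟨0, by simp⟩
    refine ⟨β, fun γ => ?_⟩
    by_cases hγ : D.χ γ w ≤ 0
    · exact H γ hγ
    · exact (show D.χ β w ≤ 0 from hβ).trans (not_le.1 hγ).le

theorem φ_eq {w : W F s} {β : D.Bs} (hβ : ∀ γ, D.χ β w ≤ D.χ γ w) : D.φ w = D.χ β w :=
  le_antisymm (ciInf_le ⟨_, by rintro _ ⟨γ, rfl⟩; exact hβ γ⟩ β) (le_ciInf hβ)

theorem φ_le {w : W F s} (hw : w ∈ coneTilde F s) (γ : D.Bs) : D.φ w ≤ D.χ γ w := by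
  obtain ⟨β, hβ⟩ := D.exists_χ_le hw
  rw [D.φ_eq hβ]
  exact hβ γ

theorem exists_χ_eq_φ {w : W F s} (hw : w ∈ coneTilde F s) : ∃ β, D.χ β w = D.φ w := by
  obtain ⟨β, hβ⟩ := D.exists_χ_le hw
  exact ⟨β, (D.φ_eq hβ).symm⟩

theorem isLeast_φ {w : W F s} (hw : w ∈ coneTilde F s) :
    IsLeast (Set.range fun β : D.Bs => D.χ β w) (D.φ w) := by
  obtain ⟨β, hβ⟩ := D.exists_χ_eq_φ hw
  exact ⟨⟨β, hβ⟩, by rintro _ ⟨γ, rfl⟩; exact D.φ_le hw γ⟩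

theorem φ_action (g : D.Gp U) {w : W F s} (hw : w ∈ coneTilde F s) :
    D.φ (D.action U g w) = D.φ w - D.χ ((g.right : (𝓞 F)ˣ) • g.left.toAdd) w := by
  obtain ⟨β, hβ⟩ := D.exists_χ_le hw
  have h1 : ∀ γ, D.χ ((g.right : (𝓞 F)ˣ)⁻¹ • β - g.left.toAdd) (D.action U g w) ≤
      D.χ γ (D.action U g w) := by
    intro γ
    rw [χ_action, χ_action, sub_add_cancel, smul_inv_smul]
    exact sub_le_sub_right (hβ _) _
  rw [D.φ_eq h1, D.φ_eq hβ, χ_action, sub_add_cancel, smul_inv_smul]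

/-- Over a cone of totally positive vectors, the origin of `𝔟 ^ s` competes for the minimum only
with finitely many elements. -/
theorem exists_finset_pos {m : ℝ} (hm : 0 < m) : ∃ T : Finset D.Bs, ∀ w : W F s, 0 ≤ tr w.1 →
    (∀ τ, m * tr w.1 ≤ w.1 τ) → (∀ γ ∈ T, 0 ≤ D.χ γ w) →
    (w.1 = 0 → w.2 = 0) ∧ ∀ γ ∉ T, w.1 ≠ 0 → 0 < D.χ γ w := by
  classical
  -- the coordinate vectors are combinations of vectors in the lattice
  have hspan : ∀ τ : F →+* ℝ, ∃ c : F →₀ ℝ, (∀ x ∈ c.support, x ∈ D.b) ∧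
      ∑ x ∈ c.support, c x • (emb x : V F) = Pi.single τ 1 := by
    intro τ
    have h : (Pi.single τ 1 : V F) ∈ Submodule.span ℝ
        ((emb : F →+* V F) '' (D.b : Submodule (𝓞 F) F)) := by
      rw [span_emb_image D.b_ne_zero]; trivial
    obtain ⟨c, hc, h⟩ := (Finsupp.mem_span_image_iff_linearCombination ℝ).1 h
    exact ⟨c, fun x hx => hc hx, h⟩
  choose c hcb hc using hspan
  let pt : Fin s → ↥(D.b : Submodule (𝓞 F) F) → D.Bs := fun i x => Pi.single i x
  have hpt : ∀ i x (w : W F s), D.χ (pt i x) w = ∑ τ : F →+* ℝ,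
      (w.1 τ * τ (D.μ i) * τ (x : F) ^ 2 + 2 * w.2 i τ * τ (D.μ i) * τ (x : F)) := by
    intro i x w
    rw [χ_eq_sum, Finset.sum_eq_single i]
    · simp [pt]
    · intro j _ hj
      simp [pt, hj]
    · simp
  let Cst : Fin s → F → ℝ := fun i x => ∑ τ : F →+* ℝ, τ (D.μ i) * τ x ^ 2
  have hCst : ∀ i x, 0 ≤ Cst i x := fun i x => Finset.sum_nonneg fun τ _ =>
    mul_nonneg (D.μ_pos i τ).le (sq_nonneg _)
  -- The conditions at `±x`, for the lattice vectors `x` that generate the coordinate vectors, bound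
  -- `|∑ l μ x|` by `Cst · tr q`. Combining them with the coefficients `c` gives the bound `M · tr
  -- q` for each coordinate of `lμ`.
  let M : ℝ := ∑ i, ∑ τ : F →+* ℝ, ∑ x ∈ (c τ).support, |c τ x| * Cst i x
  have hM0 : 0 ≤ M := Finset.sum_nonneg fun i _ => Finset.sum_nonneg fun τ _ =>
    Finset.sum_nonneg fun x _ => mul_nonneg (abs_nonneg _) (hCst i x)
  -- After division by `tr q`, each summand of `χ` is at least `e x² - 2Mx` with `e = m τ(μ)` and `x
  -- = |τ(γ)|`, whose minimum is `-M²/e`. So `-K` bounds the sum of all these expressions from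
  -- below.
  let K : ℝ := ∑ i, ∑ τ : F →+* ℝ, M ^ 2 / (m * τ (D.μ i))
  have hmμ : ∀ i, ∀ τ : F →+* ℝ, 0 < m * τ (D.μ i) := fun i τ => mul_pos hm (D.μ_pos i τ)
  have hKt : ∀ i, ∀ τ : F →+* ℝ, 0 ≤ M ^ 2 / (m * τ (D.μ i)) := fun i τ =>
    div_nonneg (sq_nonneg _) (hmμ i τ).le
  have hK0 : 0 ≤ K := Finset.sum_nonneg fun i _ => Finset.sum_nonneg fun τ _ => hKt i τ
  -- If one `x` exceeds `R`, then `x ≥ 1` and `ex - 2M ≥ K + 1`, so this single summand outweighs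
  -- the possible loss `K` from the others.
  let R : ℝ := ∑ i, ∑ τ : F →+* ℝ, (K + 1 + 2 * M) / (m * τ (D.μ i)) + 1
  have hR : ∀ i, ∀ τ : F →+* ℝ, (K + 1 + 2 * M) / (m * τ (D.μ i)) ≤ R - 1 := by
    intro i τ
    have h0 : ∀ i, ∀ τ : F →+* ℝ, 0 ≤ (K + 1 + 2 * M) / (m * τ (D.μ i)) := fun i τ =>
      div_nonneg (by positivity) (hmμ i τ).le
    have := (Finset.single_le_sum (f := fun τ : F →+* ℝ => (K + 1 + 2 * M) / (m * τ (D.μ i)))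
      (fun τ _ => h0 i τ) (Finset.mem_univ τ)).trans (Finset.single_le_sum
        (f := fun i => ∑ τ : F →+* ℝ, (K + 1 + 2 * M) / (m * τ (D.μ i)))
        (fun i _ => Finset.sum_nonneg fun τ _ => h0 i τ) (Finset.mem_univ i))
    simp only [R, add_sub_cancel_right]
    exact this
  let T₁ : Finset D.Bs := Finset.univ.biUnion fun i => Finset.univ.biUnion fun τ =>
    (c τ).support.attach.biUnion fun x => {pt i ⟨x, hcb τ x x.2⟩, pt i (-⟨x, hcb τ x x.2⟩)}
  have hT₁ : ∀ i τ x (hx : x ∈ (c τ).support), pt i ⟨x, hcb τ x hx⟩ ∈ T₁ ∧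
      pt i (-⟨x, hcb τ x hx⟩) ∈ T₁ := by
    intro i τ x hx
    simp only [T₁, Finset.mem_biUnion, Finset.mem_univ, true_and, Finset.mem_attach,
      Finset.mem_insert, Finset.mem_singleton]
    exact ⟨⟨i, τ, ⟨x, hx⟩, Or.inl rfl⟩, ⟨i, τ, ⟨x, hx⟩, Or.inr rfl⟩⟩
  refine ⟨T₁ ∪ (D.finite_Bs R).toFinset, fun w ht hw hT => ?_⟩
  have hw0 : ∀ τ, 0 ≤ w.1 τ := fun τ => (mul_nonneg hm.le ht).trans (hw τ)
  have hwt : ∀ τ, w.1 τ ≤ tr w.1 := fun τ =>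
    Finset.single_le_sum (f := w.1) (fun τ _ => hw0 τ) (Finset.mem_univ τ)
  have hB : ∀ i τ, ∀ x ∈ (c τ).support,
      |∑ υ : F →+* ℝ, w.2 i υ * υ (D.μ i) * υ x| ≤ Cst i x * tr w.1 := by
    intro i τ x hx
    have h1 := hT _ (Finset.mem_union_left _ (hT₁ i τ x hx).1)
    have h2 := hT _ (Finset.mem_union_left _ (hT₁ i τ x hx).2)
    rw [hpt, Finset.sum_add_distrib] at h1 h2
    simp only [Submodule.coe_neg, map_neg, even_two, Even.neg_pow, mul_neg,
      Finset.sum_neg_distrib] at h2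
    have h3 : ∑ υ : F →+* ℝ, w.1 υ * υ (D.μ i) * υ x ^ 2 ≤ Cst i x * tr w.1 := by
      rw [Finset.sum_mul]
      refine Finset.sum_le_sum fun υ _ => ?_
      rw [mul_assoc, mul_comm]
      exact mul_le_mul_of_nonneg_left (hwt υ) (mul_nonneg (D.μ_pos i υ).le (sq_nonneg _))
    have h4 : ∑ υ : F →+* ℝ, 2 * w.2 i υ * υ (D.μ i) * υ x =
        2 * ∑ υ : F →+* ℝ, w.2 i υ * υ (D.μ i) * υ x := by
      rw [Finset.mul_sum]
      exact Finset.sum_congr rfl fun υ _ => by ring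
    rw [h4] at h1 h2
    have h5 := mul_nonneg (hCst i x) ht
    rw [abs_le]
    constructor <;> linarith
  have hl : ∀ i τ, |w.2 i τ * τ (D.μ i)| ≤ M * tr w.1 := by
    intro i τ
    have h1 : w.2 i τ * τ (D.μ i) =
        ∑ x ∈ (c τ).support, c τ x * ∑ υ : F →+* ℝ, w.2 i υ * υ (D.μ i) * υ x := by
      have h2 : ∀ υ : F →+* ℝ, ∑ x ∈ (c τ).support, c τ x * υ x = if υ = τ then 1 else 0 := by
        intro υ
        have := congrFun (hc τ) υ
        simpa [Pi.single_apply] using this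
      simp only [Finset.mul_sum]
      rw [Finset.sum_comm]
      have h3 : ∀ υ : F →+* ℝ, ∑ x ∈ (c τ).support, c τ x * (w.2 i υ * υ (D.μ i) * υ x) =
          w.2 i υ * υ (D.μ i) * if υ = τ then 1 else 0 := by
        intro υ
        rw [← h2, Finset.mul_sum]
        exact Finset.sum_congr rfl fun x _ => by ring
      simp [h3]
    rw [h1]
    calc _ ≤ ∑ x ∈ (c τ).support, |c τ x * ∑ υ : F →+* ℝ, w.2 i υ * υ (D.μ i) * υ x| :=
          Finset.abs_sum_le_sum_abs _ _
      _ ≤ ∑ x ∈ (c τ).support, |c τ x| * Cst i x * tr w.1 := Finset.sum_le_sum fun x hx => by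
          rw [abs_mul, mul_assoc]
          exact mul_le_mul_of_nonneg_left (hB i τ x hx) (abs_nonneg _)
      _ = (∑ x ∈ (c τ).support, |c τ x| * Cst i x) * tr w.1 := (Finset.sum_mul _ _ _).symm
      _ ≤ M * tr w.1 := by
          refine mul_le_mul_of_nonneg_right ?_ ht
          have h0 : ∀ i, ∀ τ : F →+* ℝ, 0 ≤ ∑ x ∈ (c τ).support, |c τ x| * Cst i x :=
            fun i τ => Finset.sum_nonneg fun x _ => mul_nonneg (abs_nonneg _) (hCst i x)
          exact (Finset.single_le_sum (f := fun τ => ∑ x ∈ (c τ).support, |c τ x| * Cst i x)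
            (fun τ _ => h0 i τ) (Finset.mem_univ τ)).trans (Finset.single_le_sum
              (f := fun i => ∑ τ : F →+* ℝ, ∑ x ∈ (c τ).support, |c τ x| * Cst i x)
              (fun i _ => Finset.sum_nonneg fun τ _ => h0 i τ) (Finset.mem_univ i))
  constructor
  · intro h0
    funext i τ
    have h1 := hl i τ
    rw [h0, show tr (0 : V F) = 0 by simp [tr], mul_zero] at h1
    have h2 := abs_eq_zero.1 (le_antisymm h1 (abs_nonneg _))
    exact (mul_eq_zero.1 h2).resolve_right (D.μ_pos i τ).ne'
  · intro γ hγ hne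
    have ht' : 0 < tr w.1 := lt_of_le_of_ne ht fun h0 =>
      hne (eq_zero_of_tr_eq_zero_of_nonneg h0.symm hw0)
    have hγ' : ¬ ∀ i, ∀ τ : F →+* ℝ, |τ (γ i : F)| ≤ R := fun h =>
      hγ (Finset.mem_union_right _ ((Set.Finite.mem_toFinset _).2 h))
    push Not at hγ'
    obtain ⟨i₀, τ₀, h₀⟩ := hγ'
    have hterm : ∀ i, ∀ τ : F →+* ℝ, tr w.1 * (m * τ (D.μ i) * |τ (γ i : F)| ^ 2 -
        2 * M * |τ (γ i : F)|) ≤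
        w.1 τ * τ (D.μ i) * τ (γ i : F) ^ 2 + 2 * w.2 i τ * τ (D.μ i) * τ (γ i : F) := by
      intro i τ
      have h1 : m * tr w.1 * (τ (D.μ i) * τ (γ i : F) ^ 2) ≤
          w.1 τ * (τ (D.μ i) * τ (γ i : F) ^ 2) :=
        mul_le_mul_of_nonneg_right (hw τ) (mul_nonneg (D.μ_pos i τ).le (sq_nonneg _))
      have h2 : -(M * tr w.1 * |τ (γ i : F)|) ≤ w.2 i τ * τ (D.μ i) * τ (γ i : F) := by
        have h3 := mul_le_mul_of_nonneg_right (hl i τ) (abs_nonneg (τ (γ i : F)))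
        rw [← abs_mul] at h3
        exact (neg_le_neg h3).trans (neg_abs_le _)
      rw [sq_abs]
      nlinarith
    have hlow : ∀ i, ∀ τ : F →+* ℝ, -(M ^ 2 / (m * τ (D.μ i))) ≤
        m * τ (D.μ i) * |τ (γ i : F)| ^ 2 - 2 * M * |τ (γ i : F)| := by
      intro i τ
      have h1 := hmμ i τ
      have h2 : m * τ (D.μ i) * |τ (γ i : F)| ^ 2 - 2 * M * |τ (γ i : F)| +
          M ^ 2 / (m * τ (D.μ i)) = (m * τ (D.μ i) * |τ (γ i : F)| - M) ^ 2 /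
            (m * τ (D.μ i)) := by
        have h3 : ∀ e x : ℝ, 0 < e → e * x ^ 2 - 2 * M * x + M ^ 2 / e = (e * x - M) ^ 2 / e := by
          intro e x he
          field_simp
          ring
        exact h3 _ _ h1
      have h3 : 0 ≤ (m * τ (D.μ i) * |τ (γ i : F)| - M) ^ 2 / (m * τ (D.μ i)) := by positivity
      linarith
    have hbig : K < m * τ₀ (D.μ i₀) * |τ₀ (γ i₀ : F)| ^ 2 - 2 * M * |τ₀ (γ i₀ : F)| := by
      have h1 := hmμ i₀ τ₀
      have h2 := hR i₀ τ₀
      have h3 : (K + 1 + 2 * M) / (m * τ₀ (D.μ i₀)) ≤ |τ₀ (γ i₀ : F)| := by linarith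
      rw [div_le_iff₀ h1] at h3
      have h4 : 1 ≤ |τ₀ (γ i₀ : F)| := by
        have : 0 ≤ (K + 1 + 2 * M) / (m * τ₀ (D.μ i₀)) := div_nonneg (by positivity) h1.le
        linarith
      have h5 : K + 1 ≤ m * τ₀ (D.μ i₀) * |τ₀ (γ i₀ : F)| - 2 * M := by linarith
      have h6 := mul_le_mul h4 h5 (by positivity) (by linarith)
      linarith
    have hsum : -K < ∑ i, ∑ τ : F →+* ℝ,
        (m * τ (D.μ i) * |τ (γ i : F)| ^ 2 - 2 * M * |τ (γ i : F)|) - K := by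
      have h1 : ∑ i, ∑ τ : F →+* ℝ, (m * τ (D.μ i) * |τ (γ i : F)| ^ 2 -
          2 * M * |τ (γ i : F)| + M ^ 2 / (m * τ (D.μ i))) =
          ∑ i, ∑ τ : F →+* ℝ, (m * τ (D.μ i) * |τ (γ i : F)| ^ 2 - 2 * M * |τ (γ i : F)|) + K := by
        simp only [Finset.sum_add_distrib, K]
      have h0 : ∀ i, ∀ τ : F →+* ℝ, 0 ≤ m * τ (D.μ i) * |τ (γ i : F)| ^ 2 -
          2 * M * |τ (γ i : F)| + M ^ 2 / (m * τ (D.μ i)) := fun i τ => by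
        linarith [hlow i τ]
      have h2 := (Finset.single_le_sum (f := fun τ : F →+* ℝ => m * τ (D.μ i₀) *
          |τ (γ i₀ : F)| ^ 2 - 2 * M * |τ (γ i₀ : F)| + M ^ 2 / (m * τ (D.μ i₀)))
        (fun τ _ => h0 i₀ τ) (Finset.mem_univ τ₀)).trans (Finset.single_le_sum
          (f := fun i => ∑ τ : F →+* ℝ, (m * τ (D.μ i) * |τ (γ i : F)| ^ 2 -
          2 * M * |τ (γ i : F)| + M ^ 2 / (m * τ (D.μ i))))
          (fun i _ => Finset.sum_nonneg fun τ _ => h0 i τ) (Finset.mem_univ i₀))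
      rw [h1] at h2
      have h3 := hKt i₀ τ₀
      linarith
    rw [χ_eq_sum]
    calc (0 : ℝ) < tr w.1 * ∑ i, ∑ τ : F →+* ℝ,
          (m * τ (D.μ i) * |τ (γ i : F)| ^ 2 - 2 * M * |τ (γ i : F)|) :=
          mul_pos ht' (by linarith)
      _ ≤ _ := by
          simp only [Finset.mul_sum]
          exact Finset.sum_le_sum fun i _ => Finset.sum_le_sum fun τ _ => by
            have := hterm i τ
            simpa only [Finset.mul_sum] using this

end CuspData

end Quadratic

/-! ### The fan `tildeFan S` and the polarization function `φ` -/

section TildeFan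

variable {F : Type*} [Field F] [NumberField F]

namespace CuspData

variable {s : ℕ}

/-- The rational functionals on `(F ⊗ ℝ) × (F ⊗ ℝ) ^ s`. -/
def pairL : (F × (Fin s → F)) →ₗ[ℚ] (W F s →ₗ[ℝ] ℝ) where
  toFun p :=
    { toFun := fun w => pairing p.1 p.2 w
      map_add' := fun w w' => by
        simp only [pairing, Prod.fst_add, Prod.snd_add, Pi.add_apply, mul_add, tr_add,
          Finset.sum_add_distrib]
        ring
      map_smul' := fun r w => by
        simp only [pairing, Prod.smul_fst, Prod.smul_snd, Pi.smul_apply, mul_smul_comm, tr_smul,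
          RingHom.id_apply, smul_eq_mul, mul_add, Finset.mul_sum] }
  map_add' p p' := by
    refine LinearMap.ext fun w => ?_
    simp only [LinearMap.coe_mk, AddHom.coe_mk, LinearMap.add_apply, pairing, Prod.fst_add,
      Prod.snd_add, Pi.add_apply, map_add, add_mul, tr_add, Finset.sum_add_distrib]
    ring
  map_smul' r p := by
    refine LinearMap.ext fun w => ?_
    have h : ∀ x : F, (emb ((r : F) * x) : V F) = (r : ℝ) • emb x := fun x => by
      funext τ
      simp
    simp only [LinearMap.coe_mk, AddHom.coe_mk, LinearMap.smul_apply, pairing, Prod.smul_fst,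
      Prod.smul_snd, Pi.smul_apply, h, smul_mul_assoc, tr_smul, RingHom.id_apply, Rat.smul_def,
      mul_add, Finset.mul_sum]

@[simp] theorem pairL_apply (p : F × (Fin s → F)) (w : W F s) :
    pairL p w = pairing p.1 p.2 w := rfl

theorem pairing_nsmul (n : ℕ) (p : F × (Fin s → F)) (w : W F s) :
    pairing (n • p).1 (n • p).2 w = n * pairing p.1 p.2 w := by
  have := congrArg (fun f : W F s →ₗ[ℝ] ℝ => f w) (map_nsmul pairL n p)
  simpa using this

variable (D : CuspData F s)

/-- The coefficients of `χ_β`. -/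
def χCoeff (β : D.Bs) : F × (Fin s → F) :=
  (∑ i, D.μ i * (β i : F) ^ 2, fun i => 2 * D.μ i * (β i : F))

theorem χ_eq_pairing (β : D.Bs) (w : W F s) :
    D.χ β w = pairing (D.χCoeff β).1 (D.χCoeff β).2 w := by
  simp only [χ, pairing, χCoeff, map_sum, Finset.sum_mul]
  have : tr (∑ i, emb (D.μ i * (β i : F) ^ 2) * w.1) =
      ∑ i, tr (emb (D.μ i * (β i : F) ^ 2) * w.1) := map_sum (trL F) _ _
  rw [this, ← Finset.sum_add_distrib]
  refine Finset.sum_congr rfl fun i _ => ?_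
  rw [← tr_add]
  congr 1
  funext τ
  simp only [Pi.add_apply, Pi.mul_apply, Pi.pow_apply, emb_apply, map_mul, map_pow, map_ofNat]
  simp only [Pi.ofNat_apply]
  ring

theorem a_ne_zero : D.a ≠ 0 := mul_ne_zero D.b_ne_zero D.c_ne_zero

theorem X_ne_zero : D.X ≠ 0 := by
  refine mul_ne_zero D.a_ne_zero fun h => D.b_ne_zero ?_
  have := D.b_le
  rw [h] at this
  exact le_antisymm this (FractionalIdeal.zero_le _)

/-- One factor `β` together with `μ` lies in `𝔞 = 𝔟𝔠`; the other one is regarded as an element of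
`𝔟'` through `𝔟 ⊆ 𝔟'`. -/
theorem χCoeff_fst_mem (β : D.Bs) : (D.χCoeff β).1 ∈ D.X := by
  change ∑ i, D.μ i * (β i : F) ^ 2 ∈ (D.X : Submodule (𝓞 F) F)
  refine Submodule.sum_mem _ fun i _ => ?_
  have h1 : (β i : F) * D.μ i ∈ D.a := FractionalIdeal.mul_mem_mul (β i).2 (D.μ_mem i)
  have h2 : (β i : F) * D.μ i * (β i : F) ∈ D.X :=
    FractionalIdeal.mul_mem_mul h1 (D.b_le (β i).2)
  rw [show D.μ i * (β i : F) ^ 2 = (β i : F) * D.μ i * (β i : F) by ring]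
  exact h2

theorem χCoeff_snd_mem (β : D.Bs) (i : Fin s) : (D.χCoeff β).2 i ∈ D.a := by
  have h1 : (β i : F) * D.μ i ∈ D.a := FractionalIdeal.mul_mem_mul (β i).2 (D.μ_mem i)
  have : (D.χCoeff β).2 i = (β i : F) * D.μ i + (β i : F) * D.μ i := by
    simp only [χCoeff]; ring
  rw [this]
  exact Submodule.add_mem (D.a : Submodule (𝓞 F) F) h1 h1

variable [NumberField.IsTotallyReal F]

theorem pairing_rational (p : F × (Fin s → F)) {w : W F s} (hw : w ∈ D.latticeTilde) :
    ∃ r : ℚ, pairing p.1 p.2 w = r := by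
  obtain ⟨r, hr⟩ := dualLattice_rational p.1 hw.1
  choose f hf using fun i => dualLattice_rational (p.2 i) (hw.2 i (Set.mem_univ i))
  exact ⟨r + ∑ i, f i, by simp only [pairing, hr, hf]; push_cast; rfl⟩

theorem pairing_integer {p : F × (Fin s → F)} (h1 : p.1 ∈ D.X) (h2 : ∀ i, p.2 i ∈ D.a)
    {w : W F s} (hw : w ∈ D.latticeTilde) : ∃ z : ℤ, pairing p.1 p.2 w = z := by
  obtain ⟨z, hz⟩ := tr_emb_mul_integer D.X_ne_zero h1 hw.1
  choose f hf using fun i => tr_emb_mul_integer D.a_ne_zero (h2 i) (hw.2 i (Set.mem_univ i))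
  exact ⟨z + ∑ i, f i, by simp only [pairing, hz, hf]; push_cast; rfl⟩

/-- The full preimage of a cone is generated by its generators, placed at `l = 0`, together with
lattice vectors whose nonnegative combinations fill each fibre coordinate. -/
theorem exists_preimage_hull {A : Finset (V F)} (hA : (A : Set (V F)) ⊆ D.lattice) :
    ∃ A' : Finset (W F s), (A' : Set (W F s)) ⊆ D.latticeTilde ∧
      ∀ w, w ∈ PointedCone.hull ℝ (A' : Set (W F s)) ↔
        w.1 ∈ PointedCone.hull ℝ (A : Set (V F)) := by
  classical
  obtain ⟨B, hB, hBtop⟩ := exists_finset_hull_eq_top (span_dualLattice D.a_ne_zero)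
  let A₁ : Finset (W F s) := A.image fun a => (a, 0)
  let A₂ : Finset (W F s) := Finset.univ.biUnion fun i => B.image fun b => (0, Pi.single i b)
  have hA₁ : ∀ a ∈ A, ((a, 0) : W F s) ∈ A₁ ∪ A₂ := fun a ha =>
    Finset.mem_union_left _ (Finset.mem_image_of_mem _ ha)
  have hA₂ : ∀ i, ∀ b ∈ B, ((0, Pi.single i b) : W F s) ∈ A₁ ∪ A₂ := fun i b hb =>
    Finset.mem_union_right _ (Finset.mem_biUnion.2 ⟨i, Finset.mem_univ i,
      Finset.mem_image_of_mem _ hb⟩)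
  refine ⟨A₁ ∪ A₂, fun x hx => ?_, fun w => ⟨fun hw => ?_, fun hw => ?_⟩⟩
  · rcases Finset.mem_union.1 (Finset.mem_coe.1 hx) with hx | hx
    · obtain ⟨a, ha, rfl⟩ := Finset.mem_image.1 hx
      exact ⟨hA ha, fun i _ => zero_mem (dualLattice D.a)⟩
    · obtain ⟨i, _, hx⟩ := Finset.mem_biUnion.1 hx
      obtain ⟨b, hb, rfl⟩ := Finset.mem_image.1 hx
      refine ⟨zero_mem _, fun j _ => ?_⟩
      by_cases hj : j = i
      · subst hj; simpa using hB hb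
      · simp only [ne_eq, hj, not_false_eq_true, Pi.single_eq_of_ne]
        exact zero_mem (dualLattice D.a)
  · have hle : PointedCone.hull ℝ ((A₁ ∪ A₂ : Finset (W F s)) : Set (W F s)) ≤
        (PointedCone.hull ℝ (A : Set (V F))).comap (LinearMap.fst ℝ (V F) (Fin s → V F)) := by
      refine Submodule.span_le.2 fun x hx => ?_
      rcases Finset.mem_union.1 (Finset.mem_coe.1 hx) with hx | hx
      · obtain ⟨a, ha, rfl⟩ := Finset.mem_image.1 hx
        exact Submodule.subset_span (s := (A : Set (V F))) ha
      · obtain ⟨i, _, hx⟩ := Finset.mem_biUnion.1 hx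
        obtain ⟨b, hb, rfl⟩ := Finset.mem_image.1 hx
        exact zero_mem (PointedCone.hull ℝ (A : Set (V F)))
    exact hle hw
  · have h1 : PointedCone.hull ℝ (A : Set (V F)) ≤
        (PointedCone.hull ℝ ((A₁ ∪ A₂ : Finset (W F s)) : Set (W F s))).comap
          (LinearMap.inl ℝ (V F) (Fin s → V F)) :=
      Submodule.span_le.2 fun a ha =>
        Submodule.subset_span (s := ((A₁ ∪ A₂ : Finset (W F s)) : Set (W F s))) (hA₁ a ha)
    have h2 : ∀ i, PointedCone.hull ℝ (B : Set (V F)) ≤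
        (PointedCone.hull ℝ ((A₁ ∪ A₂ : Finset (W F s)) : Set (W F s))).comap
          ((LinearMap.inr ℝ (V F) (Fin s → V F)).comp
            (LinearMap.single ℝ (fun _ : Fin s => V F) i)) := fun i =>
      Submodule.span_le.2 fun b hb =>
        Submodule.subset_span (s := ((A₁ ∪ A₂ : Finset (W F s)) : Set (W F s))) (hA₂ i b hb)
    have h3 : w = LinearMap.inl ℝ (V F) (Fin s → V F) w.1 +
        ∑ i, (LinearMap.inr ℝ (V F) (Fin s → V F)).comp
          (LinearMap.single ℝ (fun _ : Fin s => V F) i) (w.2 i) := by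
      simp only [LinearMap.comp_apply, ← map_sum]
      have : ∑ i, LinearMap.single ℝ (fun _ : Fin s => V F) i (w.2 i) = w.2 :=
        Finset.univ_sum_single w.2
      rw [this]
      simp
    rw [h3]
    exact add_mem (h1 hw) (Submodule.sum_mem _ fun i _ => h2 i (hBtop (w.2 i)))

theorem neg_mem_coneTilde {w : W F s} (hw : w ∈ coneTilde F s) (hw' : -w ∈ coneTilde F s) :
    w = 0 := by
  obtain ⟨τ⟩ := nonempty_embeddings (F := F)
  rcases hw with hw | hw
  · exact hw
  rcases hw' with hw' | hw'
  · exact neg_eq_zero.1 hw'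
  have h1 := hw τ
  have h2 := hw' τ
  simp only [Prod.fst_neg, Pi.neg_apply] at h2
  linarith

theorem fst_mem_cone {w : W F s} (hw : w ∈ coneTilde F s) : w.1 ∈ cone F := by
  rcases hw with rfl | hw
  · exact Or.inl rfl
  · exact Or.inr hw

theorem fst_ne_zero {w : W F s} (hw : w ∈ coneTilde F s) (hw0 : w ≠ 0) : w.1 ≠ 0 := by
  obtain ⟨τ⟩ := nonempty_embeddings (F := F)
  intro h
  rcases hw with hw | hw
  · exact hw0 hw
  · have := hw τ
    rw [h] at this
    exact lt_irrefl _ this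

variable {U : Subgroup (𝓞 F)ˣ} {S : Set (Set (V F))}

theorem subset_cone (hS : D.IsBaseFan U S) {σ : Set (V F)} (hσ : σ ∈ S) : σ ⊆ cone F := by
  rw [← hS.complete]
  exact Set.subset_sUnion_of_mem hσ

/-- Over a cone of the base fan, the origin of `𝔟 ^ s` competes for the minimum only with finitely
many elements. -/
theorem exists_finset_pos_of_mem (hS : D.IsBaseFan U S) {σ : Set (V F)} (hσ : σ ∈ S) :
    ∃ T : Finset D.Bs, ∀ w : W F s, w.1 ∈ σ → (∀ γ ∈ T, 0 ≤ D.χ γ w) →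
      (w.1 = 0 → w.2 = 0) ∧ ∀ γ ∉ T, w.1 ≠ 0 → 0 < D.χ γ w := by
  obtain ⟨A, hA, rfl⟩ := hS.isFan.rational σ hσ
  obtain ⟨m, hm, Hm⟩ := exists_mul_tr_le (A := A) fun a ha =>
    D.subset_cone hS hσ (Submodule.subset_span (s := (A : Set (V F))) ha)
  obtain ⟨T, hT⟩ := D.exists_finset_pos hm
  exact ⟨T, fun w hw H => hT w (Hm _ hw).1 (Hm _ hw).2 H⟩

theorem cellData (hS : D.IsBaseFan U S) : CellData D.latticeTilde D.lattice S (coneTilde F s)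
    (LinearMap.fst ℝ (V F) (Fin s → V F)) D.χL D.φ where
  fan := hS.isFan
  salient := fun w hw hw' => neg_mem_coneTilde hw hw'
  complete := fun w hw => by
    have := fst_mem_cone hw
    rw [← hS.complete] at this
    exact this
  le := fun w hw β => D.φ_le hw β
  attained := fun w hw => D.exists_χ_eq_φ hw
  rational := fun β w hw => by
    rw [χL_apply, χ_eq_pairing]
    exact D.pairing_rational _ hw
  preimage := fun σ hσ => by
    obtain ⟨A, hA, rfl⟩ := hS.isFan.rational σ hσ
    exact D.exists_preimage_hull hA
  cut := fun σ hσ β => by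
    classical
    obtain ⟨T, hT⟩ := D.exists_finset_pos_of_mem hS hσ
    -- The shift by `β` reduces the minimality of `χ_β` to nonnegativity of all `χ_γ`, for which the
    -- competitors in `T` suffice.
    refine ⟨T.image (· + β), fun w hw H => ?_⟩
    have hsh : ∀ γ, D.χ γ (D.shift β w) = D.χ (γ + β) w - D.χ β w := fun γ => D.χ_shift β γ w
    obtain ⟨h1, h2⟩ := hT (D.shift β w) hw fun γ hγ => by
      rw [hsh, sub_nonneg]
      exact H _ (Finset.mem_image_of_mem _ hγ)
    -- Over `q = 0` the inequalities force `l = 0`, so the boundary points `(0,l)` with `l ≠ 0`,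
    -- which are not in the cone, are excluded.
    have hwC : w ∈ coneTilde F s := by
      rcases D.subset_cone hS hσ hw with h0 | h0
      · left
        change w.1 = 0 at h0
        have h3 := h1 h0
        refine Prod.ext h0 (funext fun i => ?_)
        have h4 := congrFun h3 i
        simp only [shift, h0, zero_mul, add_zero] at h4
        exact h4
      · exact Or.inr h0
    refine ⟨hwC, (D.φ_eq fun γ => ?_).symm⟩
    by_cases h0 : w = 0
    · simp [h0]
    have h3 : 0 ≤ D.χ (γ - β) (D.shift β w) := by
      by_cases hγ : γ - β ∈ T
      · rw [hsh, sub_nonneg]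
        exact H _ (Finset.mem_image_of_mem _ hγ)
      · exact (h2 _ hγ (fst_ne_zero (w := w) hwC h0)).le
    rwa [hsh, sub_add_cancel, sub_nonneg] at h3

variable (U) in
/-- The action of `𝔟 ^ s ⋊ U` on the base. -/
def baseAction : D.Gp U →* Module.End ℝ (V F) :=
  (unitAction U).comp SemidirectProduct.rightHom

theorem baseAction_isAdmissible (hS : D.IsBaseFan U S) : IsAdmissible (D.baseAction U) S := by
  refine ⟨fun g σ hσ => hS.admissible.stable g.right σ hσ, ?_⟩
  obtain ⟨T, hT, hTS, H⟩ := hS.admissible.finite_orbits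
  refine ⟨T, hT, hTS, fun σ hσ => ?_⟩
  obtain ⟨u, τ, hτ, h⟩ := H σ hσ
  exact ⟨SemidirectProduct.inr u, τ, hτ, h⟩

theorem isTotalFan_tildeFan (hS : D.IsBaseFan U S) : D.IsTotalFan U (D.tildeFan S) := by
  refine (D.cellData hS).isCompleteAdmissibleFan (D.action U) (D.baseAction U)
    (fun g w => rfl) (fun g w hw => D.action_mem_coneTilde U g hw)
    (fun g γ => (g.right : (𝓞 F)ˣ)⁻¹ • γ - g.left.toAdd) ?_ (D.baseAction_isAdmissible hS) ?_
  · intro g γ w hw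
    rw [χL_apply, χL_apply, χ_action, sub_add_cancel, smul_inv_smul, D.φ_action U g hw,
      sub_left_inj]
  · intro σ hσ
    obtain ⟨T, hT⟩ := D.exists_finset_pos_of_mem hS hσ
    -- Translation by a minimizer `β` turns it into the index `0`; every other minimizer then has
    -- the value zero and so must lie in `T`.
    refine ⟨T, fun β => ⟨SemidirectProduct.inl (Multiplicative.ofAdd β), ?_, ?_⟩⟩
    · simp [baseAction]
    · intro w hw hw0 hwσ hβ γ hγ
      rw [χL_apply] at hβ hγ
      have hsh : ∀ γ, D.χ γ (D.shift β w) = D.χ (γ + β) w - D.χ β w := fun γ => D.χ_shift β γ w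
      simp only [SemidirectProduct.right_inl, SemidirectProduct.left_inl, toAdd_ofAdd,
        OneMemClass.coe_one, inv_one, one_smul]
      by_contra hne
      have h1 := (hT (D.shift β w) hwσ fun γ' _ => by
        rw [hsh, sub_nonneg, hβ]
        exact D.φ_le hw _).2 _ hne (fst_ne_zero (w := w) hw hw0)
      rw [hsh, sub_add_cancel, hβ, hγ, sub_self] at h1
      exact lt_irrefl _ h1

theorem liesOver_tildeFan : LiesOver S (D.tildeFan S) := by
  rintro _ ⟨σ, hσ, A, _, rfl⟩
  refine ⟨σ, hσ, ?_⟩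
  rintro _ ⟨w, hw, rfl⟩
  exact hw.2.1

theorem smul_mem_coneTilde {w : W F s} (hw : w ∈ coneTilde F s) {r : ℝ} (hr : 0 ≤ r) :
    r • w ∈ coneTilde F s := by
  rcases hr.eq_or_lt with rfl | hr
  · exact Or.inl (zero_smul _ _)
  rcases hw with rfl | hw
  · exact Or.inl (smul_zero _)
  · exact Or.inr fun τ => mul_pos hr (hw τ)

theorem add_mem_coneTilde {w w' : W F s} (hw : w ∈ coneTilde F s) (hw' : w' ∈ coneTilde F s) :
    w + w' ∈ coneTilde F s := by
  rcases hw with rfl | hw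
  · rwa [zero_add]
  rcases hw' with rfl | hw'
  · rw [add_zero]; exact Or.inr hw
  · exact Or.inr fun τ => add_pos (hw τ) (hw' τ)

theorem convex_coneTilde : Convex ℝ (coneTilde F s) := fun _ hx _ hy _ _ ha hb _ =>
  add_mem_coneTilde (smul_mem_coneTilde hx ha) (smul_mem_coneTilde hy hb)

theorem coneTilde_diff_zero : coneTilde F s \ {0} = {w | ∀ τ, 0 < w.1 τ} := by
  ext w
  constructor
  · rintro ⟨hw, h0⟩
    exact hw.resolve_left h0
  · intro hw
    refine ⟨Or.inr hw, ?_⟩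
    rintro rfl
    obtain ⟨τ⟩ := nonempty_embeddings (F := F)
    exact lt_irrefl _ (hw τ)

/-- Without the origin the cone is open and convex, and a concave function on an open convex set of
a finite-dimensional space is continuous. -/
theorem continuousOn_of_concaveOn {f : W F s → ℝ} (hf : ConcaveOn ℝ (coneTilde F s) f) :
    ContinuousOn f (coneTilde F s \ {0}) := by
  have hopen : IsOpen (coneTilde F s \ {0}) := by
    rw [coneTilde_diff_zero]
    have : {w : W F s | ∀ τ, 0 < w.1 τ} = ⋂ τ, {w : W F s | 0 < w.1 τ} := by ext; simp
    rw [this]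
    exact isOpen_iInter_of_finite fun τ => isOpen_lt (by fun_prop) (by fun_prop)
  have hconv : Convex ℝ (coneTilde F s \ {0}) := by
    rw [coneTilde_diff_zero]
    intro x hx y hy a b ha hb hab τ
    rcases ha.eq_or_lt with rfl | ha
    · rw [zero_add] at hab; subst hab; simpa using hy τ
    · exact add_pos_of_pos_of_nonneg (mul_pos ha (hx τ)) (mul_nonneg hb (hy τ).le)
  exact (hf.subset Set.sdiff_subset hconv).continuousOn hopen

theorem concaveOn_φ : ConcaveOn ℝ (coneTilde F s) D.φ := by
  refine ⟨convex_coneTilde, fun x hx y hy a b ha hb hab => ?_⟩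
  obtain ⟨β, hβ⟩ := D.exists_χ_eq_φ (convex_coneTilde hx hy ha hb hab)
  have h : D.χ β (a • x + b • y) = a * D.χ β x + b * D.χ β y := by
    have := (D.χL β).map_add (a • x) (b • y)
    simpa using this
  rw [← hβ, h]
  exact add_le_add (mul_le_mul_of_nonneg_left (D.φ_le hx β) ha)
    (mul_le_mul_of_nonneg_left (D.φ_le hy β) hb)

theorem φ_smul {w : W F s} (hw : w ∈ coneTilde F s) {r : ℝ} (hr : 0 ≤ r) :
    D.φ (r • w) = r * D.φ w := by
  obtain ⟨β, hβ⟩ := D.exists_χ_le hw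
  have h : ∀ γ, D.χ γ (r • w) = r * D.χ γ w := fun γ => (D.χL γ).map_smul r w
  rw [D.φ_eq hβ, D.φ_eq (β := β) fun γ => ?_, h]
  rw [h, h]
  exact mul_le_mul_of_nonneg_left (hβ γ) hr

/-- The sum of the coefficients of the `χ_β`, for `β` in a finite set. -/
theorem pairing_sum_χCoeff (A : Finset D.Bs) (w : W F s) :
    pairing (∑ β ∈ A, D.χCoeff β).1 (∑ β ∈ A, D.χCoeff β).2 w = ∑ β ∈ A, D.χ β w := by
  rw [← pairL_apply, map_sum, LinearMap.sum_apply]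
  exact Finset.sum_congr rfl fun β _ => (D.χ_eq_pairing β w).symm

/-- Every summand is at least `φ`. Thus the finitely many equations that define a cone over `σ`
merge into one, which is the form required by strict convexity. -/
theorem sum_χ_eq_iff {A : Finset D.Bs} {w : W F s} (hw : w ∈ coneTilde F s) :
    A.card * D.φ w = ∑ β ∈ A, D.χ β w ↔ ∀ β ∈ A, D.χ β w = D.φ w := by
  have h := Finset.sum_eq_sum_iff_of_le (s := A) (f := fun _ => D.φ w) (g := fun β => D.χ β w)
    fun β _ => D.φ_le hw β
  rw [Finset.sum_const, nsmul_eq_mul] at h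
  rw [h]
  exact forall₂_congr fun β _ => eq_comm

theorem isTwistedPolarization_φ : D.IsTwistedPolarization U 1 S (D.tildeFan S) D.φ where
  continuousOn := continuousOn_of_concaveOn D.concaveOn_φ
  concaveOn := D.concaveOn_φ
  integral := fun w hw hN => by
    obtain ⟨β, hβ⟩ := D.exists_χ_eq_φ hw
    rw [← hβ, χ_eq_pairing]
    exact D.pairing_integer (D.χCoeff_fst_mem β) (D.χCoeff_snd_mem β) hN
  linear := by
    rintro _ ⟨σ, _, A, ⟨β, hβ⟩, rfl⟩
    exact ⟨D.χL β, fun w hw => (hw.2.2 β hβ).symm⟩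
  homogeneous := fun w hw r hr => D.φ_smul hw hr
  unit_invariant := fun u w hw => by
    rw [D.φ_action U _ hw]
    simp
  twisted := fun β w hw => by
    rw [D.φ_action U _ hw]
    simp
  strict := by
    rintro _ ⟨σ, hσ, A, hA, rfl⟩
    refine ⟨σ, hσ, A.card, hA.card_pos, (∑ β ∈ A, D.χCoeff β).1, ?_, (∑ β ∈ A, D.χCoeff β).2,
      fun i => ?_, Set.ext fun w => ?_⟩
    · rw [Prod.fst_sum]
      exact Submodule.sum_mem (D.X : Submodule (𝓞 F) F) fun β _ => D.χCoeff_fst_mem β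
    · rw [Prod.snd_sum, Finset.sum_apply]
      exact Submodule.sum_mem (D.a : Submodule (𝓞 F) F) fun β _ => D.χCoeff_snd_mem β i
    · constructor
      · intro hw
        refine ⟨hw.1, hw.2.1, ?_⟩
        rw [pairing_sum_χCoeff]
        exact (D.sum_χ_eq_iff hw.1).2 hw.2.2
      · rintro ⟨hw, hwσ, h⟩
        rw [pairing_sum_χCoeff] at h
        exact ⟨hw, hwσ, (D.sum_χ_eq_iff hw).1 h⟩

end CuspData

end TildeFan

/-! ### Concave functions on the cone of totally positive vectors -/

section Families

variable {F : Type*} [Field F] [NumberField F]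

/-- The functional `q ↦ Tr (ξ q)`. -/
def traceL : F →ₗ[ℚ] (V F →ₗ[ℝ] ℝ) where
  toFun ξ := (trL F).comp (LinearMap.mulLeft ℝ (emb ξ))
  map_add' ξ ξ' := by
    refine LinearMap.ext fun q => ?_
    simp [add_mul, tr_add]
  map_smul' r ξ := by
    refine LinearMap.ext fun q => ?_
    have h : (emb ((r : F) * ξ) : V F) = (r : ℝ) • emb ξ := by
      funext τ
      simp
    simp [Rat.smul_def, h, -map_mul]

@[simp] theorem traceL_apply (ξ : F) (q : V F) : traceL ξ q = tr (emb ξ * q) := rfl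

theorem tr_emb_pos {ξ : F} (hξ : ∀ τ : F →+* ℝ, 0 < τ ξ) {q : V F} (hq : ∀ τ, 0 < q τ)
    [Nonempty (F →+* ℝ)] : 0 < tr (emb ξ * q) :=
  Finset.sum_pos (fun τ _ => mul_pos (hξ τ) (hq τ)) Finset.univ_nonempty

/-- A family of totally positive elements, stable under the squares of the units in `U`, such that
each totally positive vector takes values below any given bound only finitely often. -/
structure IsFamily (U : Subgroup (𝓞 F)ˣ) (Ξ : Set F) : Prop where
  nonempty : Ξ.Nonempty
  pos : ∀ ξ ∈ Ξ, ∀ τ : F →+* ℝ, 0 < τ ξ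
  stable : ∀ u ∈ U, ∀ ξ ∈ Ξ, (u : F) ^ 2 * ξ ∈ Ξ
  finite : ∀ a : V F, (∀ τ, 0 < a τ) → ∀ M : ℝ, {ξ | ξ ∈ Ξ ∧ tr (emb ξ * a) ≤ M}.Finite

/-- `ξ` is minimal at `q` among the elements of a family. -/
def IsMinAt (Ξ : Set F) (q : V F) (ξ : F) : Prop :=
  ξ ∈ Ξ ∧ ∀ ξ' ∈ Ξ, tr (emb ξ * q) ≤ tr (emb ξ' * q)

/-- The minimum over the family breaks at `q` along the hyperplane defined by `η`. -/
def BreaksAt (Ξ : Set F) (η : F) (q : V F) : Prop :=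
  ∃ (θ : F) (ε : ℚ), 0 < ε ∧ IsMinAt Ξ q (θ + ε * η) ∧ IsMinAt Ξ q (θ - ε * η)

variable {U : Subgroup (𝓞 F)ˣ} {Ξ Ξ' : Set F}

theorem IsFamily.exists_isMinAt (h : IsFamily U Ξ) {q : V F} (hq : ∀ τ, 0 < q τ) :
    ∃ ξ, IsMinAt Ξ q ξ := by
  obtain ⟨ξ₀, hξ₀⟩ := h.nonempty
  obtain ⟨ξ, hξ, H⟩ := Set.exists_min_image _ (fun ξ => tr (emb ξ * q))
    (h.finite q hq (tr (emb ξ₀ * q))) ⟨ξ₀, hξ₀, le_rfl⟩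
  refine ⟨ξ, hξ.1, fun ξ' hξ' => ?_⟩
  by_cases h' : tr (emb ξ' * q) ≤ tr (emb ξ₀ * q)
  · exact H ξ' ⟨hξ', h'⟩
  · exact hξ.2.trans (not_le.1 h').le

theorem IsMinAt.add {q : V F} {ξ ξ' : F} (h : IsMinAt Ξ q ξ) (h' : IsMinAt Ξ' q ξ') :
    IsMinAt (Ξ + Ξ') q (ξ + ξ') := by
  refine ⟨Set.add_mem_add h.1 h'.1, ?_⟩
  rintro _ ⟨x, hx, x', hx', rfl⟩
  simp only [map_add, add_mul, tr_add]
  exact add_le_add (h.2 x hx) (h'.2 x' hx')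

theorem IsMinAt.smul {q : V F} {ξ : F} (h : IsMinAt Ξ q ξ) {r : ℝ} (hr : 0 ≤ r) :
    IsMinAt Ξ (r • q) ξ := by
  refine ⟨h.1, fun ξ' hξ' => ?_⟩
  rw [mul_smul_comm, mul_smul_comm, tr_smul, tr_smul]
  exact mul_le_mul_of_nonneg_left (h.2 ξ' hξ') hr

theorem BreaksAt.smul {η : F} {q : V F} (h : BreaksAt Ξ η q) {r : ℝ} (hr : 0 ≤ r) :
    BreaksAt Ξ η (r • q) := by
  obtain ⟨θ, ε, hε, h1, h2⟩ := h
  exact ⟨θ, ε, hε, h1.smul hr, h2.smul hr⟩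

/-- The minimum over a sum of families is the sum of the minima, so a minimizer of the second family
can be added to both minimizers of the first. Sums of families therefore collect breaks. -/
theorem BreaksAt.add_right (h' : IsFamily U Ξ') {η : F} {q : V F} (hq : ∀ τ, 0 < q τ)
    (h : BreaksAt Ξ η q) : BreaksAt (Ξ + Ξ') η q := by
  obtain ⟨θ, ε, hε, h1, h2⟩ := h
  obtain ⟨ξ, hξ⟩ := h'.exists_isMinAt hq
  refine ⟨θ + ξ, ε, hε, ?_, ?_⟩
  · rw [add_right_comm]; exact h1.add hξ
  · rw [add_sub_right_comm]; exact h2.add hξ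

theorem IsFamily.add (h : IsFamily U Ξ) (h' : IsFamily U Ξ') : IsFamily U (Ξ + Ξ') where
  nonempty := h.nonempty.add h'.nonempty
  pos := by
    rintro _ ⟨x, hx, x', hx', rfl⟩ τ
    rw [map_add]
    exact add_pos (h.pos x hx τ) (h'.pos x' hx' τ)
  stable := by
    rintro u hu _ ⟨x, hx, x', hx', rfl⟩
    rw [mul_add]
    exact Set.add_mem_add (h.stable u hu x hx) (h'.stable u hu x' hx')
  finite := by
    intro a ha M
    refine ((h.finite a ha M).add (h'.finite a ha M)).subset ?_
    rintro _ ⟨⟨x, hx, x', hx', rfl⟩, hM⟩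
    simp only [map_add, add_mul, tr_add] at hM
    have h1 : 0 ≤ tr (emb x * a) := Finset.sum_nonneg fun τ _ => (mul_pos (h.pos x hx τ) (ha τ)).le
    have h2 : 0 ≤ tr (emb x' * a) :=
      Finset.sum_nonneg fun τ _ => (mul_pos (h'.pos x' hx' τ) (ha τ)).le
    exact Set.add_mem_add ⟨hx, by linarith⟩ ⟨hx', by linarith⟩

variable [NumberField.IsTotallyReal F]

theorem isFamily_orbit (U : Subgroup (𝓞 F)ˣ) {A : Finset F} (hA : A.Nonempty)
    (hpos : ∀ a ∈ A, ∀ τ : F →+* ℝ, 0 < τ a) :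
    IsFamily U {x | ∃ u ∈ U, ∃ a ∈ A, x = (u : F) ^ 2 * a} where
  nonempty := by
    obtain ⟨a, ha⟩ := hA
    exact ⟨a, 1, one_mem U, a, ha, by simp⟩
  pos := by
    rintro _ ⟨u, _, a, ha, rfl⟩ τ
    rw [map_mul, map_pow]
    exact mul_pos (unit_sq_pos u τ) (hpos a ha τ)
  stable := by
    rintro v hv _ ⟨u, hu, a, ha, rfl⟩
    refine ⟨v * u, mul_mem hv hu, a, ha, ?_⟩
    rw [Units.val_mul, map_mul]
    ring
  finite := by
    intro q hq M
    have hfin : ∀ a ∈ A, {x : F | ∃ u : (𝓞 F)ˣ, x = (u : F) ^ 2 * a ∧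
        tr (emb x * q) ≤ M}.Finite := by
      intro a ha
      refine ((finite_units_sq_le (F := F) (∑ τ : F →+* ℝ, |M| / (τ a * q τ))).image
        fun u : (𝓞 F)ˣ => (u : F) ^ 2 * a).subset ?_
      rintro _ ⟨u, rfl, hM⟩
      refine ⟨u, fun τ => ?_, rfl⟩
      have hp : ∀ τ : F →+* ℝ, 0 < τ a * q τ := fun τ => mul_pos (hpos a ha τ) (hq τ)
      have h1 : τ (u : F) ^ 2 * (τ a * q τ) ≤ |M| := by
        refine le_trans ?_ (hM.trans (le_abs_self M))
        have := Finset.single_le_sum (f := fun τ : F →+* ℝ => τ (u : F) ^ 2 * (τ a * q τ))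
          (fun τ _ => mul_nonneg (sq_nonneg _) (hp τ).le) (Finset.mem_univ τ)
        refine this.trans (le_of_eq (Finset.sum_congr rfl fun τ _ => ?_))
        simp only [Pi.mul_apply, Pi.pow_apply, emb_apply, map_mul, map_pow]
        ring
      rw [← le_div_iff₀ (hp τ)] at h1
      exact h1.trans (Finset.single_le_sum (f := fun τ : F →+* ℝ => |M| / (τ a * q τ))
        (fun τ _ => div_nonneg (abs_nonneg _) (hp τ).le) (Finset.mem_univ τ))
    refine (Set.Finite.biUnion A.finite_toSet hfin).subset ?_
    rintro _ ⟨⟨u, _, a, ha, rfl⟩, hM⟩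
    exact Set.mem_biUnion ha ⟨u, rfl, hM⟩

/-- By density choose `ξ` in `F` close to the inverse of `q₀`, and `ε` small; the family is the
orbit of `ξ + εη` and `ξ - εη`. Near `q₀` on the hyperplane both have the trace `Tr(ξq)`, which is
close to the degree `n`, while multiplication by a unit square other than `1` makes the trace nearly
`n + 1` or larger. -/
theorem exists_breaksAt_near (U : Subgroup (𝓞 F)ˣ) (η : F) {q₀ : V F} (hq₀ : ∀ τ, 0 < q₀ τ) :
    ∃ Ξ : Set F, IsFamily U Ξ ∧ ∃ O : Set (V F), IsOpen O ∧ q₀ ∈ O ∧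
      ∀ q ∈ O, tr (emb η * q) = 0 → BreaksAt Ξ η q := by
  set n : ℝ := (Fintype.card (F →+* ℝ) : ℝ) with hn
  have hn0 : 0 ≤ n := Nat.cast_nonneg _
  -- The final comparison is `n(1 + δ) ≤ (1 - 2δ)(n + 1)`; it suffices that `3δ(n + 1) ≤ 1`.
  set δ : ℝ := 1 / (4 * (n + 1)) with hδ
  have hδ0 : 0 < δ := by positivity
  have hδn : δ * (n + 1) = 1 / 4 := by rw [hδ]; field_simp
  have hopen : ∀ x : F, IsOpen {q : V F | ∀ τ : F →+* ℝ, |τ x * q τ - 1| < δ} := by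
    intro x
    have : {q : V F | ∀ τ : F →+* ℝ, |τ x * q τ - 1| < δ} =
      ⋂ τ : F →+* ℝ, {q : V F | |τ x * q τ - 1| < δ} := by ext; simp
    rw [this]
    exact isOpen_iInter_of_finite fun τ => isOpen_lt (by fun_prop) (by fun_prop)
  obtain ⟨ξ, hξ⟩ : ∃ ξ : F, ∀ τ : F →+* ℝ, |τ ξ * q₀ τ - 1| < δ := by
    have h1 : IsOpen {y : V F | ∀ τ : F →+* ℝ, |y τ * q₀ τ - 1| < δ} := by
      have : {y : V F | ∀ τ : F →+* ℝ, |y τ * q₀ τ - 1| < δ} =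
        ⋂ τ : F →+* ℝ, {y : V F | |y τ * q₀ τ - 1| < δ} := by ext; simp
      rw [this]
      exact isOpen_iInter_of_finite fun τ => isOpen_lt (by fun_prop) (by fun_prop)
    obtain ⟨x, hx⟩ := denseRange_emb.exists_mem_open h1 ⟨fun τ => (q₀ τ)⁻¹, fun τ => by
      rw [inv_mul_cancel₀ (hq₀ τ).ne']; simpa using hδ0⟩
    exact ⟨x, hx⟩
  obtain ⟨ε, hε, Hε⟩ : ∃ ε : ℚ, 0 < ε ∧ ∀ τ : F →+* ℝ, |(ε : ℝ) * (τ η * q₀ τ)| < δ := by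
    obtain ⟨e, he, He⟩ := exists_pos_mul_le Finset.univ
      (fun τ : F →+* ℝ => |τ η * q₀ τ| + 1) (fun _ => δ) fun _ _ => hδ0
    obtain ⟨ε, hε0, hεe⟩ := exists_rat_btwn he
    refine ⟨ε, by exact_mod_cast hε0, fun τ => ?_⟩
    rw [abs_mul, abs_of_pos hε0]
    calc (ε : ℝ) * |τ η * q₀ τ| < ε * (|τ η * q₀ τ| + 1) :=
          mul_lt_mul_of_pos_left (lt_add_one _) hε0
      _ ≤ e * (|τ η * q₀ τ| + 1) := mul_le_mul_of_nonneg_right hεe.le (by positivity)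
      _ ≤ δ := He τ (Finset.mem_univ τ)
  have hopen' : IsOpen {q : V F | ∀ τ : F →+* ℝ, |(ε : ℝ) * (τ η * q τ)| < δ} := by
    have : {q : V F | ∀ τ : F →+* ℝ, |(ε : ℝ) * (τ η * q τ)| < δ} =
      ⋂ τ : F →+* ℝ, {q : V F | |(ε : ℝ) * (τ η * q τ)| < δ} := by ext; simp
    rw [this]
    exact isOpen_iInter_of_finite fun τ => isOpen_lt (by fun_prop) (by fun_prop)
  classical
  have hδ4 : δ ≤ 1 / 4 := by nlinarith
  have hval : ∀ a ∈ ({ξ + ε * η, ξ - ε * η} : Finset F), ∀ q : V F,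
      (∀ τ : F →+* ℝ, |τ ξ * q τ - 1| < δ) → (∀ τ : F →+* ℝ, |(ε : ℝ) * (τ η * q τ)| < δ) →
      ∀ τ : F →+* ℝ, 1 - 2 * δ < τ a * q τ := by
    intro a ha q h1 h2 τ
    have h1 := abs_lt.1 (h1 τ)
    have h2 := abs_lt.1 (h2 τ)
    rcases Finset.mem_insert.1 ha with rfl | ha
    · rw [map_add, map_mul, map_ratCast, add_mul]
      linarith
    · rw [Finset.mem_singleton.1 ha, map_sub, map_mul, map_ratCast, sub_mul]
      linarith
  have hpos : ∀ a ∈ ({ξ + ε * η, ξ - ε * η} : Finset F), ∀ τ : F →+* ℝ, 0 < τ a := by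
    intro a ha τ
    have := hval a ha q₀ hξ Hε τ
    exact pos_of_mul_pos_left (lt_trans (by linarith) this) (hq₀ τ).le
  refine ⟨_, isFamily_orbit U (Finset.insert_nonempty _ _) hpos, _, (hopen ξ).inter hopen',
    ⟨hξ, Hε⟩, ?_⟩
  rintro q ⟨hq1, hq2⟩ hηq
  have htr : ∀ a ∈ ({ξ + ε * η, ξ - ε * η} : Finset F), tr (emb a * q) = tr (emb ξ * q) := by
    intro a ha
    have h1 : tr (emb ((ε : F) * η) * q) = 0 := by
      have : (emb ((ε : F) * η) * q : V F) = (ε : ℝ) • (emb η * q) := by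
        funext τ
        simp [mul_assoc]
      rw [this, tr_smul, hηq, mul_zero]
    rcases Finset.mem_insert.1 ha with rfl | ha
    · rw [map_add, add_mul, tr_add, h1, add_zero]
    · rw [Finset.mem_singleton.1 ha, map_sub, sub_mul, ← trL_apply, map_sub, trL_apply, trL_apply,
        h1, sub_zero]
  have hle : tr (emb ξ * q) ≤ n * (1 + δ) := by
    calc tr (emb ξ * q) ≤ ∑ _τ : F →+* ℝ, (1 + δ) := Finset.sum_le_sum fun τ _ => by
          have := abs_lt.1 (hq1 τ)
          simp only [Pi.mul_apply, emb_apply]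
          linarith
      _ = n * (1 + δ) := by rw [Finset.sum_const, Finset.card_univ, nsmul_eq_mul]
  have hmin : ∀ a ∈ ({ξ + ε * η, ξ - ε * η} : Finset F),
      IsMinAt {x | ∃ u ∈ U, ∃ a ∈ ({ξ + ε * η, ξ - ε * η} : Finset F), x = (u : F) ^ 2 * a} q a := by
    intro a ha
    refine ⟨⟨1, one_mem U, a, ha, by simp⟩, ?_⟩
    rintro _ ⟨u, _, b, hb, rfl⟩
    rw [htr a ha]
    by_cases hu : (u : F) ^ 2 = 1
    · rw [hu, one_mul, htr b hb]
    · have h1 : (1 - 2 * δ) * ∑ τ : F →+* ℝ, τ (u : F) ^ 2 ≤ tr (emb ((u : F) ^ 2 * b) * q) := by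
        rw [Finset.mul_sum]
        refine Finset.sum_le_sum fun τ _ => ?_
        have h2 := mul_le_mul_of_nonneg_right (hval b hb q hq1 hq2 τ).le (sq_nonneg (τ (u : F)))
        refine h2.trans (le_of_eq ?_)
        simp only [Pi.mul_apply, Pi.pow_apply, emb_apply, map_mul, map_pow]
        ring
      have h2 := tr_unit_sq hu
      have h3 := mul_le_mul_of_nonneg_left h2 (show 0 ≤ 1 - 2 * δ by linarith)
      refine hle.trans (le_trans ?_ (h3.trans h1))
      nlinarith
  exact ⟨ξ, ε, hε, hmin _ (Finset.mem_insert_self _ _),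
    hmin _ (Finset.mem_insert_of_mem (Finset.mem_singleton_self _))⟩

/-- A set of pairs `(η, q)` such that the minimum over some family breaks at `q` along the
hyperplane defined by `η` whenever `q` is a totally positive vector on it. -/
def Breakable (U : Subgroup (𝓞 F)ˣ) (X : Set (F × V F)) : Prop :=
  ∃ Ξ : Set F, IsFamily U Ξ ∧ ∀ p ∈ X, (∀ τ, 0 < p.2 τ) → tr (emb p.1 * p.2) = 0 →
    BreaksAt Ξ p.1 p.2

theorem Breakable.union {X Y : Set (F × V F)} (hX : Breakable U X) (hY : Breakable U Y) :
    Breakable U (X ∪ Y) := by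
  obtain ⟨Ξ, h, H⟩ := hX
  obtain ⟨Ξ', h', H'⟩ := hY
  refine ⟨Ξ + Ξ', h.add h', ?_⟩
  rintro p (hp | hp) hpos htr
  · exact (H p hp hpos htr).add_right h' hpos
  · rw [add_comm]
    exact (H' p hp hpos htr).add_right h hpos

theorem breakable_empty (U : Subgroup (𝓞 F)ˣ) : Breakable U (∅ : Set (F × V F)) :=
  ⟨_, isFamily_orbit U (Finset.singleton_nonempty (1 : F)) (by simp), by simp⟩

theorem breakable_biUnion {ι : Type*} (T : Finset ι) (X : ι → Set (F × V F))
    (h : ∀ t ∈ T, Breakable U (X t)) : Breakable U (⋃ t ∈ T, X t) := by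
  classical
  induction T using Finset.induction_on with
  | empty => simpa using breakable_empty U
  | insert t T _ ih =>
    rw [Finset.set_biUnion_insert]
    exact (h t (Finset.mem_insert_self _ _)).union
      (ih fun t' ht' => h t' (Finset.mem_insert_of_mem ht'))

/-- The slice of trace `1` lies in a compact set of totally positive vectors, because the cone stays
away from the boundary. Finitely many local families cover it, their sum breaks at all its points on
the hyperplane, and scaling extends this to the cone. -/
theorem breakable_hull (U : Subgroup (𝓞 F)ˣ) (η : F) {A : Finset (V F)}
    (hA : ∀ a ∈ A, a ∈ cone F) :
    Breakable U {p | p.1 = η ∧ p.2 ∈ PointedCone.hull ℝ (A : Set (V F))} := by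
  obtain ⟨m, hm, Hm⟩ := exists_mul_tr_le hA
  let K : Set (V F) := {q | tr q = 1 ∧ ∀ τ, m ≤ q τ}
  have hcont : Continuous (tr : V F → ℝ) := continuous_finsetSum _ fun τ _ => continuous_apply τ
  have hK : IsCompact K := by
    refine IsCompact.of_isClosed_subset (isCompact_univ_pi fun _ : F →+* ℝ =>
      isCompact_Icc (a := (0 : ℝ)) (b := 1)) ?_ fun q hq => Set.mem_univ_pi.2 fun τ => ⟨?_, ?_⟩
    · have : K = {q | tr q = 1} ∩ ⋂ τ : F →+* ℝ, {q : V F | m ≤ q τ} := by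
        ext q; simp [K]
      rw [this]
      exact (isClosed_eq hcont continuous_const).inter (isClosed_iInter fun τ =>
        isClosed_le continuous_const (continuous_apply τ))
    · exact hm.le.trans (hq.2 τ)
    · have := Finset.single_le_sum (f := q) (fun τ _ => hm.le.trans (hq.2 τ))
        (Finset.mem_univ τ)
      exact this.trans hq.1.le
  have key : Breakable U {p : F × V F | p.1 = η ∧ p.2 ∈ K} := by
    refine hK.induction_on (p := fun X => Breakable U {p : F × V F | p.1 = η ∧ p.2 ∈ X})
      ?_ ?_ ?_ ?_
    · simpa using breakable_empty U
    · rintro X Y hXY ⟨Ξ, h, H⟩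
      exact ⟨Ξ, h, fun p hp => H p ⟨hp.1, hXY hp.2⟩⟩
    · intro X Y hX hY
      have := hX.union hY
      convert this using 1
      ext p
      simp only [Set.mem_ofPred_eq, Set.mem_union]
      tauto
    · intro q hq
      have hq0 : ∀ τ, 0 < q τ := fun τ => hm.trans_le (hq.2 τ)
      obtain ⟨Ξ, hΞ, O, hO, hqO, H⟩ := exists_breaksAt_near U η hq0
      refine ⟨O, mem_nhdsWithin_of_mem_nhds (hO.mem_nhds hqO), Ξ, hΞ, ?_⟩
      rintro ⟨_, q'⟩ ⟨rfl, hq'⟩ _ htr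
      exact H q' hq' htr
  obtain ⟨Ξ, hΞ, H⟩ := key
  refine ⟨Ξ, hΞ, ?_⟩
  rintro ⟨η', q⟩ ⟨hη', hq⟩ hpos htr
  simp only at hη' hq hpos htr ⊢
  subst hη'
  have hne := nonempty_embeddings (F := F)
  have htq : 0 < tr q := Finset.sum_pos (fun τ _ => hpos τ) Finset.univ_nonempty
  have h1 := H (η', (tr q)⁻¹ • q) ⟨rfl, ?_, fun τ => ?_⟩ (fun τ => ?_) ?_
  · have h2 := h1.smul htq.le
    simpa [smul_smul, mul_inv_cancel₀ htq.ne'] using h2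
  · simp only
    rw [tr_smul, inv_mul_cancel₀ htq.ne']
  · change m ≤ (tr q)⁻¹ * q τ
    rw [inv_mul_eq_div, le_div_iff₀ htq]
    exact (Hm q hq).2 τ
  · exact mul_pos (inv_pos.2 htq) (hpos τ)
  · simp only
    rw [mul_smul_comm, tr_smul, htr, mul_zero]

/-- The elementary fact that makes the minimum over the family refine a polyhedral cone. -/
theorem mem_of_isMinAt_imp {H : Finset F} (hH : ∀ η ∈ H, ∀ q : V F, (∀ τ, 0 < q τ) →
      (∀ η' ∈ H, 0 ≤ tr (emb η' * q)) → tr (emb η * q) = 0 → BreaksAt Ξ η q)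
    (hΞ : IsFamily U Ξ) {q x : V F} (hq : ∀ τ, 0 < q τ) (hqH : ∀ η ∈ H, 0 ≤ tr (emb η * q))
    (hx : x ∈ cone F) (h : ∀ ξ, IsMinAt Ξ q ξ → IsMinAt Ξ x ξ) :
    ∀ η ∈ H, 0 ≤ tr (emb η * x) := by
  classical
  by_contra! hcon
  obtain ⟨η₁, hη₁, hη₁x⟩ := hcon
  obtain ⟨η, hη, hmin⟩ := Finset.exists_min_image (H.filter fun η => tr (emb η * x) < 0)
    (fun η => tr (emb η * q) / (tr (emb η * q) - tr (emb η * x)))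
    ⟨η₁, Finset.mem_filter.2 ⟨hη₁, hη₁x⟩⟩
  obtain ⟨hηH, hηx⟩ := Finset.mem_filter.1 hη
  have hηq := hqH η hηH
  -- Among the inequalities violated at `x`, `η` is the first one met on the segment from `q` to
  -- `x`, and `t` is the parameter of the exit point `q₁`. There the family breaks along `η`.
  set t := tr (emb η * q) / (tr (emb η * q) - tr (emb η * x)) with ht
  have hden : 0 < tr (emb η * q) - tr (emb η * x) := by linarith
  have ht0 : 0 ≤ t := div_nonneg hηq hden.le
  have ht1 : t < 1 := by rw [ht, div_lt_one hden]; linarith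
  set q₁ : V F := (1 - t) • q + t • x with hq₁
  have htr : ∀ ζ : F, tr (emb ζ * q₁) = (1 - t) * tr (emb ζ * q) + t * tr (emb ζ * x) := by
    intro ζ
    rw [hq₁, mul_add, tr_add, mul_smul_comm, mul_smul_comm, tr_smul, tr_smul]
  have hx0 : ∀ τ, 0 ≤ x τ := by
    rcases hx with rfl | hx
    · simp
    · exact fun τ => (hx τ).le
  have hq₁pos : ∀ τ, 0 < q₁ τ := fun τ =>
    add_pos_of_pos_of_nonneg (mul_pos (by linarith) (hq τ)) (mul_nonneg ht0 (hx0 τ))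
  have hzero : tr (emb η * q₁) = 0 := by
    have h1 := div_mul_cancel₀ (tr (emb η * q)) hden.ne'
    rw [← ht] at h1
    rw [htr]
    linarith
  have hq₁H : ∀ η' ∈ H, 0 ≤ tr (emb η' * q₁) := by
    intro η' hη'
    have hη'q := hqH η' hη'
    by_cases hη'x : tr (emb η' * x) < 0
    · have h1 := hmin η' (Finset.mem_filter.2 ⟨hη', hη'x⟩)
      have hden' : 0 < tr (emb η' * q) - tr (emb η' * x) := by linarith
      rw [le_div_iff₀ hden'] at h1
      rw [htr]
      linarith
    · rw [htr]
      have := mul_nonneg ht0 (not_lt.1 hη'x)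
      have := mul_nonneg (show 0 ≤ 1 - t by linarith) hη'q
      linarith
  obtain ⟨θ, ε, hε, hp, hm⟩ := hH η hηH q₁ hq₁pos hq₁H hzero
  have hεR : (0 : ℝ) < ε := by exact_mod_cast hε
  have hpm : ∀ y : V F, tr (emb (θ + ε * η) * y) = tr (emb θ * y) + ε * tr (emb η * y) ∧
      tr (emb (θ - ε * η) * y) = tr (emb θ * y) - ε * tr (emb η * y) := by
    intro y
    have h1 : (emb ((ε : F) * η) * y : V F) = (ε : ℝ) • (emb η * y) := by
      funext τ
      simp [mul_assoc]
    constructor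
    · rw [map_add, add_mul, tr_add, h1, tr_smul]
    · rw [map_sub, sub_mul, ← trL_apply, map_sub, trL_apply, trL_apply, h1, tr_smul]
  rcases ht0.eq_or_lt with h0 | h0
  -- If the exit point is `q` itself, both `θ ± εη` are minimal at `q`, hence at `x`, so `η` would
  -- vanish at `x`.
  · have : q₁ = q := by rw [hq₁, ← h0]; simp
    rw [this] at hp hm
    have h1 := (h _ hp).2 _ hm.1
    rw [(hpm x).1, (hpm x).2] at h1
    have h2 := (h _ hm).2 _ hp.1
    rw [(hpm x).1, (hpm x).2] at h2
    nlinarith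
  -- A minimizer `a` at `q` is one at `x` too. Its value is at most that of `θ` at `q` and strictly
  -- smaller at `x`, where `θ + εη` is already below `θ`. So it is strictly smaller at `q₁`,
  -- although `θ` takes the minimal value there.
  · obtain ⟨a, ha⟩ := hΞ.exists_isMinAt hq
    have hax := h a ha
    have h1 := ha.2 _ hp.1
    have h2 := ha.2 _ hm.1
    have h3 := hax.2 _ hp.1
    have h4 := hax.2 _ hm.1
    have h5 := hp.2 _ ha.1
    rw [(hpm _).1] at h1 h3
    rw [(hpm _).2] at h2 h4
    rw [(hpm _).1, hzero, mul_zero, add_zero, htr θ, htr a] at h5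
    have h6 : 0 ≤ tr (emb θ * q) - tr (emb a * q) := by linarith
    have h7 : 0 < tr (emb θ * x) - tr (emb a * x) := by nlinarith
    nlinarith [mul_pos h0 h7, mul_nonneg (show 0 ≤ 1 - t by linarith) h6]

end Families

/-! ### The refinement of the base fan -/

section BaseRefinement

variable {F : Type*} [Field F] [NumberField F]

/-- The minimum over a family, as a function. -/
def famMin (Ξ : Set F) (q : V F) : ℝ := ⨅ ξ : Ξ, traceL (ξ : F) q

variable {U : Subgroup (𝓞 F)ˣ} {Ξ : Set F}

theorem IsMinAt.famMin_eq {q : V F} {ξ : F} (h : IsMinAt Ξ q ξ) :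
    famMin Ξ q = tr (emb ξ * q) := by
  have hne : Nonempty Ξ := ⟨⟨ξ, h.1⟩⟩
  refine le_antisymm (ciInf_le ⟨tr (emb ξ * q), ?_⟩ (⟨ξ, h.1⟩ : Ξ))
    (le_ciInf fun ξ' => h.2 ξ' ξ'.2)
  rintro _ ⟨ξ', rfl⟩
  exact h.2 ξ' ξ'.2

theorem isMinAt_zero {ξ : F} (hξ : ξ ∈ Ξ) : IsMinAt Ξ 0 ξ :=
  ⟨hξ, fun ξ' _ => by rw [mul_zero, mul_zero]⟩

theorem IsFamily.exists_isMinAt_of_mem_cone (h : IsFamily U Ξ) {q : V F} (hq : q ∈ cone F) :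
    ∃ ξ, IsMinAt Ξ q ξ := by
  rcases hq with rfl | hq
  · exact ⟨_, isMinAt_zero h.nonempty.some_mem⟩
  · exact h.exists_isMinAt hq

theorem IsFamily.famMin_le (h : IsFamily U Ξ) {q : V F} (hq : q ∈ cone F) {ξ : F} (hξ : ξ ∈ Ξ) :
    famMin Ξ q ≤ tr (emb ξ * q) := by
  obtain ⟨ξ', hξ'⟩ := h.exists_isMinAt_of_mem_cone hq
  rw [hξ'.famMin_eq]
  exact hξ'.2 ξ hξ

theorem IsFamily.isMinAt_iff (h : IsFamily U Ξ) {q : V F} (hq : q ∈ cone F) {ξ : F} (hξ : ξ ∈ Ξ) :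
    IsMinAt Ξ q ξ ↔ tr (emb ξ * q) = famMin Ξ q :=
  ⟨fun H => H.famMin_eq.symm, fun H => ⟨hξ, fun ξ' hξ' => by rw [H]; exact h.famMin_le hq hξ'⟩⟩

theorem tr_emb_unit_sq_mul (u : (𝓞 F)ˣ) (ξ : F) (q : V F) :
    tr (emb ξ * (emb (u : F) ^ 2 * q)) = tr (emb ((u : F) ^ 2 * ξ) * q) := by
  rw [map_mul, map_pow]
  congr 1
  ring

theorem isMinAt_unit_smul (h : IsFamily U Ξ) (u : U) (ξ : F) (q : V F) :
    IsMinAt Ξ (unitAction U u q) ξ ↔ IsMinAt Ξ q (((u : (𝓞 F)ˣ) : F) ^ 2 * ξ) := by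
  have key : ∀ ξ : F, tr (emb ξ * unitAction U u q) =
      tr (emb (((u : (𝓞 F)ˣ) : F) ^ 2 * ξ) * q) := fun ξ => tr_emb_unit_sq_mul _ _ _
  have hinv : ∀ ξ : F, (((u⁻¹ : U) : (𝓞 F)ˣ) : F) ^ 2 * (((u : (𝓞 F)ˣ) : F) ^ 2 * ξ) = ξ := by
    intro ξ
    rw [← mul_assoc, ← mul_pow, Subgroup.coe_inv, ← map_mul, Units.inv_mul, map_one, one_pow,
      one_mul]
  have hinv' : ∀ ξ : F, ((u : (𝓞 F)ˣ) : F) ^ 2 * ((((u⁻¹ : U) : (𝓞 F)ˣ) : F) ^ 2 * ξ) = ξ := by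
    intro ξ
    rw [← mul_assoc, ← mul_pow, Subgroup.coe_inv, ← map_mul, Units.mul_inv, map_one, one_pow,
      one_mul]
  constructor
  · rintro ⟨h1, h2⟩
    refine ⟨h.stable u u.2 _ h1, fun ξ' hξ' => ?_⟩
    have h3 := h2 _ (h.stable _ (u⁻¹ : U).2 _ hξ')
    rwa [key, key, hinv'] at h3
  · rintro ⟨h1, h2⟩
    refine ⟨?_, fun ξ' hξ' => ?_⟩
    · have := h.stable _ (u⁻¹ : U).2 _ h1
      rwa [hinv] at this
    · rw [key, key]
      exact h2 _ (h.stable u u.2 _ hξ')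

/-- The common refinement of a fan with the linearity domains of the minimum over a family. -/
def refineFan (S : Set (Set (V F))) (Ξ : Set F) : Set (Set (V F)) :=
  cells S (cone F) LinearMap.id (fun ξ : Ξ => traceL (ξ : F)) (famMin Ξ)

variable [NumberField.IsTotallyReal F]

theorem unitAction_mem_cone (u : U) {q : V F} (hq : q ∈ cone F) : unitAction U u q ∈ cone F := by
  rcases hq with rfl | hq
  · rw [map_zero]; exact Or.inl rfl
  · exact Or.inr fun τ => CuspData.emb_unit_sq_mul_pos hq τ

theorem unitAction_pos (u : U) {q : V F} (hq : ∀ τ, 0 < q τ) (τ : F →+* ℝ) :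
    0 < unitAction U u q τ :=
  CuspData.emb_unit_sq_mul_pos hq τ

theorem famMin_unitAction (h : IsFamily U Ξ) (u : U) {q : V F} (hq : q ∈ cone F) :
    famMin Ξ (unitAction U u q) = famMin Ξ q := by
  obtain ⟨ξ, hξ⟩ := h.exists_isMinAt_of_mem_cone (unitAction_mem_cone u hq)
  have h1 := (isMinAt_unit_smul h u ξ q).1 hξ
  rw [hξ.famMin_eq, h1.famMin_eq]
  exact tr_emb_unit_sq_mul _ _ _

/-- Over a rational cone, all but finitely many members of a family are larger than a given one. -/
theorem IsFamily.exists_finset_lt (h : IsFamily U Ξ) {A : Finset (V F)}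
    (hA : ∀ a ∈ A, a ∈ cone F) (ξ : F) : ∃ T : Finset Ξ, ∀ γ : Ξ, γ ∉ T →
      ∀ w ∈ PointedCone.hull ℝ (A : Set (V F)), w ≠ 0 →
        tr (emb ξ * w) < tr (emb (γ : F) * w) := by
  classical
  have hfin : ∀ a ∈ A, {γ : Ξ | a ≠ 0 ∧ tr (emb (γ : F) * a) ≤ tr (emb ξ * a)}.Finite := by
    intro a ha
    by_cases h0 : a = 0
    · simp [h0]
    · refine Set.Finite.preimage (f := fun γ : Ξ => (γ : F)) Subtype.val_injective.injOn
        ((h.finite a ((hA a ha).resolve_left h0) (tr (emb ξ * a)))) |>.subset ?_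
      exact fun γ hγ => ⟨γ.2, hγ.2⟩
  have hfin' := Set.Finite.biUnion A.finite_toSet hfin
  refine ⟨hfin'.toFinset, fun γ hγ w hw hw0 => ?_⟩
  -- Only finitely many members fail to exceed `ξ` at some nonzero generator; the strict inequality
  -- at the generators passes to their nonzero nonnegative combinations.
  have hlt : ∀ a ∈ A, a ≠ 0 → tr (emb ξ * a) < tr (emb (γ : F) * a) := by
    intro a ha h0
    by_contra hle
    exact hγ (hfin'.mem_toFinset.2 (Set.mem_biUnion ha ⟨h0, not_lt.1 hle⟩))
  obtain ⟨c, hc, rfl⟩ := mem_hull_finset.1 hw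
  simp only [← traceL_apply, map_sum, map_smul, smul_eq_mul]
  obtain ⟨a, ha, hca⟩ := Finset.exists_ne_zero_of_sum_ne_zero hw0
  have ha0 : a ≠ 0 := fun h => hca (by rw [h, smul_zero])
  have hc0 : c a ≠ 0 := fun h => hca (by rw [h, zero_smul])
  refine Finset.sum_lt_sum (fun a ha => mul_le_mul_of_nonneg_left ?_ (hc a ha))
    ⟨a, ha, mul_lt_mul_of_pos_left (hlt a ha ha0) ((hc a ha).lt_of_ne hc0.symm)⟩
  by_cases h0 : a = 0
  · simp [h0]
  · exact (hlt a ha h0).le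

/-! ### Refined base fans and constancy of the Delaunay decomposition -/

namespace CuspData

variable {s : ℕ} (D : CuspData F s) {S : Set (Set (V F))}

theorem baseCellData (hS : D.IsBaseFan U S) (hΞ : IsFamily U Ξ) :
    CellData D.lattice D.lattice S (cone F) LinearMap.id (fun ξ : Ξ => traceL (ξ : F))
      (famMin Ξ) where
  fan := hS.isFan
  salient := by
    obtain ⟨τ⟩ := nonempty_embeddings (F := F)
    rintro w (hw | hw) (hw' | hw')
    · exact hw
    · exact hw
    · exact neg_eq_zero.1 hw'
    · have h1 := hw τ
      have h2 := hw' τ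
      rw [Pi.neg_apply] at h2
      linarith
  complete := fun w hw => by
    rw [← hS.complete] at hw
    exact hw
  le := fun w hw ξ => hΞ.famMin_le hw ξ.2
  attained := fun w hw => by
    obtain ⟨ξ, hξ⟩ := hΞ.exists_isMinAt_of_mem_cone hw
    exact ⟨⟨ξ, hξ.1⟩, hξ.famMin_eq.symm⟩
  rational := fun ξ x hx => dualLattice_rational _ hx
  preimage := fun σ hσ => by
    obtain ⟨A, hA, rfl⟩ := hS.isFan.rational σ hσ
    exact ⟨A, hA, fun x => Iff.rfl⟩
  cut := fun σ hσ ξ => by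
    have hσC := D.subset_cone hS hσ
    obtain ⟨A, hA, rfl⟩ := hS.isFan.rational σ hσ
    obtain ⟨T, hT⟩ := hΞ.exists_finset_lt (A := A)
      (fun a ha => hσC (Submodule.subset_span (s := (A : Set (V F))) ha)) ξ
    refine ⟨T, fun w hw H => ⟨hσC hw, IsMinAt.famMin_eq ⟨ξ.2, fun γ hγ => ?_⟩ |>.symm⟩⟩
    by_cases hγT : (⟨γ, hγ⟩ : Ξ) ∈ T
    · exact H _ hγT
    · by_cases h0 : w = 0
      · simp [h0]
      · exact (hT ⟨γ, hγ⟩ hγT w hw h0).le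

theorem isBaseFan_refineFan (hS : D.IsBaseFan U S) (hΞ : IsFamily U Ξ) :
    D.IsBaseFan U (refineFan S Ξ) := by
  have hmem : ∀ (u : U) (ξ : Ξ), (((u⁻¹ : U) : (𝓞 F)ˣ) : F) ^ 2 * (ξ : F) ∈ Ξ :=
    fun u ξ => hΞ.stable _ (u⁻¹ : U).2 _ ξ.2
  refine (D.baseCellData hS hΞ).isCompleteAdmissibleFan (unitAction U) (unitAction U)
    (fun g w => rfl) (fun u w hw => unitAction_mem_cone u hw)
    (fun u ξ => ⟨_, hmem u ξ⟩) ?_ hS.admissible ?_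
  · intro u ξ w hw
    rw [famMin_unitAction hΞ u hw]
    have : traceL ((((u⁻¹ : U) : (𝓞 F)ˣ) : F) ^ 2 * (ξ : F)) (unitAction U u w) =
        traceL (ξ : F) w := by
      refine (tr_emb_unit_sq_mul _ _ _).trans ?_
      rw [← mul_assoc, ← mul_pow, Subgroup.coe_inv, ← map_mul, Units.mul_inv, map_one, one_pow,
        one_mul]
      rfl
    rw [this]
  · intro σ hσ
    have hσC := D.subset_cone hS hσ
    obtain ⟨A, hA, rfl⟩ := hS.isFan.rational σ hσ
    have hAC : ∀ a ∈ A, a ∈ cone F :=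
      fun a ha => hσC (Submodule.subset_span (s := (A : Set (V F))) ha)
    obtain ⟨T, hT⟩ := hΞ.exists_finset_lt hAC hΞ.nonempty.some
    refine ⟨T, fun ξ₀ => ⟨1, map_one _, fun w hwC hw0 hw _ ξ hξ => ?_⟩⟩
    have h1 : (⟨_, hmem 1 ξ⟩ : Ξ) = ξ := Subtype.ext (by simp)
    rw [h1]
    by_contra hne
    have h2 := hT ξ hne w hw hw0
    have h3 := hΞ.famMin_le hwC hΞ.nonempty.some_mem
    rw [← hξ] at h3
    exact absurd h3 (not_le.2 h2)

theorem isSubdivision_refineFan (hS : D.IsBaseFan U S) (hΞ : IsFamily U Ξ) :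
    IsSubdivision (refineFan S Ξ) S := by
  refine ⟨?_, by rw [(D.isBaseFan_refineFan hS hΞ).complete, hS.complete]⟩
  rintro _ ⟨σ, hσ, A, _, rfl⟩
  exact ⟨σ, hσ, fun w hw => hw.2.1⟩

/-- A rational cone in `F ⊗ ℝ` is cut out by finitely many functionals `Tr (η q) ≥ 0`. -/
theorem exists_trace_halfspaces {B : Finset (V F)} (hB : (B : Set (V F)) ⊆ D.lattice) :
    ∃ H : Finset F, ∀ x, x ∈ PointedCone.hull ℝ (B : Set (V F)) ↔
      ∀ η ∈ H, 0 ≤ tr (emb η * x) := by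
  classical
  let bas := Module.finBasis ℚ F
  obtain ⟨H, hH, hHx⟩ := exists_halfspaces (LinearMap.range (traceL (F := F)))
    (Finset.univ.image fun i => traceL (bas i)) (by
      intro h hh
      obtain ⟨i, _, rfl⟩ := Finset.mem_image.1 hh
      exact ⟨_, rfl⟩) (by
      intro x hx
      refine eq_zero_of_tr_eq_zero
        (I := (1 : FractionalIdeal (𝓞 F)⁰ F)) one_ne_zero fun y _ => ?_
      have h1 : ∀ i, traceL (bas i) x = 0 := fun i =>
        hx _ (Finset.mem_image_of_mem _ (Finset.mem_univ i))
      have h2 : traceL y x = 0 := by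
        rw [← bas.sum_repr y, map_sum, LinearMap.sum_apply]
        refine Finset.sum_eq_zero fun i _ => ?_
        rw [map_smul, LinearMap.smul_apply, h1, smul_zero]
      exact h2) B (by
      rintro _ ⟨ξ, rfl⟩ a ha
      exact dualLattice_rational _ (hB ha))
  choose! f hf using hH
  refine ⟨H.image f, fun x => ?_⟩
  rw [hHx, Finset.forall_mem_image]
  refine forall₂_congr fun h hh => ?_
  rw [← traceL_apply, hf hh]

theorem tildeFan_subset {τ : Set (W F s)} (hτ : τ ∈ D.tildeFan S) : τ ⊆ coneTilde F s := by
  obtain ⟨σ, _, A, _, rfl⟩ := hτ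
  exact fun w hw => hw.1

theorem image_fst_eq_hull (hS : D.IsBaseFan U S) {τ : Set (W F s)} (hτ : τ ∈ D.tildeFan S) :
    ∃ B : Finset (V F), (B : Set (V F)) ⊆ D.lattice ∧
      Prod.fst '' τ = (PointedCone.hull ℝ (B : Set (V F)) : Set (V F)) := by
  classical
  obtain ⟨B, hB, rfl⟩ := (D.cellData hS).exists_eq_hull hτ
  refine ⟨B.image Prod.fst, ?_, ?_⟩
  · intro x hx
    obtain ⟨w, hw, rfl⟩ := Finset.mem_image.1 (Finset.mem_coe.1 hx)
    exact (hB hw).1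
  · have := congrArg (fun P : PointedCone ℝ (V F) => (P : Set (V F)))
      (Submodule.map_span ((LinearMap.fst ℝ (V F) (Fin s → V F)).restrictScalars
        {c : ℝ // 0 ≤ c}) (B : Set (W F s)))
    rw [Finset.coe_image]
    exact this

/-- At `l = 0` all `χ_γ` are nonnegative, so `β = 0` is minimal. Hence the base cones are themselves
projections, and `Refines` applies to them too. -/
theorem self_eq_image_fst_tau {σ : Set (V F)} (hσ : σ ⊆ cone F) :
    Prod.fst '' D.tau σ {0} = σ := by
  ext q
  constructor
  · rintro ⟨w, hw, rfl⟩
    exact hw.2.1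
  · intro hq
    have hC : ((q, 0) : W F s) ∈ coneTilde F s := by
      rcases hσ hq with rfl | h
      · exact Or.inl rfl
      · exact Or.inr h
    refine ⟨(q, 0), ⟨hC, hq, ?_⟩, rfl⟩
    intro β hβ
    rw [Finset.mem_singleton.1 hβ]
    refine (D.φ_eq fun γ => ?_).symm
    rw [χ_zero_left, χ_eq_sum]
    refine Finset.sum_nonneg fun i _ => Finset.sum_nonneg fun τ _ => ?_
    have hq0 : 0 ≤ q τ := by
      rcases hσ hq with rfl | h
      · exact le_rfl
      · exact (h τ).le
    have := mul_nonneg (mul_nonneg hq0 (D.μ_pos i τ).le) (sq_nonneg (τ (γ i : F)))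
    simpa using this

theorem image_fst_action (g : D.Gp U) (τ : Set (W F s)) :
    Prod.fst '' (D.action U g '' τ) = unitAction U g.right '' (Prod.fst '' τ) := by
  rw [Set.image_image, Set.image_image]
  rfl

/-- The family `Ξ` is so large that the linearity domains of its minimum refine the projections of
all cones of `tildeFan S`. -/
def Refines (S : Set (Set (V F))) (Ξ : Set F) : Prop :=
  ∀ τ ∈ D.tildeFan S, ∀ q ∈ Prod.fst '' τ, (∀ τ' : F →+* ℝ, 0 < q τ') → ∀ x ∈ cone F,
    (∀ ξ, IsMinAt Ξ q ξ → IsMinAt Ξ x ξ) → x ∈ Prod.fst '' τ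

/-- The total fan has finitely many orbits, and the projection of each representative is cut out by
finitely many rational hyperplanes. One family breaks along all of them, `mem_of_isMinAt_imp`
settles the representatives, and the stability of the family under unit squares transports the
result to their orbits. -/
theorem exists_refines (hS : D.IsBaseFan U S) : ∃ Ξ : Set F, IsFamily U Ξ ∧ D.Refines S Ξ := by
  classical
  obtain ⟨T, hT, hTS, HT⟩ := (D.isTotalFan_tildeFan hS).admissible.finite_orbits
  have h1 : ∀ τ ∈ T, ∃ X : Set (F × V F), Breakable U X ∧ ∃ H : Finset F,
      (∀ x, x ∈ Prod.fst '' τ ↔ ∀ η ∈ H, 0 ≤ tr (emb η * x)) ∧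
      ∀ η ∈ H, ∀ q ∈ Prod.fst '' τ, (η, q) ∈ X := by
    intro τ hτ
    obtain ⟨B, hB, hBτ⟩ := D.image_fst_eq_hull hS (hTS hτ)
    obtain ⟨H, hH⟩ := D.exists_trace_halfspaces hB
    refine ⟨⋃ η ∈ H, {p | p.1 = η ∧ p.2 ∈ PointedCone.hull ℝ (B : Set (V F))},
      breakable_biUnion H _ fun η _ => breakable_hull U η fun a ha => ?_, H, fun x => ?_, ?_⟩
    · have h2 : a ∈ Prod.fst '' τ := by
        rw [hBτ]; exact Submodule.subset_span (Finset.mem_coe.2 ha)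
      obtain ⟨w, hw, rfl⟩ := h2
      exact fst_mem_cone (D.tildeFan_subset (hTS hτ) hw)
    · rw [hBτ]; exact hH x
    · intro η hη q hq
      rw [hBτ] at hq
      exact Set.mem_biUnion (Finset.mem_coe.2 hη) ⟨rfl, hq⟩
  choose! X hX H hH hHX using h1
  obtain ⟨Ξ, hΞ, HΞ⟩ := breakable_biUnion hT.toFinset X
    fun τ hτ => hX τ (hT.mem_toFinset.1 hτ)
  refine ⟨Ξ, hΞ, ?_⟩
  intro τ hτ q hq hpos x hx himp
  obtain ⟨g, t, ht, rfl⟩ := HT τ hτ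
  rw [image_fst_action] at hq ⊢
  obtain ⟨q, hq, rfl⟩ := hq
  obtain ⟨y, hy, rfl⟩ : ∃ y ∈ cone F, unitAction U g.right y = x :=
    ⟨_, unitAction_mem_cone g.right⁻¹ hx, CellData.map_map_inv (unitAction U) g.right x⟩
  have hqpos : ∀ τ, 0 < q τ := by
    have := unitAction_pos g.right⁻¹ hpos
    rwa [CellData.map_inv_map (unitAction U)] at this
  refine ⟨y, (hH t ht y).2 (mem_of_isMinAt_imp ?_ hΞ hqpos ((hH t ht q).1 hq) hy ?_), rfl⟩
  · intro η hη q' hq' hq'H htr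
    exact HΞ (η, q') (Set.mem_biUnion (Finset.mem_coe.2 (hT.mem_toFinset.2 ht))
      (hHX t ht η hη q' ((hH t ht q').2 hq'H))) hq' htr
  · intro ξ hξ
    have hu : ((g.right : (𝓞 F)ˣ) : F) ^ 2 * ((((g.right⁻¹ : U) : (𝓞 F)ˣ) : F) ^ 2 * ξ) = ξ := by
      rw [← mul_assoc, ← mul_pow, Subgroup.coe_inv, ← map_mul, Units.mul_inv, map_one, one_pow,
        one_mul]
    have h2 := himp ((((g.right⁻¹ : U) : (𝓞 F)ˣ) : F) ^ 2 * ξ)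
    rw [isMinAt_unit_smul hΞ, isMinAt_unit_smul hΞ, hu] at h2
    exact h2 hξ

/-- A member of the family that is minimal at a relative interior point is minimal on the whole
cone, which is the hypothesis of `Refines`. If the interior point is the origin, the cone is `{0}`.
-/
theorem refineFan_subset_image_fst (hS : D.IsBaseFan U S) (hΞ : IsFamily U Ξ)
    (hR : D.Refines S Ξ) {ρ : Set (V F)} (hρ : ρ ∈ refineFan S Ξ) {q : V F} (hq : IsCore ρ q)
    {τ : Set (W F s)} (hτ : τ ∈ D.tildeFan S) (hqτ : q ∈ Prod.fst '' τ) : ρ ⊆ Prod.fst '' τ := by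
  have hC := D.baseCellData hS hΞ
  intro x hx
  have hρC : ρ ⊆ cone F := CellData.cells_subset hρ
  rcases hρC hq.1 with rfl | hq0
  · obtain ⟨ε, hε, h⟩ := hq.2 x hx
    have h1 : x = 0 := by
      have h2 : ε • x = 0 := hC.salient _ (hρC ?_) ?_
      · exact (smul_eq_zero.1 h2).resolve_left hε.ne'
      · obtain ⟨P, rfl⟩ := hC.exists_coe hρ
        exact PointedCone.smul_mem _ hε.le hx
      · rw [zero_sub] at h; exact hρC h
    rwa [h1]
  · refine hR τ hτ q hqτ hq0 x (hρC hx) fun ξ hξ => ?_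
    have h1 := hC.eq_of_isCore (i := (⟨ξ, hξ.1⟩ : Ξ)) hρ hq hξ.famMin_eq.symm hx
    exact (hΞ.isMinAt_iff (hρC hx) hξ.1).2 h1

theorem mem_delaunay_set_iff {w : W F s} (hw : w ∈ coneTilde F s) (β : D.Bs) :
    (∀ γ, D.χ β w ≤ D.χ γ w) ↔ D.χ β w = D.φ w :=
  ⟨fun h => (D.φ_eq h).symm, fun h γ => by rw [h]; exact D.φ_le hw γ⟩

theorem mem_coneTilde_of_pos {w : W F s} (h : ∀ τ, 0 < w.1 τ) : w ∈ coneTilde F s := Or.inr h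

/-- A Delaunay cell at `q` is the set of minimizers at some `(q,l)`, and this set is constant on the
relative interior of the cone `τ` around `(q,l)`. Since the projection of `τ` contains the base
cone, the relative interior of `τ` also has a point over `q'`. -/
theorem isDelaunayConstant_refineFan (hS : D.IsBaseFan U S) (hΞ : IsFamily U Ξ)
    (hR : D.Refines S Ξ) : D.IsDelaunayConstant (refineFan S Ξ) := by
  have hB := D.baseCellData hS hΞ
  have hC := D.cellData hS
  have hsub : ∀ ρ ∈ refineFan S Ξ, ∀ q, IsCore ρ q → ∀ q', IsCore ρ q' →
      D.delaunay q ⊆ D.delaunay q' := by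
    rintro ρ hρ q hq q' hq' _ ⟨l, rfl⟩
    have hρC : ρ ⊆ cone F := CellData.cells_subset hρ
    obtain ⟨P, rfl⟩ := hB.exists_coe hρ
    by_cases hqq : q = q'
    · rw [← hqq]; exact ⟨l, rfl⟩
    have hne : ∀ q q', q ≠ q' → IsCore (P : Set (V F)) q → q' ∈ P → q ≠ 0 := by
      rintro q q' hqq hq hq' rfl
      obtain ⟨ε, hε, h⟩ := hq.2 q' hq'
      rw [zero_sub] at h
      have h2 := hB.salient _ (hρC (PointedCone.smul_mem P hε.le hq')) (hρC h)
      exact hqq ((smul_eq_zero.1 h2).resolve_left hε.ne').symm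
    have hq0 := (hρC hq.1).resolve_left (hne q q' hqq hq hq'.1)
    have hq0' := (hρC hq'.1).resolve_left (hne q' q (Ne.symm hqq) hq' hq.1)
    have hw : ((q, l) : W F s) ∈ coneTilde F s := mem_coneTilde_of_pos hq0
    obtain ⟨τ, hτ, hcore⟩ := hC.exists_isCore hw
    have hsubτ := D.refineFan_subset_image_fst hS hΞ hR hρ hq hτ ⟨_, hcore.1, rfl⟩
    -- Lift `q' - εq` to some `v` in `τ`. Then `v + ε(q,l)` lies over `q'`, and adding a multiple of
    -- a relative interior point puts it in the relative interior.
    obtain ⟨ε, hε, hε'⟩ := hq'.2 q hq.1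
    obtain ⟨v, hv, hvq⟩ := hsubτ hε'
    obtain ⟨T, rfl⟩ := hC.exists_coe hτ
    have hcore' : IsCore (T : Set (W F s)) (v + ε • (q, l)) := by
      refine ⟨add_mem (SetLike.mem_coe.1 hv) (PointedCone.smul_mem T hε.le hcore.1),
        fun x hx => ?_⟩
      obtain ⟨δ, hδ, h⟩ := hcore.2 x hx
      refine ⟨ε * δ, mul_pos hε hδ, ?_⟩
      have : v + ε • ((q, l) : W F s) - (ε * δ) • x = v + ε • ((q, l) - δ • x) := by
        rw [smul_sub, mul_smul]; abel
      rw [this]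
      exact add_mem (SetLike.mem_coe.1 hv) (PointedCone.smul_mem T hε.le h)
    have hfst : (v + ε • ((q, l) : W F s)).1 = q' := by
      rw [Prod.fst_add, Prod.smul_fst, hvq, sub_add_cancel]
    refine ⟨(v + ε • ((q, l) : W F s)).2, Set.ext fun β => ?_⟩
    have heq : (q', (v + ε • ((q, l) : W F s)).2) = v + ε • ((q, l) : W F s) :=
      Prod.ext hfst.symm rfl
    simp only [Set.mem_ofPred_eq]
    rw [heq, D.mem_delaunay_set_iff hw, D.mem_delaunay_set_iff (D.tildeFan_subset hτ hcore'.1)]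
    exact ⟨fun h => hC.eq_of_isCore hτ hcore' h hcore.1, fun h => hC.eq_of_isCore hτ hcore h hcore'.1⟩
  intro ρ hρ q hq q' hq'
  obtain ⟨P, rfl⟩ := hB.exists_coe hρ
  exact subset_antisymm
    (hsub _ hρ _ (IsCore.of_mem_intrinsicInterior hq) _ (IsCore.of_mem_intrinsicInterior hq'))
    (hsub _ hρ _ (IsCore.of_mem_intrinsicInterior hq') _ (IsCore.of_mem_intrinsicInterior hq))

/-- The image is the smallest base face containing the projection of a relative interior point `w`.
Over each relative interior point of that face the set of minimizers at `w` reappears as a Delaunay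
cell, which gives a point of the cone; the remaining points of the face follow because the image is
closed. -/
theorem isEquidimensional_tildeFan (hS : D.IsBaseFan U S) (hD : D.IsDelaunayConstant S) :
    IsEquidimensional S (D.tildeFan S) := by
  intro τ hτ
  have hC := D.cellData hS
  obtain ⟨B, hB, hBτ⟩ := D.image_fst_eq_hull hS hτ
  obtain ⟨H, hH⟩ := D.exists_trace_halfspaces hB
  have hH' : ∀ x, x ∈ Prod.fst '' τ ↔ ∀ η ∈ H, 0 ≤ tr (emb η * x) := fun x => by
    rw [hBτ]; exact hH x
  obtain ⟨w, hw⟩ : ∃ w, IsCore τ w := by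
    obtain ⟨B', _, rfl⟩ := hC.exists_eq_hull hτ
    exact exists_isCore_hull B'
  have hτ' := hτ
  obtain ⟨σ, hσ, A, hA, rfl⟩ := hτ
  have hσC := D.subset_cone hS hσ
  obtain ⟨P, rfl⟩ := hS.isFan.exists_coe hσ
  have hqσ : w.1 ∈ P := hw.1.2.1
  refine ⟨_, hS.isFan.face_mem P _ hσ (minFace_isFaceOf hqσ), subset_antisymm ?_ ?_⟩
  · rintro _ ⟨v, hv, rfl⟩
    obtain ⟨ε, hε, h⟩ := hw.2 v hv
    exact mem_minFace.2 ⟨hv.2.1, ε, hε, h.2.1⟩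
  have hcore := isCore_minFace hqσ
  have hmin := hS.isFan.face_mem P _ hσ (minFace_isFaceOf hqσ)
  have key : ∀ q', IsCore (minFace P w.1 hqσ : Set (V F)) q' → q' ∈ Prod.fst '' D.tau P A := by
    intro q' hq'
    rcases hσC hq'.1.1 with h0 | hq0'
    · refine ⟨0, ⟨Or.inl rfl, zero_mem P, fun β _ => ?_⟩, h0.symm⟩
      have h1 := D.φ_smul (w := 0) (Or.inl rfl) le_rfl
      rw [zero_smul, zero_mul] at h1
      rw [h1]
      exact (D.χL β).map_zero
    · have h1 := hD _ hmin _ hcore.mem_intrinsicInterior _ hq'.mem_intrinsicInterior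
      obtain ⟨l', hl'⟩ : {β | ∀ γ, D.χ β w ≤ D.χ γ w} ∈ D.delaunay q' := by
        rw [← h1]; exact ⟨w.2, rfl⟩
      have hwC : ((q', l') : W F s) ∈ coneTilde F s := mem_coneTilde_of_pos hq0'
      refine ⟨(q', l'), ⟨hwC, hq'.1.1, fun β hβ => ?_⟩, rfl⟩
      rw [← D.mem_delaunay_set_iff hwC]
      have h2 : β ∈ {β | ∀ γ, D.χ β w ≤ D.χ γ w} :=
        (D.mem_delaunay_set_iff hw.1.1 β).2 (hw.1.2.2 β hβ)
      rw [← hl'] at h2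
      exact h2
  intro x hx
  rw [hH']
  intro η hη
  by_contra hneg
  rw [not_le] at hneg
  -- Any point of the face is a limit of relative interior points, so a functional nonnegative on
  -- the image cannot be negative at `x`.
  have hcx : ∀ δ : ℝ, 0 < δ → IsCore (minFace P w.1 hqσ : Set (V F)) (x + δ • w.1) := by
    intro δ hδ
    refine ⟨add_mem (SetLike.mem_coe.1 hx) (PointedCone.smul_mem _ hδ.le hcore.1), fun y hy => ?_⟩
    obtain ⟨ε, hε, h⟩ := hcore.2 y hy
    refine ⟨δ * ε, mul_pos hδ hε, ?_⟩
    have : x + δ • w.1 - (δ * ε) • y = x + δ • (w.1 - ε • y) := by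
      rw [smul_sub, mul_smul]; abel
    rw [this]
    exact add_mem (SetLike.mem_coe.1 hx) (PointedCone.smul_mem _ hδ.le h)
  obtain ⟨δ, hδ, h⟩ := exists_pos_mul_le {()} (fun _ => |tr (emb η * w.1)| + 1)
    (fun _ => -tr (emb η * x) / 2) (fun _ _ => by linarith)
  have h1 := (hH' _).1 (key _ (hcx δ hδ)) η hη
  rw [mul_add, tr_add, mul_smul_comm, tr_smul] at h1
  have h2 := h () (Finset.mem_singleton_self _)
  have h3 := mul_le_mul_of_nonneg_left (le_abs_self (tr (emb η * w.1))) hδ.le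
  nlinarith

theorem exists_delaunayConstant_subdivision (hS : D.IsBaseFan U S) :
    ∃ S₁ : Set (Set (V F)), D.IsBaseFan U S₁ ∧ IsSubdivision S₁ S ∧
      D.IsDelaunayConstant S₁ ∧ IsEquidimensional S₁ (D.tildeFan S₁) := by
  obtain ⟨Ξ, hΞ, hR⟩ := D.exists_refines hS
  have h1 := D.isBaseFan_refineFan hS hΞ
  have h2 := D.isDelaunayConstant_refineFan hS hΞ hR
  exact ⟨_, h1, D.isSubdivision_refineFan hS hΞ, h2, D.isEquidimensional_tildeFan h1 h2⟩

/-- Each cone of the refinement is the equality set of a rational functional that bounds the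
minimum over the family from above. -/
theorem exists_strict_functional (hS : D.IsBaseFan U S) (hΞ : IsFamily U Ξ) (hR : D.Refines S Ξ)
    {ρ : Set (V F)} (hρ : ρ ∈ refineFan S Ξ) : ∃ ξ : F, (∀ τ : F →+* ℝ, 0 < τ ξ) ∧
      ∀ x ∈ cone F, famMin Ξ x ≤ tr (emb ξ * x) ∧ (tr (emb ξ * x) = famMin Ξ x ↔ x ∈ ρ) := by
  classical
  have hC := D.baseCellData hS hΞ
  have hρC : ρ ⊆ cone F := CellData.cells_subset hρ
  obtain ⟨q, hq⟩ : ∃ q, IsCore ρ q := by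
    obtain ⟨B, _, rfl⟩ := hC.exists_eq_hull hρ
    exact exists_isCore_hull B
  have hne := nonempty_embeddings (F := F)
  rcases hρC hq.1 with hq0 | hq0
  · have hρ0 : ∀ x, x ∈ ρ ↔ x = 0 := by
      intro x
      constructor
      · intro hx
        obtain ⟨ε, hε, h⟩ := hq.2 x hx
        obtain ⟨P, rfl⟩ := hC.exists_coe hρ
        rw [hq0, zero_sub] at h
        have h2 := hC.salient _ (hρC (PointedCone.smul_mem P hε.le hx)) (hρC h)
        exact (smul_eq_zero.1 h2).resolve_left hε.ne'
      · rintro rfl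
        rw [← hq0]; exact hq.1
    -- For the cone `{0}` twice a member of the family works: away from the origin it is strictly
    -- larger than the minimum.
    obtain ⟨ξ, hξ⟩ := hΞ.nonempty
    have hpos : ∀ τ : F →+* ℝ, 0 < τ (ξ + ξ) := fun τ => by
      rw [map_add]; exact add_pos (hΞ.pos ξ hξ τ) (hΞ.pos ξ hξ τ)
    refine ⟨ξ + ξ, hpos, fun x hx => ?_⟩
    have h1 := hΞ.famMin_le hx hξ
    have h2 : tr (emb (ξ + ξ) * x) = tr (emb ξ * x) + tr (emb ξ * x) := by
      rw [map_add, add_mul, tr_add]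
    rw [h2, hρ0]
    rcases hx with rfl | hx
    · have h3 := (isMinAt_zero hξ).famMin_eq
      rw [mul_zero] at h3 ⊢
      have h4 : tr (0 : V F) = 0 := (trL F).map_zero
      rw [h4] at h3 ⊢
      simp [h3]
    · have h3 := tr_emb_pos (hΞ.pos ξ hξ) hx
      refine ⟨by linarith, ⟨fun h => ?_, fun h => ?_⟩⟩
      · linarith
      · obtain ⟨τ⟩ := hne
        have := hx τ
        rw [h] at this
        exact absurd this (lt_irrefl _)
  -- Otherwise the mean of all members minimal at a relative interior point `q` is used. Equality
  -- with the minimum at `x` forces each of them to be minimal at `x`.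
  · have hfin : {ξ | IsMinAt Ξ q ξ}.Finite :=
      (hΞ.finite q hq0 (famMin Ξ q)).subset fun ξ hξ => ⟨hξ.1, hξ.famMin_eq.ge⟩
    set T := hfin.toFinset with hT
    have hTmem : ∀ ξ, ξ ∈ T ↔ IsMinAt Ξ q ξ := fun ξ => hfin.mem_toFinset
    have hTne : T.Nonempty := by
      obtain ⟨ξ, hξ⟩ := hΞ.exists_isMinAt hq0
      exact ⟨ξ, (hTmem ξ).2 hξ⟩
    have hcard : (0 : ℝ) < T.card := by exact_mod_cast hTne.card_pos
    have hval : ∀ x : V F, T.card * tr (emb ((T.card : ℚ)⁻¹ • ∑ ξ ∈ T, ξ) * x) =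
        ∑ ξ ∈ T, tr (emb ξ * x) := by
      intro x
      rw [← traceL_apply, map_smul, map_sum, LinearMap.smul_apply, LinearMap.sum_apply,
        Rat.smul_def]
      push_cast
      rw [mul_inv_cancel_left₀ hcard.ne']
      rfl
    refine ⟨(T.card : ℚ)⁻¹ • ∑ ξ ∈ T, ξ, fun τ => ?_, fun x hx => ?_⟩
    · rw [Rat.smul_def, map_mul, map_ratCast, map_sum]
      push_cast
      exact mul_pos (inv_pos.2 hcard) (Finset.sum_pos (fun ξ hξ =>
        hΞ.pos ξ ((hTmem ξ).1 hξ).1 τ) hTne)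
    · have hle : ∀ ξ ∈ T, famMin Ξ x ≤ tr (emb ξ * x) := fun ξ hξ =>
        hΞ.famMin_le hx ((hTmem ξ).1 hξ).1
      have h1 := Finset.sum_le_sum hle
      have h2 := Finset.sum_eq_sum_iff_of_le hle
      rw [Finset.sum_const, nsmul_eq_mul, ← hval] at h1 h2
      refine ⟨le_of_mul_le_mul_left h1 hcard, ?_⟩
      rw [eq_comm, ← mul_right_inj' hcard.ne', h2]
      constructor
      · intro h
        have himp : ∀ ξ, IsMinAt Ξ q ξ → IsMinAt Ξ x ξ := fun ξ hξ =>
          (hΞ.isMinAt_iff hx hξ.1).2 (h ξ ((hTmem ξ).2 hξ)).symm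
        have hρ' := hρ
        obtain ⟨σ, hσ, A, hA, rfl⟩ := hρ'
        refine ⟨hx, ?_, fun i hi => ((himp i ?_).famMin_eq).symm⟩
        -- Minimality alone does not place `x` in the base cone `σ`; this follows from `Refines`,
        -- because `σ` is a projection.
        · have h3 := D.self_eq_image_fst_tau (D.subset_cone hS hσ)
          have h4 := hR _ ⟨σ, hσ, {0}, Finset.singleton_nonempty _, rfl⟩ q
          rw [h3] at h4
          exact h4 hq.1.2.1 hq0 x hx himp
        · exact (hΞ.isMinAt_iff (hρC hq.1) i.2).2 (hq.1.2.2 i hi)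
      · intro hxρ ξ hξ
        have hξ := (hTmem ξ).1 hξ
        exact (hC.eq_of_isCore (i := (⟨ξ, hξ.1⟩ : Ξ)) hρ hq hξ.famMin_eq.symm hxρ).symm

end CuspData

end BaseRefinement

/-! ### Convex functions on a cone that are equivariant up to linear functions -/

section Twisted

variable {E G : Type*} [AddCommGroup E] [Module ℝ E] [Group G]

/-- A cone with the action of a group, a lattice, a space of functionals that are rational on the
lattice, and a function `ψ` that is equivariant up to linear functions `θ g`. -/
structure TwistedCone (E G : Type*) [AddCommGroup E] [Module ℝ E] [Group G] where
  ρ : G →* Module.End ℝ E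
  N : AddSubgroup E
  C : PointedCone ℝ E
  R : Submodule ℚ (E →ₗ[ℝ] ℝ)
  H : Finset (E →ₗ[ℝ] ℝ)
  ψ : E → ℝ
  θ : G → E →ₗ[ℝ] ℝ
  salient : ∀ x ∈ C, -x ∈ C → x = 0
  map_mem : ∀ g, ∀ x ∈ C, ρ g x ∈ C
  map_lattice : ∀ g, ∀ x ∈ N, ρ g x ∈ N
  comp_mem : ∀ g, ∀ L ∈ R, L ∘ₗ ρ g ∈ R
  rational : ∀ L ∈ R, ∀ x ∈ N, ∃ r : ℚ, L x = r
  H_subset : (H : Set (E →ₗ[ℝ] ℝ)) ⊆ R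
  H_integer : ∀ h ∈ H, ∀ x ∈ N, ∃ z : ℤ, h x = z
  H_separating : ∀ x, (∀ h ∈ H, h x = 0) → x = 0
  θ_mem : ∀ g, θ g ∈ R
  ψ_map : ∀ g, ∀ w ∈ C, w ≠ 0 → ψ (ρ g w) = ψ w + θ g w

namespace TwistedCone

variable (T : TwistedCone E G)

theorem map_inv_map (g : G) (x : E) : T.ρ g⁻¹ (T.ρ g x) = x := CellData.map_inv_map T.ρ g x

theorem map_map_inv (g : G) (x : E) : T.ρ g (T.ρ g⁻¹ x) = x := CellData.map_map_inv T.ρ g x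

theorem map_injective (g : G) : Function.Injective (T.ρ g) :=
  Function.LeftInverse.injective (T.map_inv_map g)

theorem map_ne_zero (g : G) {x : E} (hx : x ≠ 0) : T.ρ g x ≠ 0 := fun h =>
  hx (T.map_injective g (h.trans (map_zero _).symm))

theorem θ_inv (g : G) {w : E} (hw : w ∈ T.C) (hw0 : w ≠ 0) : T.θ g⁻¹ (T.ρ g w) = -T.θ g w := by
  have h1 := T.ψ_map g⁻¹ _ (T.map_mem g w hw) (T.map_ne_zero g hw0)
  rw [T.map_inv_map, T.ψ_map g w hw hw0] at h1
  linarith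

theorem hull_le {A : Finset E} (hA : ∀ p ∈ A, p ∈ T.C) : PointedCone.hull ℝ (A : Set E) ≤ T.C :=
  Submodule.span_le.2 hA

/-- The functionals in `H` are integral on the lattice and separate points, so a lattice point is
determined by finitely many bounded integers. -/
theorem finite_abs_le (b : (E →ₗ[ℝ] ℝ) → ℝ) :
    {p | p ∈ T.N ∧ ∀ h ∈ T.H, |h p| ≤ b h}.Finite := by
  have hfin : (Set.pi Set.univ fun h : T.H => Set.Icc (-⌈b h⌉) ⌈b h⌉).Finite :=
    Set.Finite.pi fun h => Set.finite_Icc _ _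
  refine Set.Finite.of_injOn (f := fun p => fun h : T.H => ⌊(h : E →ₗ[ℝ] ℝ) p⌋) ?_ ?_ hfin
  · rintro p ⟨hp, hb⟩ h _
    obtain ⟨z, hz⟩ := T.H_integer h h.2 p hp
    have h1 := abs_le.1 (hb h h.2)
    simp only [hz, Int.floor_intCast, Set.mem_Icc] at h1 ⊢
    have h2 := Int.le_ceil (b h)
    constructor
    · have : ((-⌈b h⌉ : ℤ) : ℝ) ≤ z := by push_cast; linarith
      exact_mod_cast this
    · have : (z : ℝ) ≤ (⌈b h⌉ : ℤ) := by linarith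
      exact_mod_cast this
  · rintro p ⟨hp, -⟩ p' ⟨hp', -⟩ h
    refine sub_eq_zero.1 (T.H_separating _ fun l hl => ?_)
    obtain ⟨z, hz⟩ := T.H_integer l hl p hp
    obtain ⟨z', hz'⟩ := T.H_integer l hl p' hp'
    have h1 : ⌊l p⌋ = ⌊l p'⌋ := congrFun h ⟨l, hl⟩
    rw [hz, hz', Int.floor_intCast, Int.floor_intCast] at h1
    rw [map_sub, hz, hz', h1, sub_self]

/-- A rational functional `L` such that `L - k ψ` bounds all rational functionals on the cone. -/
def Good (k : ℕ) (L : E →ₗ[ℝ] ℝ) : Prop :=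
  L ∈ T.R ∧ ∀ l ∈ T.R, ∃ K : ℝ, 0 < K ∧ ∀ w ∈ T.C, w ≠ 0 → l w ≤ K * (L w - k * T.ψ w)

variable {T} {k : ℕ} {L : E →ₗ[ℝ] ℝ}

theorem Good.nonneg (hL : T.Good k L) {w : E} (hw : w ∈ T.C) (hw0 : w ≠ 0) :
    0 ≤ L w - k * T.ψ w := by
  obtain ⟨K, hK, h⟩ := hL.2 0 (zero_mem _)
  exact nonneg_of_mul_nonneg_right (h w hw hw0) hK

/-- `L - kψ` dominates every coordinate functional and its negative, so an upper bound for it bounds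
all coordinates. This properness replaces local finiteness of the decompositions. -/
theorem Good.finite_le (hL : T.Good k L) (M : ℝ) :
    {p | p ∈ T.N ∧ p ∈ T.C ∧ p ≠ 0 ∧ L p - k * T.ψ p ≤ M}.Finite := by
  have h1 : ∀ h ∈ T.H, ∃ b : ℝ, ∀ p ∈ T.C, p ≠ 0 → L p - k * T.ψ p ≤ M → |h p| ≤ b := by
    intro h hh
    obtain ⟨K, hK, H⟩ := hL.2 h (T.H_subset hh)
    obtain ⟨K', hK', H'⟩ := hL.2 (-h) (neg_mem (T.H_subset hh))
    refine ⟨max (K * M) (K' * M), fun p hp hp0 hM => abs_le'.2 ⟨?_, ?_⟩⟩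
    · exact ((H p hp hp0).trans (mul_le_mul_of_nonneg_left hM hK.le)).trans (le_max_left _ _)
    · exact ((H' p hp hp0).trans (mul_le_mul_of_nonneg_left hM hK'.le)).trans (le_max_right _ _)
  choose! b hb using h1
  exact (T.finite_abs_le b).subset fun p ⟨hN, hC, h0, hM⟩ => ⟨hN, fun h hh => hb h hh p hC h0 hM⟩

/-- If `-l ≤ K(L - kψ)` and `n ≥ K + 1`, then `nL + l - nkψ ≥ L - kψ`, so the old domination is
inherited. -/
theorem Good.exists_smul_add (hL : T.Good k L) {l : E →ₗ[ℝ] ℝ} (hl : l ∈ T.R) :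
    ∃ n₀ : ℕ, ∀ n : ℕ, n₀ ≤ n → T.Good (n * k) ((n : ℝ) • L + l) := by
  obtain ⟨K, hK, H⟩ := hL.2 (-l) (neg_mem hl)
  obtain ⟨n₀, hn₀⟩ := exists_nat_ge (K + 1)
  refine ⟨n₀, fun n hn => ⟨?_, fun l' hl' => ?_⟩⟩
  · refine add_mem ?_ hl
    rw [Nat.cast_smul_eq_nsmul]
    exact nsmul_mem hL.1 n
  · obtain ⟨K', hK', H'⟩ := hL.2 l' hl'
    refine ⟨K', hK', fun w hw hw0 => (H' w hw hw0).trans (mul_le_mul_of_nonneg_left ?_ hK'.le)⟩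
    have h1 := H w hw hw0
    have h2 := hL.nonneg hw hw0
    have h3 : (n₀ : ℝ) ≤ n := by exact_mod_cast hn
    simp only [LinearMap.add_apply, LinearMap.smul_apply, LinearMap.neg_apply, smul_eq_mul,
      Nat.cast_mul] at h1 ⊢
    nlinarith

variable (T) in
/-- The functional that corresponds to `L` under the action of `g` on functions that are
equivariant up to `k` times `θ`. -/
def translate (k : ℕ) (L : E →ₗ[ℝ] ℝ) (g : G) : E →ₗ[ℝ] ℝ :=
  L ∘ₗ T.ρ g⁻¹ - (k : ℝ) • T.θ g⁻¹

theorem translate_apply_map (g : G) {w : E} (hw : w ∈ T.C) (hw0 : w ≠ 0) :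
    T.translate k L g (T.ρ g w) = L w + k * T.θ g w := by
  simp only [translate, LinearMap.sub_apply, LinearMap.comp_apply, LinearMap.smul_apply,
    smul_eq_mul]
  rw [T.map_inv_map, T.θ_inv g hw hw0]
  ring

theorem Good.translate (hL : T.Good k L) (g : G) : T.Good k (T.translate k L g) := by
  refine ⟨sub_mem (T.comp_mem _ _ hL.1) ?_, fun l hl => ?_⟩
  · rw [Nat.cast_smul_eq_nsmul]
    exact nsmul_mem (T.θ_mem _) k
  · obtain ⟨K, hK, H⟩ := hL.2 _ (T.comp_mem g l hl)
    refine ⟨K, hK, fun w hw hw0 => ?_⟩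
    obtain ⟨v, hv, hv0, rfl⟩ : ∃ v ∈ T.C, v ≠ 0 ∧ T.ρ g v = w :=
      ⟨_, T.map_mem g⁻¹ w hw, T.map_ne_zero g⁻¹ hw0, T.map_map_inv g w⟩
    have h1 := H v hv hv0
    rw [translate_apply_map g hv hv0, T.ψ_map g v hv hv0]
    refine h1.trans (le_of_eq ?_)
    ring

/-! ### Polyhedral decompositions given by vertices -/

variable [DecidableEq E]

variable (T) in
/-- A decomposition of the cone into the cones spanned by the members of `K`, with the values `h`
at the vertices of a function that is linear on each cone, strictly concave, and equivariant up to
`k` times `θ`. -/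
structure State (k : ℕ) (K : Set (Finset E)) (h : E → ℝ) : Prop where
  pos : 0 < k
  lattice : ∀ A ∈ K, ∀ p ∈ A, p ∈ T.N
  mem : ∀ A ∈ K, ∀ p ∈ A, p ∈ T.C
  ne_zero : ∀ A ∈ K, ∀ p ∈ A, p ≠ 0
  stable : ∀ g, ∀ A ∈ K, A.image (T.ρ g) ∈ K
  finite_orbits : ∃ F : Set (Finset E), F.Finite ∧ F ⊆ K ∧
    ∀ A ∈ K, ∃ g, ∃ B ∈ F, A = B.image (T.ρ g)
  twisted : ∀ A ∈ K, ∀ p ∈ A, ∀ g, h (T.ρ g p) = h p + k * T.θ g p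
  cover : ∀ w ∈ T.C, ∃ A ∈ K, ∃ c : E → ℝ, (∀ p ∈ A, 0 < c p) ∧ w = ∑ p ∈ A, c p • p
  strict : ∀ A ∈ K, ∃ L, T.Good k L ∧ (∀ p ∈ A, L p = h p) ∧ ∀ B ∈ K, ∀ p ∈ B, p ∉ A → h p < L p

/-- The piecewise linear function with the values `h` at the vertices. -/
def pl (K : Set (Finset E)) (h : E → ℝ) (w : E) : ℝ :=
  sSup {y | ∃ A ∈ K, ∃ c : E → ℝ, (∀ p ∈ A, 0 ≤ c p) ∧ w = ∑ p ∈ A, c p • p ∧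
    y = ∑ p ∈ A, c p * h p}

/-- `L` supports the piecewise linear function along the cell `A`. -/
def Supports (T : TwistedCone E G) (k : ℕ) (K : Set (Finset E)) (h : E → ℝ) (A : Finset E)
    (L : E →ₗ[ℝ] ℝ) : Prop :=
  T.Good k L ∧ (∀ p ∈ A, L p = h p) ∧ ∀ B ∈ K, ∀ p ∈ B, p ∉ A → h p < L p

/-! ### The piecewise linear function of a decomposition -/

namespace State

variable {K : Set (Finset E)} {h : E → ℝ}

theorem supports_le {A B : Finset E} (hL : T.Supports k K h A L) (hB : B ∈ K) {p : E}
    (hp : p ∈ B) : h p ≤ L p := by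
  by_cases hpA : p ∈ A
  · exact (hL.2.1 p hpA).ge
  · exact (hL.2.2 B hB p hp hpA).le

theorem apply_sum (L : E →ₗ[ℝ] ℝ) (A : Finset E) (c : E → ℝ) :
    L (∑ p ∈ A, c p • p) = ∑ p ∈ A, c p * L p := by
  simp only [map_sum, map_smul, smul_eq_mul]

theorem sum_le_apply {A B : Finset E} (hL : T.Supports k K h A L) (hB : B ∈ K) {c : E → ℝ}
    (hc : ∀ p ∈ B, 0 ≤ c p) : ∑ p ∈ B, c p * h p ≤ L (∑ p ∈ B, c p • p) := by
  rw [apply_sum]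
  exact Finset.sum_le_sum fun p hp => mul_le_mul_of_nonneg_left (supports_le hL hB hp) (hc p hp)

theorem apply_eq_sum {A : Finset E} (hL : T.Supports k K h A L) (c : E → ℝ) :
    L (∑ p ∈ A, c p • p) = ∑ p ∈ A, c p * h p := by
  rw [apply_sum]
  exact Finset.sum_congr rfl fun p hp => by rw [hL.2.1 p hp]

/-- Two representations of a point over cells `A` and `B` give the same value: the support
functional of each cell bounds the value computed in the other. So the supremum is over a single
number. -/
theorem pl_sum (S : T.State k K h) {A : Finset E} (hA : A ∈ K) {c : E → ℝ}
    (hc : ∀ p ∈ A, 0 ≤ c p) : pl K h (∑ p ∈ A, c p • p) = ∑ p ∈ A, c p * h p := by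
  have : {y | ∃ B ∈ K, ∃ d : E → ℝ, (∀ p ∈ B, 0 ≤ d p) ∧ ∑ p ∈ A, c p • p = ∑ p ∈ B, d p • p ∧
      y = ∑ p ∈ B, d p * h p} = {∑ p ∈ A, c p * h p} := by
    refine Set.eq_singleton_iff_unique_mem.2 ⟨⟨A, hA, c, hc, rfl, rfl⟩, ?_⟩
    rintro _ ⟨B, hB, d, hd, he, rfl⟩
    obtain ⟨L, hL⟩ := S.strict A hA
    obtain ⟨L', hL'⟩ := S.strict B hB
    have h1 := sum_le_apply hL hB hd
    have h2 := sum_le_apply hL' hA hc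
    rw [← he, apply_eq_sum hL] at h1
    rw [he, apply_eq_sum hL'] at h2
    exact le_antisymm h1 h2
  rw [pl, this, csSup_singleton]

theorem pl_vertex (S : T.State k K h) {A : Finset E} (hA : A ∈ K) {p : E} (hp : p ∈ A) :
    pl K h p = h p := by
  have h1 := S.pl_sum hA (c := fun x => if x = p then 1 else 0) fun x _ => by split_ifs <;> simp
  simpa [hp] using h1

theorem pl_le (S : T.State k K h) {A : Finset E} (hL : T.Supports k K h A L) {w : E}
    (hw : w ∈ T.C) : pl K h w ≤ L w := by
  obtain ⟨B, hB, c, hc, rfl⟩ := S.cover w hw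
  rw [S.pl_sum hB fun p hp => (hc p hp).le]
  exact sum_le_apply hL hB fun p hp => (hc p hp).le

theorem pl_eq_of_mem_hull (S : T.State k K h) {A : Finset E} (hA : A ∈ K)
    (hL : T.Supports k K h A L) {w : E} (hw : w ∈ PointedCone.hull ℝ (A : Set E)) :
    pl K h w = L w := by
  obtain ⟨c, hc, rfl⟩ := mem_hull_finset.1 hw
  rw [S.pl_sum hA hc, apply_eq_sum hL]

/-- `L` exceeds the height strictly at every vertex outside `A`, so equality at a strictly positive
combination leaves no such vertex in `B`. All intersection properties of the cells come from this.
-/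
theorem subset_of_pl_eq (S : T.State k K h) {A B : Finset E} (hL : T.Supports k K h A L)
    (hB : B ∈ K) {c : E → ℝ} (hc : ∀ p ∈ B, 0 < c p)
    (he : pl K h (∑ p ∈ B, c p • p) = L (∑ p ∈ B, c p • p)) : B ⊆ A := by
  rw [S.pl_sum hB fun p hp => (hc p hp).le, apply_sum] at he
  have h1 := (Finset.sum_eq_sum_iff_of_le fun p hp =>
    mul_le_mul_of_nonneg_left (supports_le hL hB hp) (hc p hp).le).1 he
  intro p hp
  by_contra hpA
  have h2 := mul_left_cancel₀ (hc p hp).ne' (h1 p hp)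
  exact absurd h2 (hL.2.2 B hB p hp hpA).ne

/-- A point is in the cone over a cell if and only if the piecewise linear function agrees there
with the support function of the cell. -/
theorem mem_hull_iff (S : T.State k K h) {A : Finset E} (hA : A ∈ K)
    (hL : T.Supports k K h A L) {w : E} (hw : w ∈ T.C) :
    w ∈ PointedCone.hull ℝ (A : Set E) ↔ pl K h w = L w := by
  refine ⟨S.pl_eq_of_mem_hull hA hL, fun he => ?_⟩
  obtain ⟨B, hB, c, hc, rfl⟩ := S.cover w hw
  have h1 := S.subset_of_pl_eq hL hB hc he
  exact Submodule.span_mono (Finset.coe_subset.2 h1) (sum_smul_mem_hull fun p hp => (hc p hp).le)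

theorem subset_of_mem_hull (S : T.State k K h) {A B : Finset E} (hA : A ∈ K) (hB : B ∈ K)
    {c : E → ℝ} (hc : ∀ p ∈ B, 0 < c p)
    (hw : ∑ p ∈ B, c p • p ∈ PointedCone.hull ℝ (A : Set E)) : B ⊆ A := by
  obtain ⟨L, hL⟩ := S.strict A hA
  exact S.subset_of_pl_eq hL hB hc (S.pl_eq_of_mem_hull hA hL hw)

theorem mem_of_mem_hull (S : T.State k K h) {A B : Finset E} (hA : A ∈ K) (hB : B ∈ K) {p : E}
    (hp : p ∈ B) (hpA : p ∈ PointedCone.hull ℝ (A : Set E)) : p ∈ A := by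
  obtain ⟨L, hL⟩ := S.strict A hA
  have h1 := S.pl_eq_of_mem_hull hA hL hpA
  rw [S.pl_vertex hB hp] at h1
  by_contra hne
  exact absurd h1 (hL.2.2 B hB p hp hne).ne

theorem sum_image (g : G) (A : Finset E) (c : E → ℝ) :
    T.ρ g (∑ p ∈ A, c p • p) = ∑ p ∈ A.image (T.ρ g), c (T.ρ g⁻¹ p) • p := by
  rw [Finset.sum_image fun x _ y _ hxy => T.map_injective g hxy, map_sum]
  exact Finset.sum_congr rfl fun p _ => by rw [map_smul, T.map_inv_map]

theorem map_mem_hull (g : G) {A : Finset E} {w : E}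
    (hw : w ∈ PointedCone.hull ℝ (A : Set E)) :
    T.ρ g w ∈ PointedCone.hull ℝ ((A.image (T.ρ g) : Finset E) : Set E) := by
  obtain ⟨c, hc, rfl⟩ := mem_hull_finset.1 hw
  rw [sum_image]
  refine sum_smul_mem_hull fun p hp => ?_
  obtain ⟨a, ha, rfl⟩ := Finset.mem_image.1 hp
  rw [T.map_inv_map]
  exact hc a ha

theorem image_inv_image (g : G) (A : Finset E) : (A.image (T.ρ g)).image (T.ρ g⁻¹) = A := by
  have : T.ρ g⁻¹ ∘ T.ρ g = id := funext fun x => T.map_inv_map g x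
  rw [Finset.image_image, this, Finset.image_id]

theorem image_mul (g g' : G) (A : Finset E) :
    A.image (T.ρ (g * g')) = (A.image (T.ρ g')).image (T.ρ g) := by
  rw [Finset.image_image, map_mul]
  rfl

theorem map_mem_hull_iff (g : G) {A : Finset E} {w : E} :
    T.ρ g w ∈ PointedCone.hull ℝ ((A.image (T.ρ g) : Finset E) : Set E) ↔
      w ∈ PointedCone.hull ℝ (A : Set E) := by
  refine ⟨fun hw => ?_, map_mem_hull g⟩
  have := map_mem_hull (T := T) g⁻¹ hw
  rwa [image_inv_image, T.map_inv_map] at this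

theorem pl_map (S : T.State k K h) (g : G) {w : E} (hw : w ∈ T.C) :
    pl K h (T.ρ g w) = pl K h w + k * T.θ g w := by
  obtain ⟨A, hA, c, hc, rfl⟩ := S.cover w hw
  rw [sum_image, S.pl_sum (S.stable g A hA), S.pl_sum hA fun p hp => (hc p hp).le, apply_sum,
    Finset.sum_image fun x _ y _ hxy => T.map_injective g hxy, Finset.mul_sum,
    ← Finset.sum_add_distrib]
  · refine Finset.sum_congr rfl fun p hp => ?_
    rw [T.map_inv_map, S.twisted A hA p hp]
    ring
  · intro p hp
    obtain ⟨a, ha, rfl⟩ := Finset.mem_image.1 hp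
    rw [T.map_inv_map]
    exact (hc a ha).le

/-- Support functions can be translated. -/
theorem _root_.VoronoiDelaunay.TwistedCone.Supports.translate {A : Finset E}
    (hst : ∀ g, ∀ A ∈ K, A.image (T.ρ g) ∈ K) (hmem : ∀ A ∈ K, ∀ p ∈ A, p ∈ T.C ∧ p ≠ 0)
    (htw : ∀ A ∈ K, ∀ p ∈ A, ∀ g, h (T.ρ g p) = h p + k * T.θ g p)
    (hA : A ∈ K) (hL : T.Supports k K h A L) (g : G) :
    T.Supports k K h (A.image (T.ρ g)) (T.translate k L g) := by
  refine ⟨hL.1.translate g, fun p hp => ?_, fun B hB p hp hpA => ?_⟩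
  · obtain ⟨a, ha, rfl⟩ := Finset.mem_image.1 hp
    rw [translate_apply_map g (hmem A hA a ha).1 (hmem A hA a ha).2, hL.2.1 a ha, htw A hA a ha]
  · have hB' := hst g⁻¹ B hB
    have hp' := Finset.mem_image_of_mem (T.ρ g⁻¹) hp
    have h1 := T.map_map_inv g p
    have h2 : T.ρ g⁻¹ p ∉ A := fun h => hpA (h1 ▸ Finset.mem_image_of_mem _ h)
    rw [← h1, translate_apply_map g (hmem _ hB' _ hp').1 (hmem _ hB' _ hp').2, htw _ hB' _ hp']
    exact add_lt_add_left (hL.2.2 _ hB' _ hp' h2) _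

end State

end TwistedCone

end Twisted

/-! ### Stellar subdivision -/

namespace TwistedCone

section Star

variable {E G : Type*} [AddCommGroup E] [Module ℝ E] [Group G] [DecidableEq E]

/-- A set of lattice points, stable under the group with finitely many orbits, such that each cell
contains at most one of them. -/
structure IsCenter (T : TwistedCone E G) (K : Set (Finset E)) (W : Set E) : Prop where
  lattice : ∀ w ∈ W, w ∈ T.N
  mem : ∀ w ∈ W, w ∈ T.C
  ne_zero : ∀ w ∈ W, w ≠ 0
  stable : ∀ g, ∀ w ∈ W, T.ρ g w ∈ W
  finite_orbits : ∃ F : Set E, F.Finite ∧ F ⊆ W ∧ ∀ w ∈ W, ∃ g, ∃ v ∈ F, w = T.ρ g v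
  unique : ∀ B ∈ K, ∀ w ∈ W, ∀ w' ∈ W, w ∈ PointedCone.hull ℝ (B : Set E) →
    w' ∈ PointedCone.hull ℝ (B : Set E) → w = w'

/-- The cells of the stellar subdivision. -/
def starCells (K : Set (Finset E)) (W : Set E) : Set (Finset E) :=
  {B | B ∈ K ∧ ∀ w ∈ W, w ∉ PointedCone.hull ℝ (B : Set E)} ∪
  {A | ∃ w ∈ W, ∃ B' ∈ K, ∃ B ∈ K, w ∈ PointedCone.hull ℝ (B : Set E) ∧ B' ⊆ B ∧
    w ∉ PointedCone.hull ℝ (B' : Set E) ∧ A = insert w B'}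

open scoped Classical in
/-- The values at the vertices of the stellar subdivision. -/
def starHeight (K : Set (Finset E)) (h : E → ℝ) (W : Set E) (n : ℕ) (p : E) : ℝ :=
  n * pl K h p + if p ∈ W then 1 else 0

variable {T : TwistedCone E G} {k : ℕ} {K : Set (Finset E)} {h : E → ℝ} {W : Set E}

theorem starHeight_of_mem {p : E} (hp : p ∈ W) (n : ℕ) :
    starHeight K h W n p = n * pl K h p + 1 := by rw [starHeight, if_pos hp]

theorem starHeight_of_notMem {p : E} (hp : p ∉ W) (n : ℕ) :
    starHeight K h W n p = n * pl K h p := by rw [starHeight, if_neg hp, add_zero]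

theorem starHeight_le (p : E) (n : ℕ) : starHeight K h W n p ≤ n * pl K h p + 1 := by
  rw [starHeight]
  split_ifs <;> linarith

/-- In a description by half-spaces, `t` is the smallest ratio `l(x)/l(w)` over the functionals
positive at `w`. There is one because the cone contains no line. -/
theorem State.exists_max_sub (S : T.State k K h) {A : Finset E} (hA : A ∈ K) {x w : E}
    (hx : x ∈ PointedCone.hull ℝ (A : Set E)) (hw : w ∈ PointedCone.hull ℝ (A : Set E))
    (hw0 : w ≠ 0) : ∃ t : ℝ, 0 ≤ t ∧ x - t • w ∈ PointedCone.hull ℝ (A : Set E) ∧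
      ∀ ε : ℝ, 0 < ε → x - t • w - ε • w ∉ PointedCone.hull ℝ (A : Set E) := by
  obtain ⟨H, -, hH⟩ := exists_halfspaces T.R T.H T.H_subset T.H_separating A
    fun l hl a ha => T.rational l hl a (S.lattice A hA a ha)
  have hne : (H.filter fun l => 0 < l w).Nonempty := by
    by_contra hemp
    rw [Finset.not_nonempty_iff_eq_empty, Finset.filter_eq_empty_iff] at hemp
    refine hw0 (T.salient w (T.hull_le (S.mem A hA) hw) (T.hull_le (S.mem A hA) ?_))
    rw [hH]
    intro l hl
    have := hemp hl
    rw [map_neg]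
    linarith
  obtain ⟨l, hl, hmin⟩ := Finset.exists_min_image _ (fun l => l x / l w) hne
  obtain ⟨hlH, hlw⟩ := Finset.mem_filter.1 hl
  have hx' := (hH x).1 hx
  have hw' := (hH w).1 hw
  refine ⟨l x / l w, div_nonneg (hx' l hlH) hlw.le, (hH _).2 fun l' hl' => ?_, fun ε hε hmem => ?_⟩
  · rw [map_sub, map_smul, smul_eq_mul, sub_nonneg]
    rcases (hw' l' hl').eq_or_lt with h0 | h0
    · rw [← h0, mul_zero]
      exact hx' l' hl'
    · have := hmin l' (Finset.mem_filter.2 ⟨hl', h0⟩)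
      rwa [le_div_iff₀ h0] at this
  · have := (hH _).1 hmem l hlH
    simp only [map_sub, map_smul, smul_eq_mul] at this
    rw [div_mul_cancel₀ _ hlw.ne'] at this
    have := mul_pos hε hlw
    linarith

/-- The vertices and the centers. -/
def points (K : Set (Finset E)) (W : Set E) : Set E := {p | (∃ A ∈ K, p ∈ A) ∨ p ∈ W}

theorem State.points_spec (S : T.State k K h) (hW : T.IsCenter K W) {p : E}
    (hp : p ∈ points K W) : p ∈ T.N ∧ p ∈ T.C ∧ p ≠ 0 := by
  rcases hp with ⟨A, hA, hp⟩ | hp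
  · exact ⟨S.lattice A hA p hp, S.mem A hA p hp, S.ne_zero A hA p hp⟩
  · exact ⟨hW.lattice p hp, hW.mem p hp, hW.ne_zero p hp⟩

/-- The piecewise linear function and `kψ` change by the same linear function under the group, so
their difference is invariant and takes finitely many values on the vertices and centers. -/
theorem State.exists_bound (S : T.State k K h) (hW : T.IsCenter K W) :
    ∃ M, ∀ p ∈ points K W, pl K h p - k * T.ψ p ≤ M := by
  obtain ⟨F, hF, hFK, HF⟩ := S.finite_orbits
  obtain ⟨F', hF', hFW, HF'⟩ := hW.finite_orbits
  have hfin : ((⋃ A ∈ F, (A : Set E)) ∪ F').Finite :=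
    (hF.biUnion fun A _ => A.finite_toSet).union hF'
  obtain ⟨M, hM⟩ := (hfin.image fun p => pl K h p - k * T.ψ p).bddAbove
  have hinv : ∀ g, ∀ p ∈ T.C, p ≠ 0 →
      pl K h (T.ρ g p) - k * T.ψ (T.ρ g p) = pl K h p - k * T.ψ p := by
    intro g p hp hp0
    rw [S.pl_map g hp, T.ψ_map g p hp hp0]
    ring
  refine ⟨M, ?_⟩
  rintro p (⟨A, hA, hp⟩ | hp)
  · obtain ⟨g, B, hB, rfl⟩ := HF A hA
    obtain ⟨q, hq, rfl⟩ := Finset.mem_image.1 hp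
    rw [hinv g q (S.mem B (hFK hB) q hq) (S.ne_zero B (hFK hB) q hq)]
    exact hM ⟨q, Or.inl (Set.mem_biUnion hB (Finset.mem_coe.2 hq)), rfl⟩
  · obtain ⟨g, q, hq, rfl⟩ := HF' p hp
    rw [hinv g q (hW.mem q (hFW hq)) (hW.ne_zero q (hFW hq))]
    exact hM ⟨q, Or.inr hq, rfl⟩

/-- A strict inequality at each of infinitely many points becomes a gap of more than `1`, with one
scale for all of them and in spite of the perturbation `l`. -/
theorem State.exists_scale (S : T.State k K h) (hW : T.IsCenter K W) {L l : E →ₗ[ℝ] ℝ}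
    (hL : T.Good k L) (hl : l ∈ T.R) :
    ∃ n₀ : ℕ, ∀ n, n₀ ≤ n → T.Good (n * k) ((n : ℝ) • L + l) ∧
      ∀ p ∈ points K W, pl K h p < L p → n * pl K h p + 1 < ((n : ℝ) • L + l) p := by
  obtain ⟨n₁, hn₁⟩ := hL.exists_smul_add hl
  obtain ⟨M, hM⟩ := S.exists_bound hW
  have hfin := (hn₁ n₁ le_rfl).finite_le (1 + n₁ * M)
  choose! m hm using fun p (hp : pl K h p < L p) => exists_nat_gt ((1 - l p) / (L p - pl K h p))
  refine ⟨n₁ + hfin.toFinset.sup m, fun n hn => ⟨hn₁ n (by omega), fun p hp hlt => ?_⟩⟩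
  obtain ⟨hpN, hpC, hp0⟩ := S.points_spec hW hp
  simp only [LinearMap.add_apply, LinearMap.smul_apply, smul_eq_mul]
  have hd : 0 < L p - pl K h p := sub_pos.2 hlt
  by_cases hpF : p ∈ hfin.toFinset
  · have h1 := hm p hlt
    rw [div_lt_iff₀ hd] at h1
    have h2 : (m p : ℝ) ≤ n := by
      have := Finset.le_sup (f := m) hpF
      exact_mod_cast (by omega : m p ≤ n)
    nlinarith
  -- Outside a finite set, properness already gives the gap at the scale `n₁`, because `pl - kψ` is
  -- bounded on the points; a larger `n` only increases it.
  · rw [hfin.mem_toFinset] at hpF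
    have h1 : 1 + n₁ * M < (n₁ * L p + l p) - n₁ * k * T.ψ p := by
      by_contra hcon
      refine hpF ⟨hpN, hpC, hp0, ?_⟩
      simpa using not_lt.1 hcon
    have h2 := mul_le_mul_of_nonneg_left (hM p hp) (Nat.cast_nonneg (α := ℝ) n₁)
    have h3 : (n₁ : ℝ) ≤ n := by exact_mod_cast (by omega : n₁ ≤ n)
    nlinarith

theorem starCells_subset_points {A : Finset E} (hA : A ∈ starCells K W) {p : E} (hp : p ∈ A) :
    p ∈ points K W := by
  rcases hA with ⟨hA, -⟩ | ⟨w, hw, B', hB', B, hB, hwB, hsub, hwB', rfl⟩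
  · exact Or.inl ⟨A, hA, hp⟩
  · rcases Finset.mem_insert.1 hp with rfl | hp
    · exact Or.inr hw
    · exact Or.inl ⟨B', hB', hp⟩

theorem subset_hull {A : Finset E} {p : E} (hp : p ∈ A) : p ∈ PointedCone.hull ℝ (A : Set E) :=
  Submodule.subset_span (Finset.mem_coe.2 hp)

theorem hull_mono {A B : Finset E} (h : A ⊆ B) {p : E}
    (hp : p ∈ PointedCone.hull ℝ (A : Set E)) : p ∈ PointedCone.hull ℝ (B : Set E) :=
  Submodule.span_mono (Finset.coe_subset.2 h) hp

/-- The cells of the stellar subdivision have support functions. -/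
theorem State.exists_supports_star (S : T.State k K h) (hW : T.IsCenter K W) {A : Finset E}
    (hA : A ∈ starCells K W) : ∃ n₀ : ℕ, ∀ n, n₀ ≤ n → ∃ L,
      T.Supports (n * k) (starCells K W) (starHeight K h W n) A L := by
  rcases hA with ⟨hA, hno⟩ | ⟨w, hw, B', hB', B, hB, hwB, hsub, hwB', rfl⟩
  · obtain ⟨L, hL⟩ := S.strict A hA
    obtain ⟨n₀, hn₀⟩ := S.exists_scale hW hL.1 (zero_mem _)
    refine ⟨n₀ + 1, fun n hn => ⟨(n : ℝ) • L + 0, (hn₀ n (by omega)).1, fun p hp => ?_,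
      fun B hB p hp hpA => ?_⟩⟩
    · have hpW : p ∉ W := fun hpW => hno p hpW (subset_hull hp)
      rw [starHeight_of_notMem hpW, S.pl_vertex hA hp, add_zero, LinearMap.smul_apply, smul_eq_mul,
        hL.2.1 p hp]
    · have hpQ := starCells_subset_points hB hp
      by_cases hlt : pl K h p < L p
      · exact (starHeight_le p n).trans_lt ((hn₀ n (by omega)).2 p hpQ hlt)
      · exfalso
        have hpC := (S.points_spec hW hpQ).2.1
        have heq := le_antisymm (S.pl_le hL hpC) (not_lt.1 hlt)
        have hph := (S.mem_hull_iff hA hL hpC).2 heq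
        rcases hpQ with ⟨B', hB', hpB'⟩ | hpW
        · exact hpA (S.mem_of_mem_hull hA hB' hpB' hph)
        · exact hno p hpW hph
  · obtain ⟨L, hL⟩ := S.strict B hB
    obtain ⟨L', hL'⟩ := S.strict B' hB'
    have hwC := hW.mem w hw
    have hLw := S.pl_eq_of_mem_hull hB hL hwB
    -- The support functional `nL` of the big cell is tilted by `(L' - L)/d`, which vanishes on
    -- `B'`, equals `1` at the center `w` and is positive at the other vertices of `B`. The number
    -- `d` is positive because `w` is not over `B'`, and rational because `w` is a lattice point.
    set d : ℝ := (L' - L) w with hd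
    have hd0 : 0 < d := by
      rw [hd, LinearMap.sub_apply, sub_pos, ← hLw]
      exact lt_of_le_of_ne (S.pl_le hL' hwC) fun h => hwB' ((S.mem_hull_iff hB' hL' hwC).2 h)
    have hlR : d⁻¹ • (L' - L) ∈ T.R := by
      obtain ⟨r, hr⟩ := T.rational _ (sub_mem hL'.1.1 hL.1.1) w (hW.lattice w hw)
      rw [hd, hr, ← Rat.cast_inv, Rat.cast_smul_eq_qsmul]
      exact T.R.smul_mem _ (sub_mem hL'.1.1 hL.1.1)
    obtain ⟨n₀, hn₀⟩ := S.exists_scale hW hL.1 hlR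
    have hval : ∀ (n : ℕ) (p : E), ((n : ℝ) • L + d⁻¹ • (L' - L)) p =
        n * L p + d⁻¹ * (L' p - L p) := fun n p => rfl
    refine ⟨n₀, fun n hn => ⟨(n : ℝ) • L + d⁻¹ • (L' - L), (hn₀ n hn).1, fun p hp => ?_,
      fun A hA p hp hpA => ?_⟩⟩
    · rcases Finset.mem_insert.1 hp with rfl | hp
      · rw [starHeight_of_mem hw, hval, hLw]
        congr 1
        exact inv_mul_cancel₀ hd0.ne'
      · have hpW : p ∉ W := fun hpW => hwB' (by
          rw [hW.unique B hB w hw p hpW hwB (subset_hull (hsub hp))]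
          exact subset_hull hp)
        rw [starHeight_of_notMem hpW, hval, S.pl_vertex hB' hp, hL.2.1 p (hsub hp), hL'.2.1 p hp]
        ring
    · have hpQ := starCells_subset_points hA hp
      by_cases hlt : pl K h p < L p
      · exact (starHeight_le p n).trans_lt ((hn₀ n hn).2 p hpQ hlt)
      · have hpC := (S.points_spec hW hpQ).2.1
        have heq := le_antisymm (S.pl_le hL hpC) (not_lt.1 hlt)
        have hph := (S.mem_hull_iff hB hL hpC).2 heq
        have hpW : p ∉ W := fun hpW =>
          hpA (by rw [hW.unique B hB p hpW w hw hph hwB]; exact Finset.mem_insert_self _ _)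
        obtain ⟨A', hA', hpA'⟩ := hpQ.resolve_right hpW
        have hpB' : p ∉ B' := fun h => hpA (Finset.mem_insert_of_mem h)
        have h1 := hL'.2.2 A' hA' p hpA' hpB'
        rw [← S.pl_vertex hA' hpA'] at h1
        rw [starHeight_of_notMem hpW, hval, ← heq]
        have := mul_pos (inv_pos.2 hd0) (sub_pos.2 h1)
        linarith

theorem State.star_stable (S : T.State k K h) (hW : T.IsCenter K W) (g : G) {A : Finset E}
    (hA : A ∈ starCells K W) : A.image (T.ρ g) ∈ starCells K W := by
  have hiff := fun (A : Finset E) (w : E) => State.map_mem_hull_iff (T := T) g (A := A) (w := w)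
  rcases hA with ⟨hA, hno⟩ | ⟨w, hw, B', hB', B, hB, hwB, hsub, hwB', rfl⟩
  · refine Or.inl ⟨S.stable g A hA, fun w hw hwA => ?_⟩
    rw [← T.map_map_inv g w, hiff] at hwA
    exact hno _ (hW.stable g⁻¹ w hw) hwA
  · refine Or.inr ⟨T.ρ g w, hW.stable g w hw, _, S.stable g B' hB', _, S.stable g B hB,
      (hiff _ _).2 hwB, Finset.image_subset_image hsub, fun h => hwB' ((hiff _ _).1 h), ?_⟩
    rw [Finset.image_insert]

theorem State.star_finite_orbits (S : T.State k K h) (hW : T.IsCenter K W) :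
    ∃ F : Set (Finset E), F.Finite ∧ F ⊆ starCells K W ∧
      ∀ A ∈ starCells K W, ∃ g, ∃ B ∈ F, A = B.image (T.ρ g) := by
  obtain ⟨F, hF, hFK, HF⟩ := S.finite_orbits
  have hfin : (F ∪ ⋃ B ∈ F, ⋃ w ∈ {w | w ∈ W ∧ w ∈ PointedCone.hull ℝ (B : Set E)},
      (insert w) '' (B.powerset : Set (Finset E))).Finite := by
    refine hF.union (hF.biUnion fun B hB => Set.Finite.biUnion (Set.Subsingleton.finite ?_)
      fun w _ => (Finset.finite_toSet _).image _)
    rintro w ⟨hw, hwB⟩ w' ⟨hw', hwB'⟩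
    exact hW.unique B (hFK hB) w hw w' hw' hwB hwB'
  refine ⟨starCells K W ∩ _, hfin.inter_of_right _, Set.inter_subset_left, fun A hA => ?_⟩
  have key : ∃ g, A.image (T.ρ g) ∈ F ∪ ⋃ B ∈ F,
      ⋃ w ∈ {w | w ∈ W ∧ w ∈ PointedCone.hull ℝ (B : Set E)},
      (insert w) '' (B.powerset : Set (Finset E)) := by
    rcases hA with ⟨hA, hno⟩ | ⟨w, hw, B', hB', B, hB, hwB, hsub, hwB', rfl⟩
    · obtain ⟨g, B, hB, rfl⟩ := HF A hA
      refine ⟨g⁻¹, Or.inl ?_⟩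
      rwa [image_inv_image]
    · obtain ⟨g, B₀, hB₀, rfl⟩ := HF B hB
      refine ⟨g⁻¹, Or.inr (Set.mem_biUnion hB₀ (Set.mem_biUnion
        (show T.ρ g⁻¹ w ∈ _ from ⟨hW.stable _ w hw, ?_⟩) ⟨B'.image (T.ρ g⁻¹), ?_, ?_⟩))⟩
      · rwa [← State.map_mem_hull_iff (T := T) g, T.map_map_inv]
      · rw [Finset.mem_coe, Finset.mem_powerset]
        have := Finset.image_subset_image (f := T.ρ g⁻¹) hsub
        rwa [image_inv_image] at this
      · rw [Finset.image_insert]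
  obtain ⟨g, hg⟩ := key
  exact ⟨g⁻¹, _, ⟨S.star_stable hW g hA, hg⟩, (image_inv_image g A).symm⟩

/-- Subtract from `x` the largest multiple of the center that stays in the cone of the cell. The
remainder is interior to a cell `B` contained in `A` whose cone misses the center, for otherwise
more could be subtracted. -/
theorem State.star_cover (S : T.State k K h) (hW : T.IsCenter K W) {x : E} (hx : x ∈ T.C) :
    ∃ A ∈ starCells K W, ∃ c : E → ℝ, (∀ p ∈ A, 0 < c p) ∧ x = ∑ p ∈ A, c p • p := by
  obtain ⟨A, hA, c, hc, hxc⟩ := S.cover x hx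
  by_cases hno : ∀ w ∈ W, w ∉ PointedCone.hull ℝ (A : Set E)
  · exact ⟨A, Or.inl ⟨hA, hno⟩, c, hc, hxc⟩
  push Not at hno
  obtain ⟨w, hw, hwA⟩ := hno
  have hcore := isCore_hull hc
  rw [← hxc] at hcore
  obtain ⟨t, ht, hmem, hmax⟩ := S.exists_max_sub hA hcore.1 hwA (hW.ne_zero w hw)
  -- `x` is a relative interior point, so a positive multiple of `w` can be subtracted; the
  -- coefficient at the new vertex is thus positive.
  have ht0 : 0 < t := by
    refine lt_of_le_of_ne ht fun h0 => ?_
    obtain ⟨ε, hε, h⟩ := hcore.2 w hwA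
    refine hmax ε hε ?_
    rw [← h0, zero_smul, sub_zero]
    exact h
  obtain ⟨B, hB, d, hd, hxd⟩ := S.cover _ (T.hull_le (S.mem A hA) hmem)
  have hBA : B ⊆ A := S.subset_of_mem_hull hA hB hd (hxd ▸ hmem)
  have hwB : w ∉ PointedCone.hull ℝ (B : Set E) := by
    intro hwB
    obtain ⟨ε, hε, h⟩ := (isCore_hull hd).2 w hwB
    rw [← hxd] at h
    exact hmax ε hε (hull_mono hBA h)
  have hwB' : w ∉ B := fun h => hwB (subset_hull h)
  refine ⟨insert w B, Or.inr ⟨w, hw, B, hB, A, hA, hwA, hBA, hwB, rfl⟩,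
    fun p => if p = w then t else d p, fun p hp => ?_, ?_⟩
  · simp only
    split_ifs with h
    · exact ht0
    · exact hd p ((Finset.mem_insert.1 hp).resolve_left h)
  · rw [Finset.sum_insert hwB']
    simp only [if_true]
    have : ∑ p ∈ B, (if p = w then t else d p) • p = x - t • w := by
      rw [hxd]
      refine Finset.sum_congr rfl fun p hp => ?_
      rw [if_neg fun h : p = w => hwB' (h ▸ hp)]
    rw [this, add_sub_cancel]

/-- The scale is chosen for representatives of the finitely many orbits of new cells; support
functionals for all other cells are obtained by translation. -/
theorem State.star (S : T.State k K h) (hW : T.IsCenter K W) :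
    ∃ n : ℕ, T.State (n * k) (starCells K W) (starHeight K h W n) := by
  obtain ⟨F, hF, hFK, HF⟩ := S.star_finite_orbits hW
  choose! m hm using fun A (hA : A ∈ starCells K W) => S.exists_supports_star hW hA
  set n := hF.toFinset.sup m + 1 with hn
  have hmem : ∀ A ∈ starCells K W, ∀ p ∈ A, p ∈ T.C ∧ p ≠ 0 := fun A hA p hp =>
    (S.points_spec hW (starCells_subset_points hA hp)).2
  have htw : ∀ A ∈ starCells K W, ∀ p ∈ A, ∀ g, starHeight K h W n (T.ρ g p) =
      starHeight K h W n p + (n * k : ℕ) * T.θ g p := by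
    intro A hA p hp g
    have h1 : T.ρ g p ∈ W ↔ p ∈ W := ⟨fun h => by
      have := hW.stable g⁻¹ _ h
      rwa [T.map_inv_map] at this, hW.stable g p⟩
    by_cases hpW : p ∈ W
    · rw [starHeight_of_mem hpW, starHeight_of_mem (h1.2 hpW), S.pl_map g (hmem A hA p hp).1]
      push_cast
      ring
    · rw [starHeight_of_notMem hpW, starHeight_of_notMem fun h => hpW (h1.1 h),
        S.pl_map g (hmem A hA p hp).1]
      push_cast
      ring
  refine ⟨n, Nat.mul_pos (Nat.succ_pos _) S.pos, fun A hA p hp =>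
    (S.points_spec hW (starCells_subset_points hA hp)).1, fun A hA p hp => (hmem A hA p hp).1,
    fun A hA p hp => (hmem A hA p hp).2, fun g A hA => S.star_stable hW g hA, ⟨F, hF, hFK, HF⟩,
    htw, fun w hw => S.star_cover hW hw, fun A hA => ?_⟩
  obtain ⟨g, B, hB, rfl⟩ := HF A hA
  obtain ⟨L, hL⟩ := hm B (hFK hB) n
    ((Finset.le_sup (f := m) (hF.mem_toFinset.2 hB)).trans (Nat.le_succ _))
  exact ⟨_, hL.translate (fun g A hA => S.star_stable hW g hA) hmem htw (hFK hB) g⟩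

/-- Each cell of the stellar subdivision lies in a cell of the original decomposition. -/
theorem exists_subset_of_mem_starCells {A : Finset E} (hA : A ∈ starCells K W) :
    ∃ B ∈ K, ∀ p ∈ A, p ∈ PointedCone.hull ℝ (B : Set E) := by
  rcases hA with ⟨hA, hno⟩ | ⟨w, hw, B', hB', B, hB, hwB, hsub, hwB', rfl⟩
  · exact ⟨A, hA, fun p hp => subset_hull hp⟩
  · refine ⟨B, hB, fun p hp => ?_⟩
    rcases Finset.mem_insert.1 hp with rfl | hp
    · exact hwB
    · exact subset_hull (hsub hp)

end Star

end TwistedCone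

/-! ### Barycentric subdivision -/

namespace TwistedCone

section Barycentric

variable {E G : Type*} [AddCommGroup E] [Module ℝ E] [Group G] [DecidableEq E]

/-- Each member of `K'` lies in the cone over some member of `K`. -/
def Finer (K K' : Set (Finset E)) : Prop :=
  ∀ A ∈ K', ∃ B ∈ K, ∀ p ∈ A, p ∈ PointedCone.hull ℝ (B : Set E)

theorem Finer.refl (K : Set (Finset E)) : Finer K K := fun A hA => ⟨A, hA, fun _ => subset_hull⟩

theorem Finer.trans {K K' K'' : Set (Finset E)} (h : Finer K K') (h' : Finer K' K'') :
    Finer K K'' := by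
  intro A hA
  obtain ⟨B, hB, hAB⟩ := h' A hA
  obtain ⟨B', hB', hBB'⟩ := h B hB
  exact ⟨B', hB', fun p hp => Submodule.span_le.2 hBB' (hAB p hp)⟩

theorem finer_starCells (K : Set (Finset E)) (W : Set E) : Finer K (starCells K W) :=
  fun _ hA => exists_subset_of_mem_starCells hA

variable {T : TwistedCone E G} {k : ℕ} {K : Set (Finset E)} {h : E → ℝ} {O : Set E} {d : ℕ}

theorem sum_ne_zero {A : Finset E} (hA : A.Nonempty) (hAC : ∀ p ∈ A, p ∈ T.C ∧ p ≠ 0)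
    {c : E → ℝ} (hc : ∀ p ∈ A, 0 < c p) : ∑ p ∈ A, c p • p ≠ 0 := by
  obtain ⟨q, hq⟩ := hA
  intro h0
  have h1 : ∀ p ∈ A, c p • p ∈ T.C := fun p hp =>
    PointedCone.smul_mem _ (hc p hp).le (hAC p hp).1
  rw [← Finset.add_sum_erase A _ hq] at h0
  have h2 : ∑ p ∈ A.erase q, c p • p ∈ T.C :=
    sum_mem fun p hp => h1 p (Finset.mem_of_mem_erase hp)
  have h3 := T.salient _ (h1 q hq) (by rwa [neg_eq_of_add_eq_zero_right h0])
  exact (hAC q hq).2 ((smul_eq_zero.1 h3).resolve_left (hc q hq).ne')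

theorem State.mem_ne (S : T.State k K h) {A : Finset E} (hA : A ∈ K) : ∀ p ∈ A, p ∈ T.C ∧ p ≠ 0 :=
  fun p hp => ⟨S.mem A hA p hp, S.ne_zero A hA p hp⟩

theorem mem_of_subset (herase : ∀ B ∈ K, ∀ p ∈ B, p ∉ O → B.erase p ∈ K) {B B' : Finset E}
    (hB : B ∈ K) (hsub : B' ⊆ B) (hO : ∀ p ∈ B, p ∉ B' → p ∉ O) : B' ∈ K := by
  induction hn : (B \ B').card generalizing B with
  | zero =>
    rw [Finset.card_eq_zero, Finset.sdiff_eq_empty_iff_subset] at hn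
    rwa [subset_antisymm hsub hn]
  | succ n ih =>
    obtain ⟨p, hp⟩ : (B \ B').Nonempty := by
      rw [← Finset.card_pos]; omega
    obtain ⟨hpB, hpB'⟩ := Finset.mem_sdiff.1 hp
    refine ih (herase B hB p hpB (hO p hpB hpB')) (fun x hx => Finset.mem_erase.2 ⟨?_, hsub hx⟩)
      (fun q hq hq' => hO q (Finset.mem_of_mem_erase hq) hq') ?_
    · rintro rfl
      exact hpB' hx
    · rw [Finset.erase_sdiff_comm, Finset.card_erase_of_mem hp]
      omega

/-- All cells are simplices, except for the vertices in `O`: subsets are cells if they contain all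
vertices in `O`, and vertices outside `O` are not moved inside a cell. The cells with vertices in
`O` have rank at most `d`. -/
structure Inv (T : TwistedCone E G) (K : Set (Finset E)) (O : Set E) (d : ℕ) : Prop where
  stable : ∀ g, ∀ p ∈ O, T.ρ g p ∈ O
  erase : ∀ B ∈ K, ∀ p ∈ B, p ∉ O → B.erase p ∈ K
  fixed : ∀ B ∈ K, ∀ p ∈ B, p ∉ O → ∀ g, T.ρ g p ∈ B → T.ρ g p = p
  rank : ∀ B ∈ K, (B : Set E) ⊆ O → Module.finrank ℝ (Submodule.span ℝ (B : Set E)) ≤ d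

/-- The barycenters of the cells of rank `d` with vertices in `O`. -/
def barycenters (K : Set (Finset E)) (O : Set E) (d : ℕ) : Set E :=
  {w | ∃ B ∈ K, (B : Set E) ⊆ O ∧ Module.finrank ℝ (Submodule.span ℝ (B : Set E)) = d ∧
    w = ∑ p ∈ B, p}

theorem finrank_span_image (g : G) (B : Finset E) :
    Module.finrank ℝ (Submodule.span ℝ ((B.image (T.ρ g) : Finset E) : Set E)) =
      Module.finrank ℝ (Submodule.span ℝ (B : Set E)) := by
  rw [Finset.coe_image, ← Submodule.map_span]
  exact (Submodule.equivMapOfInjective _ (T.map_injective g) _).finrank_eq.symm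

theorem sum_one_smul (B : Finset E) : ∑ p ∈ B, p = ∑ p ∈ B, (fun _ => (1 : ℝ)) p • p := by
  simp

/-- If the barycenter of `B₁` lies in the cone over `B`, then `B₁` is contained in `B ∩ O`, and both
have the same span since `d + 1` is the largest rank. The two support functionals agree on that
span, so strictness leaves no room for another vertex: `B₁` is all of `B ∩ O`, and the barycenter is
unique. -/
theorem State.isCenter_barycenters [FiniteDimensional ℝ E] (S : T.State k K h)
    (I : T.Inv K O (d + 1)) : T.IsCenter K (barycenters K O (d + 1)) := by
  classical
  have himage : ∀ g, ∀ B ∈ K, (B : Set E) ⊆ O → ((B.image (T.ρ g) : Finset E) : Set E) ⊆ O := by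
    intro g B _ hBO x hx
    obtain ⟨p, hp, rfl⟩ := Finset.mem_image.1 (Finset.mem_coe.1 hx)
    exact I.stable g p (hBO (Finset.mem_coe.2 hp))
  have hsum : ∀ (g : G) (B : Finset E), T.ρ g (∑ p ∈ B, p) = ∑ p ∈ B.image (T.ρ g), p := by
    intro g B
    rw [map_sum, Finset.sum_image fun x _ y _ hxy => T.map_injective g hxy]
  refine ⟨?_, ?_, ?_, ?_, ?_, ?_⟩
  · rintro _ ⟨B, hB, -, -, rfl⟩
    exact sum_mem fun p hp => S.lattice B hB p hp
  · rintro _ ⟨B, hB, -, -, rfl⟩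
    exact sum_mem fun p hp => S.mem B hB p hp
  · rintro _ ⟨B, hB, -, hr, rfl⟩
    rw [sum_one_smul]
    refine sum_ne_zero (T := T) ?_ (S.mem_ne hB) fun _ _ => one_pos
    rw [Finset.nonempty_iff_ne_empty]
    rintro rfl
    rw [Finset.coe_empty, Submodule.span_empty, finrank_bot] at hr
    omega
  · rintro g _ ⟨B, hB, hBO, hr, rfl⟩
    exact ⟨_, S.stable g B hB, himage g B hB hBO, by rw [finrank_span_image, hr], hsum g B⟩
  · obtain ⟨F, hF, hFK, HF⟩ := S.finite_orbits
    refine ⟨(fun B => ∑ p ∈ B, p) '' {B | B ∈ F ∧ (B : Set E) ⊆ O ∧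
      Module.finrank ℝ (Submodule.span ℝ (B : Set E)) = d + 1},
      (hF.subset fun B hB => hB.1).image _, ?_, ?_⟩
    · rintro _ ⟨B, ⟨hB, hBO, hr⟩, rfl⟩
      exact ⟨B, hFK hB, hBO, hr, rfl⟩
    · rintro _ ⟨B, hB, hBO, hr, rfl⟩
      obtain ⟨g, B₀, hB₀, rfl⟩ := HF B hB
      refine ⟨g, _, ⟨B₀, ⟨hB₀, ?_, ?_⟩, rfl⟩, (hsum g B₀).symm⟩
      · have := himage g⁻¹ _ hB hBO
        rwa [State.image_inv_image] at this
      · rwa [finrank_span_image] at hr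
  · have key : ∀ B ∈ K, ∀ B₁ ∈ K, (B₁ : Set E) ⊆ O →
        Module.finrank ℝ (Submodule.span ℝ (B₁ : Set E)) = d + 1 →
        ∑ p ∈ B₁, p ∈ PointedCone.hull ℝ (B : Set E) → B₁ = B.filter (· ∈ O) := by
      intro B hB B₁ hB₁ hO hr hmem
      rw [sum_one_smul] at hmem
      have hsub : B₁ ⊆ B := S.subset_of_mem_hull hB hB₁ (fun _ _ => one_pos) hmem
      set B₀ := B.filter (· ∈ O) with hB₀
      have hB₀K : B₀ ∈ K := mem_of_subset I.erase hB (Finset.filter_subset _ _)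
        fun p hp hp' hpO => hp' (Finset.mem_filter.2 ⟨hp, hpO⟩)
      have hsub₀ : B₁ ⊆ B₀ := fun p hp =>
        Finset.mem_filter.2 ⟨hsub hp, hO (Finset.mem_coe.2 hp)⟩
      have hr₀ := I.rank B₀ hB₀K fun p hp => (Finset.mem_filter.1 (Finset.mem_coe.1 hp)).2
      have hspan := Submodule.eq_of_le_of_finrank_le
        (Submodule.span_mono (R := ℝ) (Finset.coe_subset.2 hsub₀)) (by rw [hr]; exact hr₀)
      refine subset_antisymm hsub₀ fun p hp => ?_
      by_contra hpB₁
      obtain ⟨L, hL⟩ := S.strict B₀ hB₀K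
      obtain ⟨L₁, hL₁⟩ := S.strict B₁ hB₁
      have h1 : p ∈ Submodule.span ℝ (B₁ : Set E) := by
        rw [hspan]
        exact Submodule.subset_span (Finset.mem_coe.2 hp)
      have h2 : Submodule.span ℝ (B₁ : Set E) ≤ LinearMap.ker (L₁ - L) := by
        refine Submodule.span_le.2 fun q hq => ?_
        have hq := Finset.mem_coe.1 hq
        simp only [SetLike.mem_coe, LinearMap.mem_ker, LinearMap.sub_apply]
        rw [hL₁.2.1 q hq, hL.2.1 q (hsub₀ hq), sub_self]
      have h3 := h2 h1
      rw [LinearMap.mem_ker, LinearMap.sub_apply, hL.2.1 p hp] at h3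
      have := hL₁.2.2 B₀ hB₀K p hp hpB₁
      linarith
    rintro B hB _ ⟨B₁, hB₁, hO₁, hr₁, rfl⟩ _ ⟨B₂, hB₂, hO₂, hr₂, rfl⟩ hm₁ hm₂
    rw [key B hB B₁ hB₁ hO₁ hr₁ hm₁, key B hB B₂ hB₂ hO₂ hr₂ hm₂]

/-- Conditions on the vertices of a decomposition are passed on to its stellar subdivisions. -/
theorem IsCenter.star_erase {W : Set E} (hW : T.IsCenter K W)
    (herase : ∀ B ∈ K, ∀ p ∈ B, p ∉ O → B.erase p ∈ K) :
    ∀ A ∈ starCells K W, ∀ p ∈ A, p ∉ O \ W → A.erase p ∈ starCells K W := by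
  rintro A (⟨hA, hno⟩ | ⟨w, hw, B', hB', B, hB, hwB, hsub, hwB', rfl⟩) p hp hpO
  · have hpW : p ∉ W := fun h => hno p h (subset_hull hp)
    exact Or.inl ⟨herase A hA p hp fun h => hpO ⟨h, hpW⟩, fun w hw hwA =>
      hno w hw (hull_mono (Finset.erase_subset _ _) hwA)⟩
  · have hno : ∀ v ∈ W, v ∉ PointedCone.hull ℝ (B' : Set E) := fun v hv hvB' =>
      hwB' (by rwa [hW.unique B hB w hw v hv hwB (hull_mono hsub hvB')])
    have hwB'' : w ∉ B' := fun h => hwB' (subset_hull h)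
    rcases Finset.mem_insert.1 hp with rfl | hp
    · rw [Finset.erase_insert hwB'']
      exact Or.inl ⟨hB', hno⟩
    · have hpW : p ∉ W := fun h => hno p h (subset_hull hp)
      have hne : w ≠ p := fun h => hwB'' (h ▸ hp)
      rw [Finset.erase_insert_of_ne hne]
      exact Or.inr ⟨w, hw, _, herase B' hB' p hp fun h => hpO ⟨h, hpW⟩, B, hB, hwB,
        (Finset.erase_subset _ _).trans hsub,
        fun h => hwB' (hull_mono (Finset.erase_subset _ _) h), rfl⟩

/-- A new cell has at most one center among its vertices and `W` is stable, so the group cannot move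
a center to another vertex of the cell, nor an old vertex to the center. -/
theorem IsCenter.star_fixed {W : Set E} (hW : T.IsCenter K W)
    (hfixed : ∀ B ∈ K, ∀ p ∈ B, p ∉ O → ∀ g, T.ρ g p ∈ B → T.ρ g p = p) :
    ∀ A ∈ starCells K W, ∀ p ∈ A, p ∉ O \ W → ∀ g, T.ρ g p ∈ A → T.ρ g p = p := by
  rintro A (⟨hA, hno⟩ | ⟨w, hw, B', hB', B, hB, hwB, hsub, hwB', rfl⟩) p hp hpO g hgp
  · have hpW : p ∉ W := fun h => hno p h (subset_hull hp)
    exact hfixed A hA p hp (fun h => hpO ⟨h, hpW⟩) g hgp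
  · have hno : ∀ v ∈ W, v ∉ B' := fun v hv hvB' =>
      hwB' (by rw [hW.unique B hB w hw v hv hwB (subset_hull (hsub hvB'))]; exact subset_hull hvB')
    rcases Finset.mem_insert.1 hp with rfl | hp
    · exact (Finset.mem_insert.1 hgp).resolve_right (hno _ (hW.stable g p hw))
    · have hpW : p ∉ W := fun h => hno p h hp
      rcases Finset.mem_insert.1 hgp with h | h
      · refine absurd ?_ hpW
        have := hW.stable g⁻¹ w hw
        rwa [← h, T.map_inv_map] at this
      · exact hfixed B' hB' p hp (fun h => hpO ⟨h, hpW⟩) g h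

/-- A cell with vertices in `O` of rank `d + 1` contains its own barycenter, so it does not survive;
the centers, which are vertices of the new cells, are removed from `O`. -/
theorem State.inv_star [FiniteDimensional ℝ E] (S : T.State k K h) (I : T.Inv K O (d + 1)) :
    T.Inv (starCells K (barycenters K O (d + 1))) (O \ barycenters K O (d + 1)) d := by
  have hW := S.isCenter_barycenters I
  refine ⟨fun g p hp => ⟨I.stable g p hp.1, fun h => hp.2 ?_⟩, hW.star_erase I.erase,
    hW.star_fixed I.fixed, ?_⟩
  · have := hW.stable g⁻¹ _ h
    rwa [T.map_inv_map] at this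
  · rintro A (⟨hA, hno⟩ | ⟨w, hw, B', hB', B, hB, hwB, hsub, hwB', rfl⟩) hAO
    · have h1 : (A : Set E) ⊆ O := fun p hp => (hAO hp).1
      have h2 := I.rank A hA h1
      by_contra h3
      refine hno _ ⟨A, hA, h1, by omega, rfl⟩ ?_
      rw [sum_one_smul]
      exact sum_smul_mem_hull fun _ _ => zero_le_one
    · exact absurd hw (hAO (Finset.mem_coe.2 (Finset.mem_insert_self _ _))).2

/-- All subsets of cells are cells, and the group does not identify vertices of a cell. -/
structure Simplicial (T : TwistedCone E G) (K : Set (Finset E)) : Prop where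
  erase : ∀ B ∈ K, ∀ p ∈ B, B.erase p ∈ K
  fixed : ∀ B ∈ K, ∀ p ∈ B, ∀ g, T.ρ g p ∈ B → T.ρ g p = p

theorem Simplicial.mem_of_subset (hK : T.Simplicial K) {B B' : Finset E} (hB : B ∈ K)
    (hsub : B' ⊆ B) : B' ∈ K :=
  TwistedCone.mem_of_subset (O := ∅) (fun B hB p hp _ => hK.erase B hB p hp) hB hsub
    fun _ _ _ => id

theorem Simplicial.star (hK : T.Simplicial K) {W : Set E} (hW : T.IsCenter K W) :
    T.Simplicial (starCells K W) where
  erase := fun A hA p hp => hW.star_erase (O := ∅) (fun B hB p hp _ => hK.erase B hB p hp) A hA p hp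
    fun h => h.1
  fixed := fun A hA p hp => hW.star_fixed (O := ∅) (fun B hB p hp _ => hK.fixed B hB p hp) A hA p hp
    fun h => h.1

/-- Barycentric subdivision from the largest rank downwards. At rank `0` no vertex is left in `O`,
and the conditions on vertices outside `O` say that the decomposition is simplicial. -/
theorem State.exists_simplicial_of_inv [FiniteDimensional ℝ E] (S : T.State k K h)
    (I : T.Inv K O d) : ∃ k' K' h', T.State k' K' h' ∧ Finer K K' ∧ T.Simplicial K' := by
  classical
  induction d generalizing k K h O with
  | zero =>
    have hO : ∀ B ∈ K, ∀ p ∈ B, p ∉ O := by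
      intro B hB p hp hpO
      have hB₀ : B.filter (· ∈ O) ∈ K := TwistedCone.mem_of_subset I.erase hB
        (Finset.filter_subset _ _) fun p hp hp' hpO => hp' (Finset.mem_filter.2 ⟨hp, hpO⟩)
      have h1 := I.rank _ hB₀ fun p hp => (Finset.mem_filter.1 (Finset.mem_coe.1 hp)).2
      rw [Nat.le_zero, Submodule.finrank_eq_zero, Submodule.span_eq_bot] at h1
      have h2 := Finset.mem_filter.2 ⟨hp, hpO⟩
      exact S.ne_zero _ hB₀ p h2 (h1 p (Finset.mem_coe.2 h2))
    exact ⟨k, K, h, S, Finer.refl K, fun B hB p hp => I.erase B hB p hp (hO B hB p hp),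
      fun B hB p hp => I.fixed B hB p hp (hO B hB p hp)⟩
  | succ d ih =>
    obtain ⟨n, S'⟩ := S.star (S.isCenter_barycenters I)
    obtain ⟨k', K', h', S'', hf, hs⟩ := ih S' (S.inv_star I)
    exact ⟨k', K', h', S'', (finer_starCells _ _).trans hf, hs⟩

/-- Every decomposition has a simplicial subdivision. -/
theorem State.exists_simplicial [FiniteDimensional ℝ E] (S : T.State k K h) :
    ∃ k' K' h', T.State k' K' h' ∧ Finer K K' ∧ T.Simplicial K' :=
  S.exists_simplicial_of_inv (O := Set.univ) (d := Module.finrank ℝ E)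
    ⟨fun _ _ _ => trivial, fun _ _ _ _ h => absurd trivial h, fun _ _ _ _ h => absurd trivial h,
      fun _ _ _ => Submodule.finrank_le _⟩

end Barycentric

end TwistedCone

/-! ### Multiplicities and unimodular subdivisions -/

namespace TwistedCone

section Multiplicity

variable {E G : Type*} [AddCommGroup E] [Module ℝ E] [Group G] [DecidableEq E]

variable {T : TwistedCone E G} {k : ℕ} {K : Set (Finset E)} {h : E → ℝ}

/-- The vertices of a simplicial cell are linearly independent. -/
theorem State.eq_of_sum_eq (S : T.State k K h) (hK : T.Simplicial K) {B : Finset E} (hB : B ∈ K)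
    {c d : E → ℝ} (hcd : ∑ p ∈ B, c p • p = ∑ p ∈ B, d p • p) {p : E} (hp : p ∈ B) :
    c p = d p := by
  classical
  set e : E → ℝ := fun p => c p - d p with he
  set P := B.filter fun p => 0 < e p with hP
  set Q := B.filter fun p => e p < 0 with hQ
  have hsum : ∑ p ∈ B, e p • p = 0 := by
    simp only [he, sub_smul, Finset.sum_sub_distrib, hcd, sub_self]
  have hzero : ∑ p ∈ B.filter (fun p => e p = 0), e p • p = 0 :=
    Finset.sum_eq_zero fun p hp => by rw [(Finset.mem_filter.1 hp).2, zero_smul]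
  rw [sum_eq_sum_pos_add_sum_neg_add_sum_zero B e, hzero, add_zero] at hsum
  have heq : ∑ p ∈ P, e p • p = ∑ p ∈ Q, (-e p) • p := by
    simp only [neg_smul, Finset.sum_neg_distrib]
    exact eq_neg_of_add_eq_zero_left hsum
  have hPpos : ∀ p ∈ P, 0 < e p := fun p hp => (Finset.mem_filter.1 hp).2
  have hQpos : ∀ p ∈ Q, 0 < -e p := fun p hp => neg_pos.2 (Finset.mem_filter.1 hp).2
  have hPK := hK.mem_of_subset hB (Finset.filter_subset _ _ : P ⊆ B)
  have hQK := hK.mem_of_subset hB (Finset.filter_subset _ _ : Q ⊆ B)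
  -- The positive and negative parts of a relation are cells with a common relative interior point,
  -- so they coincide; being disjoint, they are empty.
  have h1 : P ⊆ Q := S.subset_of_mem_hull hQK hPK hPpos (by
    rw [heq]; exact sum_smul_mem_hull fun p hp => (hQpos p hp).le)
  have h2 : Q ⊆ P := S.subset_of_mem_hull hPK hQK hQpos (by
    rw [← heq]; exact sum_smul_mem_hull fun p hp => (hPpos p hp).le)
  rcases lt_trichotomy (e p) 0 with hlt | h0 | hlt
  · have := hPpos p (h2 (Finset.mem_filter.2 ⟨hp, hlt⟩))
    exact absurd hlt this.le.not_gt
  · exact sub_eq_zero.1 h0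
  · have := hQpos p (h1 (Finset.mem_filter.2 ⟨hp, hlt⟩))
    exact absurd hlt (neg_pos.1 this).le.not_gt

/-- The half-open parallelepiped spanned by a finite set of vectors. -/
def box (B : Finset E) : Set E :=
  {x | ∃ c : E → ℝ, (∀ p ∈ B, 0 ≤ c p ∧ c p < 1) ∧ x = ∑ p ∈ B, c p • p}

/-- The number of lattice points in the half-open parallelepiped. -/
def mult (T : TwistedCone E G) (B : Finset E) : ℕ := Set.ncard {x | x ∈ T.N ∧ x ∈ box B}

theorem finite_box (T : TwistedCone E G) (B : Finset E) : {x | x ∈ T.N ∧ x ∈ box B}.Finite := by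
  refine (T.finite_abs_le fun l => ∑ p ∈ B, |l p|).subset ?_
  rintro _ ⟨hN, c, hc, rfl⟩
  refine ⟨hN, fun l _ => ?_⟩
  rw [State.apply_sum]
  refine (Finset.abs_sum_le_sum_abs _ _).trans (Finset.sum_le_sum fun p hp => ?_)
  rw [abs_mul, abs_of_nonneg (hc p hp).1]
  exact mul_le_of_le_one_left (abs_nonneg _) (hc p hp).2.le

theorem mult_image_le (g : G) (B : Finset E) : T.mult (B.image (T.ρ g)) ≤ T.mult B := by
  refine le_trans (Set.ncard_le_ncard ?_ ((T.finite_box B).image _))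
    (Set.ncard_image_le (f := T.ρ g) (T.finite_box B))
  rintro _ ⟨hN, c, hc, rfl⟩
  have h1 : ∑ p ∈ B.image (T.ρ g), c p • p = T.ρ g (∑ p ∈ B, c (T.ρ g p) • p) := by
    rw [State.sum_image]
    exact Finset.sum_congr rfl fun p _ => by simp only [T.map_map_inv]
  refine ⟨_, ⟨?_, _, fun p hp => hc _ (Finset.mem_image_of_mem _ hp), rfl⟩, h1.symm⟩
  rw [h1] at hN
  have := T.map_lattice g⁻¹ _ hN
  rwa [T.map_inv_map] at this

theorem zero_mem_box (B : Finset E) : (0 : E) ∈ box B :=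
  ⟨0, fun _ _ => ⟨le_rfl, zero_lt_one⟩, by simp⟩

theorem eq_zero_of_mult_le_one {B : Finset E} (hB : T.mult B ≤ 1) {x : E} (hx : x ∈ T.N)
    (hxB : x ∈ box B) : x = 0 :=
  (Set.ncard_le_one_iff (T.finite_box B)).1 hB ⟨hx, hxB⟩ ⟨zero_mem _, zero_mem_box B⟩

theorem State.exists_mult_le (S : T.State k K h) : ∃ m, ∀ B ∈ K, T.mult B ≤ m := by
  obtain ⟨F, hF, hFK, HF⟩ := S.finite_orbits
  refine ⟨hF.toFinset.sup T.mult, fun B hB => ?_⟩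
  obtain ⟨g, A, hA, rfl⟩ := HF B hB
  exact (mult_image_le g A).trans (Finset.le_sup (hF.mem_toFinset.2 hA))

/-- Replacing vertices of a simplicial cell by a lattice point in the half-open parallelepiped makes
the multiplicity smaller. -/
theorem State.mult_insert_lt (S : T.State k K h) (hK : T.Simplicial K) {B B' A : Finset E}
    (hB : B ∈ K) (hB' : B' ⊆ B) (hA : A ⊆ B) {w : E} (hw : w ∈ T.N) {c : E → ℝ}
    (hc : ∀ p ∈ A, 0 < c p ∧ c p < 1) (hwc : w = ∑ p ∈ A, c p • p)
    (hwB' : w ∉ PointedCone.hull ℝ (B' : Set E)) : T.mult (insert w B') < T.mult B := by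
  classical
  obtain ⟨q, hqA, hqB'⟩ : ∃ q ∈ A, q ∉ B' := by
    by_contra! hcon
    refine hwB' (hwc ▸ hull_mono hcon (sum_smul_mem_hull fun p hp => (hc p hp).1.le))
  have hwB'' : w ∉ B' := fun h => hwB' (subset_hull h)
  have hext : ∀ (A : Finset E), A ⊆ B → ∀ c : E → ℝ,
      ∑ p ∈ A, c p • p = ∑ p ∈ B, (if p ∈ A then c p else 0) • p := by
    intro A hA c
    simp only [ite_smul, zero_smul]
    rw [Finset.sum_ite_mem, Finset.inter_eq_right.2 hA]
  have hcoord : ∀ x : E, ∃ t : ℝ, ∃ d : E → ℝ, x ∈ box (insert w B') →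
      0 ≤ t ∧ t < 1 ∧ (∀ p ∈ B', 0 ≤ d p ∧ d p < 1) ∧ x = t • w + ∑ p ∈ B', d p • p := by
    intro x
    by_cases hx : x ∈ box (insert w B')
    · obtain ⟨e, he, rfl⟩ := hx
      refine ⟨e w, e, fun _ => ⟨(he w (Finset.mem_insert_self _ _)).1,
        (he w (Finset.mem_insert_self _ _)).2, fun p hp => he p (Finset.mem_insert_of_mem hp), ?_⟩⟩
      rw [Finset.sum_insert hwB'']
    · exact ⟨0, 0, fun h => absurd h hx⟩
  choose t d htd using hcoord
  -- These are the coordinates of a point of the new box with respect to `B`. Reducing them modulo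
  -- `1` maps lattice points of the new box to lattice points of the old one; this map is injective
  -- and misses `w`.
  let e : E → E → ℝ := fun x p => t x * (if p ∈ A then c p else 0) + if p ∈ B' then d x p else 0
  have he : ∀ x ∈ box (insert w B'), x = ∑ p ∈ B, e x p • p := by
    intro x hx
    conv_lhs => rw [(htd x hx).2.2.2, hwc, hext A hA, hext B' hB', Finset.smul_sum,
      ← Finset.sum_add_distrib]
    exact Finset.sum_congr rfl fun p _ => by rw [smul_smul, ← add_smul]
  have heq : ∀ x, e x q = t x * c q := fun x => by simp only [e, if_pos hqA, if_neg hqB', add_zero]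
  have hfrq : ∀ x ∈ box (insert w B'), Int.fract (e x q) = t x * c q := by
    intro x hx
    rw [heq, Int.fract_eq_self]
    have h1 := htd x hx
    have h2 := hc q hqA
    exact ⟨mul_nonneg h1.1 h2.1.le, by nlinarith⟩
  let Φ : E → E := fun x => ∑ p ∈ B, Int.fract (e x p) • p
  have hΦ : ∀ x ∈ box (insert w B'), Φ x = x - ∑ p ∈ B, ⌊e x p⌋ • p := by
    intro x hx
    rw [eq_sub_iff_add_eq, ← Finset.sum_add_distrib]
    conv_rhs => rw [he x hx]
    refine Finset.sum_congr rfl fun p _ => ?_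
    rw [← Int.self_sub_floor, sub_smul, Int.cast_smul_eq_zsmul, sub_add_cancel]
  have hmaps : Φ '' {x | x ∈ T.N ∧ x ∈ box (insert w B')} ⊆ {x | x ∈ T.N ∧ x ∈ box B} := by
    rintro _ ⟨x, ⟨hxN, hx⟩, rfl⟩
    refine ⟨?_, _, fun p _ => ⟨Int.fract_nonneg _, Int.fract_lt_one _⟩, rfl⟩
    rw [hΦ x hx]
    exact sub_mem hxN (sum_mem fun p hp => zsmul_mem (S.lattice B hB p hp) _)
  -- The coordinate at `q`, a vertex of `A` outside `B'`, equals `t c(q) < 1` and is not changed by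
  -- reduction, so it determines `t`. The other coordinates are then determined modulo `1` within
  -- `[0,1)`.
  have hinj : Set.InjOn Φ {x | x ∈ T.N ∧ x ∈ box (insert w B')} := by
    rintro x ⟨_, hx⟩ y ⟨_, hy⟩ hxy
    have h1 : ∀ p ∈ B, Int.fract (e x p) = Int.fract (e y p) :=
      fun p hp => S.eq_of_sum_eq hK hB hxy hp
    have h2 : t x = t y := by
      have := h1 q (hA hqA)
      rw [hfrq x hx, hfrq y hy] at this
      exact mul_right_cancel₀ (hc q hqA).1.ne' this
    obtain ⟨-, -, hdx, hex⟩ := htd x hx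
    obtain ⟨-, -, hdy, hey⟩ := htd y hy
    have h3 : ∀ p ∈ B', d x p = d y p := by
      intro p hp
      obtain ⟨z, hz⟩ := Int.fract_eq_fract.1 (h1 p (hB' hp))
      simp only [e, h2, if_pos hp, add_sub_add_left_eq_sub] at hz
      have h4 : |(z : ℝ)| < 1 := by
        rw [← hz, abs_lt]
        exact ⟨by linarith [(hdx p hp).1, (hdy p hp).2], by linarith [(hdx p hp).2, (hdy p hp).1]⟩
      have h5 : z = 0 := by
        rw [← Int.abs_lt_one_iff]
        exact_mod_cast h4
      rw [h5, Int.cast_zero] at hz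
      linarith
    rw [hex, hey, h2]
    congr 1
    exact Finset.sum_congr rfl fun p hp => by rw [h3 p hp]
  have hwbox : w ∈ box B := by
    refine ⟨_, fun p _ => ?_, hwc.trans (hext A hA c)⟩
    split_ifs with hpA
    · exact ⟨(hc p hpA).1.le, (hc p hpA).2⟩
    · exact ⟨le_rfl, zero_lt_one⟩
  rw [mult, mult, ← hinj.ncard_image]
  refine Set.ncard_lt_ncard (Set.ssubset_iff_of_subset hmaps |>.2 ⟨w, ⟨hw, hwbox⟩, ?_⟩)
    (T.finite_box B)
  -- To hit `w` the coordinate at `q` would have to be `c(q)`, that is `t = 1`, which the half-open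
  -- box excludes.
  rintro ⟨x, ⟨_, hx⟩, hxw⟩
  have h1 : Int.fract (e x q) = c q := by
    have h2 : Φ x = ∑ p ∈ B, (if p ∈ A then c p else 0) • p := by
      rw [hxw, hwc, hext A hA]
    have := S.eq_of_sum_eq hK hB h2 (hA hqA)
    rwa [if_pos hqA] at this
  rw [hfrq x hx] at h1
  have h2 := (htd x hx).2.1
  have h3 := (hc q hqA).1
  nlinarith

/-- If two translates of `w` lie over one cell, the corresponding translates of `A` are subsets of
that cell. The element relating them moves vertices within the cell, hence fixes them, and the two
translates of `w` agree. -/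
theorem State.isCenter_orbit (S : T.State k K h) (hK : T.Simplicial K) {A : Finset E} (hA : A ∈ K)
    (hne : A.Nonempty) {w : E} (hw : w ∈ T.N) {c : E → ℝ} (hc : ∀ p ∈ A, 0 < c p)
    (hwc : w = ∑ p ∈ A, c p • p) : T.IsCenter K (Set.range fun g => T.ρ g w) := by
  have hwC : w ∈ T.C := by
    rw [hwc]
    exact T.hull_le (S.mem A hA) (sum_smul_mem_hull fun p hp => (hc p hp).le)
  have hw0 : w ≠ 0 := by
    rw [hwc]
    exact sum_ne_zero (T := T) hne (S.mem_ne hA) hc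
  have hsub : ∀ (g : G), ∀ B ∈ K, T.ρ g w ∈ PointedCone.hull ℝ (B : Set E) →
      A.image (T.ρ g) ⊆ B := by
    intro g B hB hgB
    rw [hwc, State.sum_image] at hgB
    refine S.subset_of_mem_hull hB (S.stable g A hA) (fun p hp => ?_) hgB
    obtain ⟨a, ha, rfl⟩ := Finset.mem_image.1 hp
    rw [T.map_inv_map]
    exact hc a ha
  refine ⟨?_, ?_, ?_, ?_, ⟨{w}, Set.finite_singleton _, ?_, ?_⟩, ?_⟩
  · rintro _ ⟨g, rfl⟩
    exact T.map_lattice g w hw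
  · rintro _ ⟨g, rfl⟩
    exact T.map_mem g w hwC
  · rintro _ ⟨g, rfl⟩
    exact T.map_ne_zero g hw0
  · rintro g _ ⟨g', rfl⟩
    exact ⟨g * g', by simp only [map_mul, Module.End.mul_apply]⟩
  · rintro _ rfl
    exact ⟨1, by simp⟩
  · rintro _ ⟨g, rfl⟩
    exact ⟨g, w, rfl, rfl⟩
  · rintro B hB _ ⟨g, rfl⟩ _ ⟨g', rfl⟩ hg hg'
    simp only at hg hg' ⊢
    rw [hwc, map_sum, map_sum]
    refine Finset.sum_congr rfl fun p hp => ?_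
    have h1 : T.ρ (g' * g⁻¹) (T.ρ g p) = T.ρ g' p := by
      rw [map_mul, Module.End.mul_apply, T.map_inv_map]
    have h2 := hK.fixed B hB _ (hsub g B hB hg (Finset.mem_image_of_mem _ hp)) (g' * g⁻¹) (by
      rw [h1]; exact hsub g' B hB hg' (Finset.mem_image_of_mem _ hp))
    rw [map_smul, map_smul, ← h2, h1]

/-- Stellar subdivision at an orbit of lattice points that lowers the number of orbits of cells of
the largest multiplicity. -/
theorem State.exists_star_mult_lt (S : T.State k K h) (hK : T.Simplicial K) {B : Finset E}
    (hB : B ∈ K) (hmB : 1 < T.mult B) : ∃ W, T.IsCenter K W ∧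
      (∀ g, ∃ w ∈ W, w ∈ PointedCone.hull ℝ ((B.image (T.ρ g) : Finset E) : Set E)) ∧
      ∀ A ∈ starCells K W, A ∈ K ∧ (∀ w ∈ W, w ∉ PointedCone.hull ℝ (A : Set E)) ∨
        ∃ B₁ ∈ K, T.mult A < T.mult B₁ := by
  classical
  obtain ⟨x, y, ⟨hxN, hxB⟩, ⟨hyN, hyB⟩, hxy⟩ := (Set.one_lt_ncard_iff (T.finite_box B)).1 hmB
  obtain ⟨w, hwN, hwB, hw0⟩ : ∃ w ∈ T.N, w ∈ box B ∧ w ≠ 0 := by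
    by_cases hx0 : x = 0
    · exact ⟨y, hyN, hyB, fun hy => hxy (hx0.trans hy.symm)⟩
    · exact ⟨x, hxN, hxB, hx0⟩
  obtain ⟨c, hc, hwc⟩ := hwB
  -- Restricting to the support of `w` makes `w` a relative interior point of a cell, as
  -- `State.isCenter_orbit` requires.
  set A := B.filter fun p => 0 < c p with hAdef
  have hAB : A ⊆ B := Finset.filter_subset _ _
  have hA : A ∈ K := hK.mem_of_subset hB hAB
  have hcA : ∀ p ∈ A, 0 < c p ∧ c p < 1 := fun p hp =>
    ⟨(Finset.mem_filter.1 hp).2, (hc p (hAB hp)).2⟩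
  have hwA : w = ∑ p ∈ A, c p • p := by
    rw [hwc]
    refine (Finset.sum_subset hAB fun p hp hpA => ?_).symm
    have : c p = 0 := le_antisymm (not_lt.1 fun h => hpA (Finset.mem_filter.2 ⟨hp, h⟩)) (hc p hp).1
    rw [this, zero_smul]
  have hne : A.Nonempty := by
    rw [Finset.nonempty_iff_ne_empty]
    intro h
    rw [h, Finset.sum_empty] at hwA
    exact hw0 hwA
  have hW := S.isCenter_orbit hK hA hne hwN (fun p hp => (hcA p hp).1) hwA
  refine ⟨_, hW, fun g => ⟨_, ⟨g, rfl⟩, State.map_mem_hull g ?_⟩, ?_⟩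
  · rw [hwc]
    exact sum_smul_mem_hull fun p hp => (hc p hp).1
  · rintro A' (hA' | ⟨_, ⟨g, rfl⟩, B', hB', B₁, hB₁, hwB₁, hsub, hwB', rfl⟩)
    · exact Or.inl hA'
    · refine Or.inr ⟨B₁, hB₁, ?_⟩
      have hcg : ∀ p ∈ A.image (T.ρ g), 0 < c (T.ρ g⁻¹ p) ∧ c (T.ρ g⁻¹ p) < 1 := by
        intro p hp
        obtain ⟨a, ha, rfl⟩ := Finset.mem_image.1 hp
        rw [T.map_inv_map]
        exact hcA a ha
      have hwg : T.ρ g w = ∑ p ∈ A.image (T.ρ g), c (T.ρ g⁻¹ p) • p := by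
        rw [hwA, State.sum_image]
      refine S.mult_insert_lt hK hB₁ hsub ?_ (T.map_lattice g w hwN) hcg hwg hwB'
      refine S.subset_of_mem_hull hB₁ (S.stable g A hA) (fun p hp => (hcg p hp).1) ?_
      rw [← hwg]
      exact hwB₁

/-- Induction on the number of representatives of cells of the largest multiplicity `m + 2`: each
star destroys one orbit of such cells, and every cell it creates has smaller multiplicity than some
old cell. -/
theorem State.exists_mult_le_pred (m : ℕ) (S : T.State k K h) (hK : T.Simplicial K)
    (hm : ∀ B ∈ K, T.mult B ≤ m + 2) (F : Finset (Finset E))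
    (HF : ∀ B ∈ K, T.mult B = m + 2 → ∃ g, ∃ A ∈ F, B = A.image (T.ρ g)) :
    ∃ k' K' h', T.State k' K' h' ∧ Finer K K' ∧ T.Simplicial K' ∧
      ∀ B ∈ K', T.mult B ≤ m + 1 := by
  induction hn : F.card generalizing k K h F with
  | zero =>
    refine ⟨k, K, h, S, Finer.refl K, hK, fun B hB => ?_⟩
    have := hm B hB
    by_contra hcon
    obtain ⟨g, A, hA, -⟩ := HF B hB (by omega)
    rw [Finset.card_eq_zero] at hn
    rw [hn] at hA
    exact absurd hA (Finset.notMem_empty _)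
  | succ n ih =>
    by_cases hex : ∃ B ∈ K, T.mult B = m + 2
    · obtain ⟨B, hB, hmB⟩ := hex
      obtain ⟨g, A, hA, rfl⟩ := HF B hB hmB
      obtain ⟨W, hW, hWB, HW⟩ := S.exists_star_mult_lt hK hB (by omega)
      obtain ⟨n', S'⟩ := S.star hW
      have hle : ∀ A' ∈ starCells K W, T.mult A' ≤ m + 2 := by
        intro A' hA'
        rcases HW A' hA' with ⟨h1, -⟩ | ⟨B₁, hB₁, hlt⟩
        · exact hm A' h1
        · exact hlt.le.trans (hm B₁ hB₁)
      have hF' : ∀ A' ∈ starCells K W, T.mult A' = m + 2 →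
          ∃ g, ∃ A'' ∈ F.erase A, A' = A''.image (T.ρ g) := by
        intro A' hA' hmA'
        rcases HW A' hA' with ⟨h1, hno⟩ | ⟨B₁, hB₁, hlt⟩
        · obtain ⟨g', A'', hA'', rfl⟩ := HF A' h1 hmA'
          refine ⟨g', A'', Finset.mem_erase.2 ⟨?_, hA''⟩, rfl⟩
          rintro rfl
          obtain ⟨w, hw, hwA⟩ := hWB (g' * g⁻¹)
          rw [State.image_mul, State.image_inv_image] at hwA
          exact hno w hw hwA
        · have := hm B₁ hB₁
          omega
      obtain ⟨k', K', h', S'', hf, hs, hm'⟩ := ih S' (hK.star hW) hle (F.erase A) hF'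
        (by rw [Finset.card_erase_of_mem hA, hn, Nat.add_sub_cancel])
      exact ⟨k', K', h', S'', (finer_starCells _ _).trans hf, hs, hm'⟩
    · refine ⟨k, K, h, S, Finer.refl K, hK, fun B hB => ?_⟩
      have := hm B hB
      have h2 : T.mult B ≠ m + 2 := fun h => hex ⟨B, hB, h⟩
      omega

/-- Every simplicial decomposition has a unimodular subdivision. -/
theorem State.exists_unimodular (S : T.State k K h) (hK : T.Simplicial K) :
    ∃ k' K' h', T.State k' K' h' ∧ Finer K K' ∧ T.Simplicial K' ∧ ∀ B ∈ K', T.mult B ≤ 1 := by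
  obtain ⟨m, hm⟩ := S.exists_mult_le
  induction m generalizing k K h with
  | zero => exact ⟨k, K, h, S, Finer.refl K, hK, fun B hB => (hm B hB).trans zero_le_one⟩
  | succ m ih =>
    cases m with
    | zero => exact ⟨k, K, h, S, Finer.refl K, hK, hm⟩
    | succ m =>
      obtain ⟨F, hF, hFK, HF⟩ := S.finite_orbits
      obtain ⟨k', K', h', S', hf, hs, hm'⟩ := S.exists_mult_le_pred m hK hm hF.toFinset
        fun B hB _ => by simpa only [hF.mem_toFinset] using HF B hB
      obtain ⟨k'', K'', h'', S'', hf', hs', hm''⟩ := ih S' hs hm'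
      exact ⟨k'', K'', h'', S'', hf.trans hf', hs', hm''⟩

theorem finite_lattice (T : TwistedCone E G) : Module.Finite ℤ T.N := by
  choose! z hz using T.H_integer
  let f : T.N →ₗ[ℤ] (T.H → ℤ) := AddMonoidHom.toIntLinearMap
    { toFun := fun x l => z l x
      map_zero' := by
        funext l
        have := hz l l.2 _ (zero_mem T.N)
        rw [map_zero] at this
        exact_mod_cast this.symm
      map_add' := fun x y => by
        funext l
        have h1 := hz l l.2 _ x.2
        have h2 := hz l l.2 _ y.2
        have h3 := hz l l.2 _ (x + y).2
        rw [AddSubgroup.coe_add, map_add, h1, h2] at h3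
        exact_mod_cast h3.symm }
  refine Module.Finite.of_injective f ?_
  rw [← LinearMap.ker_eq_bot, LinearMap.ker_eq_bot']
  intro x hx
  refine Subtype.ext (T.H_separating _ fun l hl => ?_)
  have h1 : z l x = 0 := congrFun hx ⟨l, hl⟩
  rw [hz l hl x x.2, h1, Int.cast_zero]

/-- A simplicial cell of multiplicity one is part of a basis of the lattice. -/
theorem State.exists_basis (S : T.State k K h) (hK : T.Simplicial K) {B : Finset E} (hB : B ∈ K)
    (hmB : T.mult B ≤ 1) : ∃ (n : ℕ) (b : Module.Basis (Fin n) ℤ T.N) (J : Set (Fin n)),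
      (fun j => (b j : E)) '' J = B := by
  have hfin := T.finite_lattice
  let v : B → T.N := fun p => ⟨p, S.lattice B hB p p.2⟩
  have hsum : ∀ (c : B → ℤ), ((∑ p, c p • v p : T.N) : E) =
      ∑ p ∈ B, (if hp : p ∈ B then (c ⟨p, hp⟩ : ℝ) else 0) • p := by
    intro c
    rw [AddSubgroup.val_finsetSum, ← Finset.sum_coe_sort B]
    refine Finset.sum_congr rfl fun p _ => ?_
    rw [dif_pos p.2, Int.cast_smul_eq_zsmul]
    rfl
  have hli : LinearIndependent ℤ v := by
    rw [Fintype.linearIndependent_iff]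
    intro c hc p
    have h1 := hsum c
    rw [hc, ZeroMemClass.coe_zero] at h1
    have h2 : ∑ p ∈ B, (fun _ => (0 : ℝ)) p • p =
        ∑ p ∈ B, (if hp : p ∈ B then (c ⟨p, hp⟩ : ℝ) else 0) • p := by
      rw [← h1]; simp
    have h3 := S.eq_of_sum_eq hK hB h2 p.2
    rw [dif_pos p.2] at h3
    exact_mod_cast h3.symm
  let M : Submodule ℤ T.N := Submodule.span ℤ (Set.range v)
  -- A lattice point in the real span of the cell differs from an integral combination of its
  -- vertices by a lattice point of the half-open box, which is zero when the multiplicity is one. A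
  -- basis of the torsion-free quotient then completes the cell.
  have htf : Module.IsTorsionFree ℤ (T.N ⧸ M) := by
    refine Module.IsTorsionFree.of_smul_eq_zero fun r x hx => ?_
    obtain ⟨x, rfl⟩ := M.mkQ_surjective x
    by_cases hr : r = 0
    · exact Or.inl hr
    right
    have hrR : (r : ℝ) ≠ 0 := by exact_mod_cast hr
    rw [← map_smul, Submodule.mkQ_apply, Submodule.Quotient.mk_eq_zero] at hx
    obtain ⟨c, hc⟩ := (Submodule.mem_span_range_iff_exists_fun ℤ).1 hx
    rw [Submodule.mkQ_apply, Submodule.Quotient.mk_eq_zero]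
    have h1 : (r : ℝ) • (x : E) = ∑ p ∈ B, (if hp : p ∈ B then (c ⟨p, hp⟩ : ℝ) else 0) • p := by
      rw [← hsum, hc, Int.cast_smul_eq_zsmul]
      rfl
    set e : E → ℝ := fun p => if hp : p ∈ B then (c ⟨p, hp⟩ : ℝ) / r else 0 with he
    have h2 : (x : E) = ∑ p ∈ B, e p • p := by
      rw [← inv_smul_smul₀ hrR (x : E), h1, Finset.smul_sum]
      refine Finset.sum_congr rfl fun p hp => ?_
      rw [he, smul_smul, dif_pos hp]
      simp only [dif_pos hp]
      rw [inv_mul_eq_div]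
    set y : T.N := ∑ p : B, ⌊e p⌋ • v p with hy
    have h3 : ((x - y : T.N) : E) = ∑ p ∈ B, Int.fract (e p) • p := by
      rw [AddSubgroup.coe_sub, hy, hsum, h2, ← Finset.sum_sub_distrib]
      refine Finset.sum_congr rfl fun p hp => ?_
      rw [dif_pos hp, ← sub_smul]
      rfl
    have h4 := T.eq_zero_of_mult_le_one hmB (x - y).2
      ⟨_, fun p _ => ⟨Int.fract_nonneg _, Int.fract_lt_one _⟩, h3⟩
    have h5 : x = y := sub_eq_zero.1 (Subtype.ext h4)
    rw [h5]
    exact sum_mem fun p _ => M.smul_mem _ (Submodule.subset_span ⟨p, rfl⟩)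
  obtain ⟨n, bQ⟩ := Module.basisOfFiniteTypeTorsionFree' (R := ℤ) (M := T.N ⧸ M)
  let b := Module.Basis.sumQuot (Module.Basis.span hli) bQ
  let ε := Fintype.equivFin (B ⊕ Fin n)
  refine ⟨_, b.reindex ε, ε '' Set.range Sum.inl, ?_⟩
  rw [Set.image_image, ← Set.range_comp]
  have : ((fun j => ((b.reindex ε) (ε j) : E)) ∘ Sum.inl : B → E) = Subtype.val := by
    funext p
    simp only [Function.comp_apply, Module.Basis.reindex_apply, Equiv.symm_apply_apply, b,
      Module.Basis.sumQuot_inl]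
    rw [Module.Basis.span_apply]
  rw [this]
  exact Subtype.range_coe

end Multiplicity

end TwistedCone

/-! ### Fans and decompositions -/

namespace TwistedCone

section FanOfState

variable {E G : Type*} [AddCommGroup E] [Module ℝ E] [Group G] [DecidableEq E]

variable {T : TwistedCone E G} {k : ℕ} {K : Set (Finset E)} {h : E → ℝ}

/-- A complete admissible fan with a piecewise linear function and support functions for all its
cones gives a decomposition. -/
theorem exists_state {S : Set (Set E)} (hS : IsCompleteAdmissibleFan T.N T.C T.ρ S) {f : E → ℝ}
    (hk : 0 < k) (hf : ∀ g, ∀ w ∈ T.C, f (T.ρ g w) = f w + k * T.θ g w)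
    (hstrict : ∀ τ ∈ S, ∃ L, T.Good k L ∧ ∀ w ∈ T.C, f w ≤ L w ∧ (L w = f w ↔ w ∈ τ)) :
    ∃ K : Set (Finset E), T.State k K f ∧ ∀ A ∈ K, ∃ τ ∈ S, (A : Set E) ⊆ τ := by
  classical
  obtain ⟨Y, hY, hYS, HY⟩ := hS.admissible.finite_orbits
  choose! B hBN hB using hS.isFan.rational
  have hSC : ∀ τ ∈ S, τ ⊆ T.C := fun τ hτ => by
    rw [← hS.complete]; exact Set.subset_sUnion_of_mem hτ
  have hBτ : ∀ τ ∈ S, ∀ p ∈ B τ, p ∈ τ := fun τ hτ p hp => by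
    rw [hB τ hτ]; exact subset_hull hp
  let Q : Set E := (⋃ τ ∈ Y, (B τ : Set E)) \ {0}
  have hQ : Q.Finite := (hY.biUnion fun τ _ => (B τ).finite_toSet).subset Set.sdiff_subset
  have hQspec : ∀ p ∈ Q, p ∈ T.N ∧ p ∈ T.C ∧ p ≠ 0 := by
    rintro p ⟨hp, hp0⟩
    obtain ⟨τ, hτ, hpτ⟩ := Set.mem_iUnion₂.1 hp
    exact ⟨hBN τ (hYS hτ) hpτ, hSC τ (hYS hτ) (hBτ τ (hYS hτ) p hpτ), hp0⟩
  -- Generators chosen cone by cone need not be compatible with stabilizers or with faces. Taking as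
  -- vertices of `τ` all points of the saturated set `P` in `τ` is canonical and equivariant.
  let P : Set E := {p | ∃ g, ∃ q ∈ Q, p = T.ρ g q}
  have hPspec : ∀ p ∈ P, p ∈ T.N ∧ p ∈ T.C ∧ p ≠ 0 := by
    rintro _ ⟨g, q, hq, rfl⟩
    obtain ⟨h1, h2, h3⟩ := hQspec q hq
    exact ⟨T.map_lattice g q h1, T.map_mem g q h2, T.map_ne_zero g h3⟩
  have hPstable : ∀ g, ∀ p ∈ P, T.ρ g p ∈ P := by
    rintro g _ ⟨g', q, hq, rfl⟩
    exact ⟨g * g', q, hq, by rw [map_mul, Module.End.mul_apply]⟩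
  have hPimage : ∀ g, T.ρ g '' P = P := fun g => subset_antisymm
    (Set.image_subset_iff.2 fun p hp => hPstable g p hp)
    fun p hp => ⟨_, hPstable g⁻¹ p hp, T.map_map_inv g p⟩
  obtain ⟨M, hM⟩ := (hQ.image fun p => f p - k * T.ψ p).bddAbove
  have hPM : ∀ p ∈ P, f p - k * T.ψ p ≤ M := by
    rintro _ ⟨g, q, hq, rfl⟩
    obtain ⟨h1, h2, h3⟩ := hQspec q hq
    rw [hf g q h2, T.ψ_map g q h2 h3]
    refine le_trans (le_of_eq ?_) (hM ⟨q, hq, rfl⟩)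
    ring
  -- On `τ` the function `f` equals `L`, and the invariant `f - kψ` is bounded on `P`; so properness
  -- of `L - kψ` applies.
  have hfin : ∀ τ ∈ S, (P ∩ τ).Finite := by
    intro τ hτ
    obtain ⟨L, hL, H⟩ := hstrict τ hτ
    refine (hL.finite_le M).subset ?_
    rintro p ⟨hp, hpτ⟩
    obtain ⟨h1, h2, h3⟩ := hPspec p hp
    refine ⟨h1, h2, h3, ?_⟩
    rw [((H p h2).2).2 hpτ]
    exact hPM p hp
  have hhull : ∀ τ ∈ S, ∀ A : Finset E, (A : Set E) = P ∩ τ →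
      τ = (PointedCone.hull ℝ (A : Set E) : Set E) := by
    intro τ hτ A hA
    obtain ⟨D, rfl⟩ := hS.isFan.exists_coe hτ
    refine subset_antisymm (fun x hx => ?_) fun x hx => ?_
    · obtain ⟨g, t, ht, hgt⟩ := HY _ hτ
      rw [hgt] at hx
      obtain ⟨y, hy, rfl⟩ := hx
      rw [hB t (hYS ht)] at hy
      obtain ⟨c, hc, rfl⟩ := mem_hull_finset.1 hy
      rw [map_sum]
      refine sum_mem fun b hb => ?_
      rw [map_smul]
      refine PointedCone.smul_mem _ (hc b hb) ?_
      by_cases hb0 : b = 0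
      · rw [hb0, map_zero]; exact zero_mem _
      · refine Submodule.subset_span ?_
        rw [hA]
        refine ⟨⟨g, b, ⟨Set.mem_biUnion ht hb, hb0⟩, rfl⟩, ?_⟩
        rw [hgt]
        exact ⟨b, hBτ t (hYS ht) b hb, rfl⟩
    · refine Submodule.span_le.2 ?_ hx
      rw [hA]
      exact Set.inter_subset_right
  refine ⟨{A | ∃ τ ∈ S, (A : Set E) = P ∩ τ}, ⟨hk, ?_, ?_, ?_, ?_, ?_, ?_, ?_, ?_⟩, ?_⟩
  · rintro A ⟨τ, hτ, hA⟩ p hp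
    have h1 : p ∈ P ∩ τ := hA ▸ Finset.mem_coe.2 hp
    exact (hPspec p h1.1).1
  · rintro A ⟨τ, hτ, hA⟩ p hp
    have h1 : p ∈ P ∩ τ := hA ▸ Finset.mem_coe.2 hp
    exact (hPspec p h1.1).2.1
  · rintro A ⟨τ, hτ, hA⟩ p hp
    have h1 : p ∈ P ∩ τ := hA ▸ Finset.mem_coe.2 hp
    exact (hPspec p h1.1).2.2
  · rintro g A ⟨τ, hτ, hA⟩
    refine ⟨_, hS.admissible.stable g τ hτ, ?_⟩
    rw [Finset.coe_image, hA, Set.image_inter (T.map_injective g), hPimage]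
  · refine ⟨{A | ∃ τ ∈ Y, (A : Set E) = P ∩ τ}, ?_, ?_, ?_⟩
    · refine Set.Finite.subset (Set.Finite.preimage Finset.coe_injective.injOn
        (hY.image fun τ => P ∩ τ)) ?_
      rintro A ⟨τ, hτ, hA⟩
      exact ⟨τ, hτ, hA.symm⟩
    · rintro A ⟨τ, hτ, hA⟩
      exact ⟨τ, hYS hτ, hA⟩
    · rintro A ⟨τ, hτ, hA⟩
      obtain ⟨g, t, ht, rfl⟩ := HY τ hτ
      refine ⟨g, (hfin t (hYS ht)).toFinset, ⟨t, ht, Set.Finite.coe_toFinset _⟩,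
        Finset.coe_injective ?_⟩
      rw [Finset.coe_image, Set.Finite.coe_toFinset, hA, Set.image_inter (T.map_injective g),
        hPimage]
  · rintro A ⟨τ, hτ, hA⟩ p hp g
    have h1 : p ∈ P ∩ τ := hA ▸ Finset.mem_coe.2 hp
    exact hf g p (hPspec p h1.1).2.1
  · intro w hw
    have hw' : w ∈ ⋃₀ S := by rw [hS.complete]; exact hw
    obtain ⟨τ, hτ, hwτ⟩ := hw'
    obtain ⟨D, rfl⟩ := hS.isFan.exists_coe hτ
    have hD := hS.isFan.face_mem D _ hτ (minFace_isFaceOf hwτ)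
    have hcore := isCore_minFace hwτ
    have hA := (Set.Finite.coe_toFinset (hfin _ hD))
    rw [hhull _ hD _ hA] at hcore
    obtain ⟨c, hc, hwc⟩ := hcore.exists_pos
    exact ⟨_, ⟨_, hD, hA⟩, c, hc, hwc⟩
  · rintro A ⟨τ, hτ, hA⟩
    obtain ⟨L, hL, H⟩ := hstrict τ hτ
    refine ⟨L, hL, fun p hp => ?_, ?_⟩
    · have h1 : p ∈ P ∩ τ := hA ▸ Finset.mem_coe.2 hp
      exact ((H p (hPspec p h1.1).2.1).2).2 h1.2
    · rintro A' ⟨τ', hτ', hA'⟩ p hp hpA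
      have h1 : p ∈ P ∩ τ' := hA' ▸ Finset.mem_coe.2 hp
      have h2 := H p (hPspec p h1.1).2.1
      refine lt_of_le_of_ne h2.1 fun heq => hpA ?_
      have h3 : p ∈ P ∩ τ := ⟨h1.1, h2.2.1 heq.symm⟩
      rw [← hA] at h3
      exact Finset.mem_coe.1 h3
  · rintro A ⟨τ, hτ, hA⟩
    exact ⟨τ, hτ, hA ▸ Set.inter_subset_right⟩

/-- The cones over the cells. -/
def fanOf (K : Set (Finset E)) : Set (Set E) :=
  {σ | ∃ B ∈ K, σ = (PointedCone.hull ℝ (B : Set E) : Set E)}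

/-- For the intersection axiom, the piecewise linear function is linear on the first cone and
bounded above by the support functional of the second; equality at `ax + y` forces equality at `x`.
-/
theorem State.isFan_fanOf (S : T.State k K h) (hK : T.Simplicial K) : IsFan T.N (fanOf K) where
  rational := by
    rintro _ ⟨B, hB, rfl⟩
    exact ⟨B, fun p hp => S.lattice B hB p hp, rfl⟩
  salient := by
    rintro _ ⟨B, hB, rfl⟩ x hx hx'
    exact T.salient x (T.hull_le (S.mem B hB) hx) (T.hull_le (S.mem B hB) hx')
  face_mem := by
    rintro C D ⟨B, hB, hC⟩ hD
    obtain rfl : C = PointedCone.hull ℝ (B : Set E) := SetLike.coe_injective hC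
    obtain ⟨B', hB', rfl⟩ := exists_hull_of_isFaceOf hD
    exact ⟨B', hK.mem_of_subset hB hB', rfl⟩
  inter_isFaceOf := by
    rintro C D ⟨B, hB, hC⟩ ⟨B', hB', hD⟩
    obtain rfl : C = PointedCone.hull ℝ (B : Set E) := SetLike.coe_injective hC
    obtain rfl : D = PointedCone.hull ℝ (B' : Set E) := SetLike.coe_injective hD
    refine ⟨inf_le_left, fun {x y a} hx hy ha hxy => ⟨hx, ?_⟩⟩
    obtain ⟨L, hL⟩ := S.strict B hB
    obtain ⟨L', hL'⟩ := S.strict B' hB'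
    have hC := T.hull_le (S.mem B hB)
    rw [SetLike.mem_coe, S.mem_hull_iff hB' hL' (hC hx)]
    have h1 := S.pl_eq_of_mem_hull hB' hL' hxy.2
    rw [S.pl_eq_of_mem_hull hB hL hxy.1] at h1
    have h2 := S.pl_le hL' (hC hx)
    have h3 := S.pl_le hL' (hC hy)
    rw [S.pl_eq_of_mem_hull hB hL hx] at h2 ⊢
    rw [S.pl_eq_of_mem_hull hB hL hy] at h3
    simp only [map_add, map_smul, smul_eq_mul] at h1
    refine le_antisymm h2 ?_
    by_contra hcon
    have := mul_lt_mul_of_pos_left (not_le.1 hcon) ha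
    linarith

theorem State.isCompleteAdmissibleFan_fanOf (S : T.State k K h) (hK : T.Simplicial K) :
    IsCompleteAdmissibleFan T.N T.C T.ρ (fanOf K) where
  isFan := S.isFan_fanOf hK
  complete := by
    refine subset_antisymm (Set.sUnion_subset ?_) fun w hw => ?_
    · rintro _ ⟨B, hB, rfl⟩
      exact T.hull_le (S.mem B hB)
    · obtain ⟨A, hA, c, hc, rfl⟩ := S.cover w hw
      exact ⟨_, ⟨A, hA, rfl⟩, sum_smul_mem_hull fun p hp => (hc p hp).le⟩
  admissible := by
    have himage : ∀ (g : G) (B : Finset E), T.ρ g '' (PointedCone.hull ℝ (B : Set E) : Set E) =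
        (PointedCone.hull ℝ ((B.image (T.ρ g) : Finset E) : Set E) : Set E) := by
      intro g B
      refine subset_antisymm (Set.image_subset_iff.2 fun x hx => State.map_mem_hull g hx)
        fun x hx => ⟨T.ρ g⁻¹ x, ?_, T.map_map_inv g x⟩
      have := State.map_mem_hull (T := T) g⁻¹ hx
      rwa [State.image_inv_image] at this
    obtain ⟨F, hF, hFK, HF⟩ := S.finite_orbits
    refine ⟨?_, (fun B : Finset E => (PointedCone.hull ℝ (B : Set E) : Set E)) '' F,
      hF.image _, ?_, ?_⟩
    · rintro g _ ⟨B, hB, rfl⟩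
      exact ⟨_, S.stable g B hB, himage g B⟩
    · rintro _ ⟨B, hB, rfl⟩
      exact ⟨B, hFK hB, rfl⟩
    · rintro _ ⟨B, hB, rfl⟩
      obtain ⟨g, A, hA, rfl⟩ := HF B hB
      exact ⟨g, _, ⟨A, hA, rfl⟩, (himage g A).symm⟩

theorem State.isSmooth_fanOf (S : T.State k K h) (hK : T.Simplicial K)
    (hm : ∀ B ∈ K, T.mult B ≤ 1) : IsSmooth T.N (fanOf K) := by
  rintro _ ⟨B, hB, rfl⟩
  obtain ⟨n, b, J, hJ⟩ := S.exists_basis hK hB (hm B hB)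
  exact ⟨n, b, J, by rw [hJ]⟩

theorem State.concaveOn_pl (S : T.State k K h) : ConcaveOn ℝ (T.C : Set E) (pl K h) := by
  refine ⟨fun x hx y hy a b ha hb _ => add_mem (PointedCone.smul_mem _ ha hx)
    (PointedCone.smul_mem _ hb hy), fun x hx y hy a b ha hb hab => ?_⟩
  have hxy : a • x + b • y ∈ T.C :=
    add_mem (PointedCone.smul_mem _ ha hx) (PointedCone.smul_mem _ hb hy)
  obtain ⟨A, hA, c, hc, hw⟩ := S.cover _ hxy
  obtain ⟨L, hL⟩ := S.strict A hA
  have h1 : pl K h (a • x + b • y) = L (a • x + b • y) :=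
    S.pl_eq_of_mem_hull hA hL (by rw [hw]; exact sum_smul_mem_hull fun p hp => (hc p hp).le)
  rw [h1, map_add, map_smul, map_smul]
  exact add_le_add (mul_le_mul_of_nonneg_left (S.pl_le hL hx) ha)
    (mul_le_mul_of_nonneg_left (S.pl_le hL hy) hb)

theorem State.pl_smul (S : T.State k K h) {w : E} (hw : w ∈ T.C) {r : ℝ} (hr : 0 ≤ r) :
    pl K h (r • w) = r * pl K h w := by
  obtain ⟨A, hA, c, hc, rfl⟩ := S.cover w hw
  have h1 := S.pl_sum hA (c := fun p => r * c p) fun p hp => mul_nonneg hr (hc p hp).le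
  rw [S.pl_sum hA fun p hp => (hc p hp).le, Finset.mul_sum, Finset.smul_sum]
  simp only [mul_smul, mul_assoc] at h1
  exact h1

/-- Some multiple of the piecewise linear function is integral on the lattice. -/
theorem State.exists_integral (S : T.State k K h)
    (hR : ∀ L ∈ T.R, ∃ n : ℕ, 0 < n ∧ ∀ x ∈ T.N, ∃ z : ℤ, n * L x = z)
    (hθ : ∀ g, ∀ x ∈ T.N, ∃ z : ℤ, T.θ g x = z) :
    ∃ n : ℕ, 0 < n ∧ ∀ w ∈ T.C, w ∈ T.N → ∃ z : ℤ, n * pl K h w = z := by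
  obtain ⟨F, hF, hFK, HF⟩ := S.finite_orbits
  choose! L hL using S.strict
  choose! n hn hnL using hR
  -- It suffices to clear the denominators of the support functionals of representatives, since
  -- translation adds only the integral functionals `kθ`.
  refine ⟨∏ A ∈ hF.toFinset, n (L A), Finset.prod_pos fun A hA =>
    hn _ (hL A (hFK (hF.mem_toFinset.1 hA))).1.1, fun w hw hwN => ?_⟩
  obtain ⟨B, hB, c, hc, hwc⟩ := S.cover w hw
  obtain ⟨g, A, hA, rfl⟩ := HF B hB
  have hwB : w ∈ PointedCone.hull ℝ ((A.image (T.ρ g) : Finset E) : Set E) := by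
    rw [hwc]; exact sum_smul_mem_hull fun p hp => (hc p hp).le
  have hv := T.map_mem g⁻¹ w hw
  have hvN := T.map_lattice g⁻¹ w hwN
  have hvA : T.ρ g⁻¹ w ∈ PointedCone.hull ℝ (A : Set E) := by
    rwa [← State.map_mem_hull_iff (T := T) g, T.map_map_inv]
  obtain ⟨z, hz⟩ := hnL _ (hL A (hFK hA)).1.1 _ hvN
  obtain ⟨z', hz'⟩ := hθ g _ hvN
  obtain ⟨m, hm⟩ := Finset.dvd_prod_of_mem (fun A => n (L A)) (hF.mem_toFinset.2 hA)
  refine ⟨m * z + (∏ A ∈ hF.toFinset, n (L A) : ℕ) * k * z', ?_⟩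
  rw [← T.map_map_inv g w, S.pl_map g hv, S.pl_eq_of_mem_hull (hFK hA) (hL A (hFK hA)) hvA, hz',
    mul_add]
  push_cast
  congr 1
  · rw [← Nat.cast_prod, hm, Nat.cast_mul, ← hz]
    ring
  · ring

end FanOfState

end TwistedCone

/-! ### The twisted cone of a cusp -/

section Cusp

variable {F : Type*} [Field F] [NumberField F]

theorem tr_sum {ι : Type*} (A : Finset ι) (x : ι → V F) : tr (∑ i ∈ A, x i) = ∑ i ∈ A, tr (x i) :=
  map_sum (trL F) _ _

theorem exists_nsmul_mem {I : FractionalIdeal (𝓞 F)⁰ F} (hI : I ≠ 0) (x : F) :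
    ∃ n : ℕ, 0 < n ∧ n • x ∈ I := by
  let b := basisOfFractionalIdeal F (Units.mk0 I hI)
  have hb : ∀ i, b i ∈ I := fun i =>
    (mem_span_basisOfFractionalIdeal F).1 (Submodule.subset_span ⟨i, rfl⟩)
  obtain ⟨n, hn, h⟩ := exists_common_denominator Finset.univ (fun i => (b.repr x i : ℝ))
    fun i _ => ⟨_, rfl⟩
  choose! z hz using h
  refine ⟨n, hn, ?_⟩
  have h1 : n • x = ∑ i, z i • b i := by
    conv_lhs => rw [← b.sum_repr x, Finset.smul_sum]
    refine Finset.sum_congr rfl fun i hi => ?_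
    have h2 : (n : ℚ) * b.repr x i = z i := by exact_mod_cast hz i hi
    rw [← Nat.cast_smul_eq_nsmul ℚ, smul_smul, h2, Int.cast_smul_eq_zsmul]
  rw [h1]
  change ∑ i, z i • b i ∈ (I : Submodule (𝓞 F) F)
  exact sum_mem fun i _ => zsmul_mem (show b i ∈ (I : Submodule (𝓞 F) F) from hb i) _

theorem eq_zero_of_basis {ι : Type*} [Fintype ι] (b : Module.Basis ι ℚ F) {q : V F}
    (h : ∀ i, tr (emb (b i) * q) = 0) : q = 0 := by
  refine eq_zero_of_tr_eq_zero (I := (1 : FractionalIdeal (𝓞 F)⁰ F)) one_ne_zero fun y _ => ?_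
  rw [← traceL_apply, ← b.sum_repr y, map_sum, LinearMap.sum_apply]
  refine Finset.sum_eq_zero fun i _ => ?_
  rw [map_smul, LinearMap.smul_apply, traceL_apply, h, smul_zero]

theorem emb_mul_mem_dualLattice {I J : FractionalIdeal (𝓞 F)⁰ F} (hI : I ≠ 0) (hJ : J ≠ 0) {c : F}
    (hc : ∀ x ∈ J, c * x ∈ I) {y : V F} (hy : y ∈ dualLattice I) :
    emb c * y ∈ dualLattice J := by
  obtain ⟨y, hy, rfl⟩ := hy
  refine ⟨c * y, ?_, map_mul (emb : F →+* V F) c y⟩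
  refine (FractionalIdeal.mem_dual (A := ℤ) (K := ℚ) hJ).2 fun x hx => ?_
  have := (FractionalIdeal.mem_dual (A := ℤ) (K := ℚ) hI).1 hy _ (hc x hx)
  rwa [Algebra.traceForm_apply, mul_left_comm, ← mul_assoc, ← Algebra.traceForm_apply] at this

theorem unit_mul_mem {I : FractionalIdeal (𝓞 F)⁰ F} (u : 𝓞 F) {x : F} (hx : x ∈ I) :
    (u : F) * x ∈ I := by
  rw [← Algebra.smul_def]
  exact Submodule.smul_mem (I : Submodule (𝓞 F) F) u hx

variable [NumberField.IsTotallyReal F]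

namespace CuspData

variable {s : ℕ} (D : CuspData F s) (U : Subgroup (𝓞 F)ˣ)

theorem pairing_single (i : Fin s) (x : F) (w : W F s) :
    pairing 0 (Pi.single i x) w = tr (emb x * w.2 i) := by
  have h0 : tr (0 : V F) = 0 := (trL F).map_zero
  rw [pairing, map_zero, zero_mul, h0, zero_add, Finset.sum_eq_single i, Pi.single_eq_same]
  · intro j _ hj
    rw [Pi.single_eq_of_ne hj, map_zero, zero_mul, h0]
  · simp

theorem pairing_zero_right (x : F) (w : W F s) : pairing x 0 w = tr (emb x * w.1) := by
  have h0 : tr (0 : V F) = 0 := (trL F).map_zero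
  simp [pairing, h0]

theorem exists_nsmul_mem_lattices (p : F × (Fin s → F)) :
    ∃ n : ℕ, 0 < n ∧ (n • p).1 ∈ D.X ∧ ∀ i, (n • p).2 i ∈ D.a := by
  obtain ⟨n, hn, h⟩ := exists_nsmul_mem D.X_ne_zero p.1
  choose m hm hm' using fun i => exists_nsmul_mem D.a_ne_zero (p.2 i)
  refine ⟨n * ∏ i, m i, Nat.mul_pos hn (Finset.prod_pos fun i _ => hm i), ?_, fun i => ?_⟩
  · rw [mul_comm, mul_smul]
    exact nsmul_mem (show n • p.1 ∈ (D.X : Submodule (𝓞 F) F) from h) _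
  · obtain ⟨r, hr⟩ := Finset.dvd_prod_of_mem m (Finset.mem_univ i)
    have h1 : ((n * ∏ i, m i) • p).2 i = (n * r) • (m i • p.2 i) := by
      rw [← mul_smul, hr]
      change (n * (m i * r)) • p.2 i = _
      congr 1
      ring
    rw [h1]
    exact nsmul_mem (show m i • p.2 i ∈ (D.a : Submodule (𝓞 F) F) from hm' i) _

/-- The term `u²qβ` lies in `𝔞*` because `𝔞β ⊆ 𝔞𝔟' = X` and `q` lies in `X*`. -/
theorem action_mem_latticeTilde (g : D.Gp U) {w : W F s} (hw : w ∈ D.latticeTilde) :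
    D.action U g w ∈ D.latticeTilde := by
  have hu : ∀ {I : FractionalIdeal (𝓞 F)⁰ F} {x : F}, x ∈ I →
      ((g.right : (𝓞 F)ˣ) : F) * x ∈ I := fun hx => unit_mul_mem _ hx
  refine ⟨?_, fun i _ => ?_⟩
  · change emb ((g.right : (𝓞 F)ˣ) : F) ^ 2 * w.1 ∈ dualLattice D.X
    rw [← map_pow]
    refine emb_mul_mem_dualLattice D.X_ne_zero D.X_ne_zero (fun x hx => ?_) hw.1
    rw [pow_two, mul_assoc]
    exact hu (hu hx)
  · change emb ((g.right : (𝓞 F)ˣ) : F) * w.2 i + emb ((g.right : (𝓞 F)ˣ) : F) ^ 2 * w.1 *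
      emb (g.left.toAdd i : F) ∈ dualLattice D.a
    refine add_mem (emb_mul_mem_dualLattice D.a_ne_zero D.a_ne_zero (fun x hx => hu hx)
      (hw.2 i (Set.mem_univ i))) ?_
    rw [mul_right_comm, ← map_pow, ← map_mul]
    refine emb_mul_mem_dualLattice D.X_ne_zero D.a_ne_zero (fun x hx => ?_) hw.1
    rw [mul_comm _ x, ← mul_assoc]
    refine FractionalIdeal.mul_mem_mul ?_ (D.b_le (g.left.toAdd i).2)
    rw [mul_comm, pow_two, mul_assoc]
    exact hu (hu hx)

theorem pairL_comp_action (g : D.Gp U) (p : F × (Fin s → F)) : pairL p ∘ₗ D.action U g =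
    pairL (((g.right : (𝓞 F)ˣ) : F) ^ 2 * p.1 + ∑ i, p.2 i * ((g.right : (𝓞 F)ˣ) : F) ^ 2 *
      (g.left.toAdd i : F), fun i => ((g.right : (𝓞 F)ˣ) : F) * p.2 i) := by
  refine LinearMap.ext fun w => ?_
  rw [LinearMap.comp_apply, pairL_apply, pairL_apply]
  simp only [pairing, map_add, map_sum, add_mul, Finset.sum_mul, tr_add, tr_sum]
  rw [add_assoc, ← Finset.sum_add_distrib]
  congr 1
  · change tr (emb p.1 * (emb ((g.right : (𝓞 F)ˣ) : F) ^ 2 * w.1)) = _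
    rw [map_mul, map_pow]
    congr 1
    ring
  · refine Finset.sum_congr rfl fun i _ => ?_
    change tr (emb (p.2 i) * (emb ((g.right : (𝓞 F)ˣ) : F) * w.2 i +
      emb ((g.right : (𝓞 F)ˣ) : F) ^ 2 * w.1 * emb (g.left.toAdd i : F))) = _
    rw [← tr_add]
    simp only [map_mul, map_pow]
    congr 1
    ring

/-- The infimum of `χ_β (q, l)` over all real `β`. -/
def realMin (w : W F s) : ℝ := -∑ i, ∑ τ : F →+* ℝ, τ (D.μ i) * w.2 i τ ^ 2 / w.1 τ

theorem χ_eq_square_add_realMin (β : D.Bs) (w : W F s) (hw : ∀ τ, 0 < w.1 τ) : D.χ β w =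
    ∑ i, ∑ τ : F →+* ℝ, w.1 τ * τ (D.μ i) * (τ (β i : F) + w.2 i τ / w.1 τ) ^ 2 + D.realMin w := by
  rw [D.χ_eq_square β w hw, realMin, sub_eq_add_neg]

/-- The infimum over all real `β` is subject to the same substitution as the minimum over the
lattice, so it has the same cocycle as `φ`; here this is read off from the explicit formula. -/
theorem realMin_action (g : D.Gp U) (w : W F s) (hw : ∀ τ, 0 < w.1 τ) :
    D.realMin (D.action U g w) =
      D.realMin w - D.χ ((g.right : (𝓞 F)ˣ) • g.left.toAdd) w := by
  rw [← D.χ_unit]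
  simp only [realMin, χ_eq_sum, ← Finset.sum_neg_distrib, ← Finset.sum_sub_distrib]
  refine Finset.sum_congr rfl fun i _ => Finset.sum_congr rfl fun τ _ => ?_
  have h1 := (hw τ).ne'
  have h2 := unit_embedding_ne_zero (g.right : (𝓞 F)ˣ) τ
  rw [action_apply]
  simp only [shift, Pi.mul_apply, Pi.pow_apply, Pi.add_apply, emb_apply]
  field_simp
  ring

variable (F s) in
/-- The cone `{0} ∪ (F ⊗ ℝ)₊ × (F ⊗ ℝ) ^ s` as a pointed cone. -/
def pointedConeTilde : PointedCone ℝ (W F s) where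
  carrier := coneTilde F s
  add_mem' := fun hx hy => add_mem_coneTilde hx hy
  zero_mem' := Or.inl rfl
  smul_mem' := fun r _ hx => smul_mem_coneTilde hx r.2

open scoped Classical in
/-- Integral functionals that separate points. -/
def coordinates : Finset (W F s →ₗ[ℝ] ℝ) :=
  (Finset.univ.image fun j =>
    pairL (basisOfFractionalIdeal F (Units.mk0 D.X D.X_ne_zero) j, 0)) ∪
  Finset.univ.image fun p : Fin s × _ =>
    pairL (0, Pi.single p.1 (basisOfFractionalIdeal F (Units.mk0 D.a D.a_ne_zero) p.2))

theorem exists_of_mem_coordinates {l : W F s →ₗ[ℝ] ℝ} (hl : l ∈ D.coordinates) :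
    ∃ p : F × (Fin s → F), p.1 ∈ D.X ∧ (∀ i, p.2 i ∈ D.a) ∧ pairL p = l := by
  classical
  have h0 : ∀ I : FractionalIdeal (𝓞 F)⁰ F, (0 : F) ∈ I := fun I =>
    zero_mem (I : Submodule (𝓞 F) F)
  rcases Finset.mem_union.1 hl with hl | hl
  · obtain ⟨j, _, rfl⟩ := Finset.mem_image.1 hl
    refine ⟨(basisOfFractionalIdeal F (Units.mk0 D.X D.X_ne_zero) j, 0), ?_, fun i => h0 _, rfl⟩
    change _ ∈ ((Units.mk0 D.X D.X_ne_zero : (FractionalIdeal (𝓞 F)⁰ F)ˣ) :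
      FractionalIdeal (𝓞 F)⁰ F)
    exact (mem_span_basisOfFractionalIdeal F).1 (Submodule.subset_span ⟨j, rfl⟩)
  · obtain ⟨p, _, rfl⟩ := Finset.mem_image.1 hl
    refine ⟨_, h0 _, fun i => ?_, rfl⟩
    by_cases hi : i = p.1
    · subst hi
      simp only [Pi.single_eq_same]
      exact (mem_span_basisOfFractionalIdeal F).1 (Submodule.subset_span ⟨p.2, rfl⟩)
    · simp only [Pi.single_eq_of_ne hi]
      exact h0 _

theorem eq_zero_of_coordinates {w : W F s} (h : ∀ l ∈ D.coordinates, l w = 0) : w = 0 := by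
  classical
  refine Prod.ext ?_ (funext fun i => ?_)
  · refine eq_zero_of_basis (basisOfFractionalIdeal F (Units.mk0 D.X D.X_ne_zero)) fun j => ?_
    rw [← pairing_zero_right]
    exact h _ (Finset.mem_union_left _ (Finset.mem_image_of_mem _ (Finset.mem_univ j)))
  · refine eq_zero_of_basis (basisOfFractionalIdeal F (Units.mk0 D.a D.a_ne_zero)) fun j => ?_
    rw [← pairing_single]
    exact h _ (Finset.mem_union_right _ (Finset.mem_image_of_mem _ (Finset.mem_univ (i, j))))

theorem pos_of_mem {w : W F s} (hw : w ∈ coneTilde F s) (hw0 : w ≠ 0) : ∀ τ, 0 < w.1 τ :=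
  hw.resolve_left hw0

/-- The cone of the cusp with the action of `𝔟 ^ s ⋊ U`. -/
def twistedCone : TwistedCone (W F s) (D.Gp U) where
  ρ := D.action U
  N := D.latticeTilde
  C := pointedConeTilde F s
  R := LinearMap.range pairL
  H := D.coordinates
  ψ := D.realMin
  θ := fun g => -D.χL ((g.right : (𝓞 F)ˣ) • g.left.toAdd)
  salient := fun _ hx hx' => neg_mem_coneTilde hx hx'
  map_mem := fun g _ hx => D.action_mem_coneTilde U g hx
  map_lattice := fun g _ hx => D.action_mem_latticeTilde U g hx
  comp_mem := by
    rintro g _ ⟨p, rfl⟩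
    exact ⟨_, (D.pairL_comp_action U g p).symm⟩
  rational := by
    rintro _ ⟨p, rfl⟩ x hx
    exact D.pairing_rational p hx
  H_subset := fun l hl => by
    obtain ⟨p, _, _, rfl⟩ := D.exists_of_mem_coordinates hl
    exact ⟨p, rfl⟩
  H_integer := fun l hl x hx => by
    obtain ⟨p, h1, h2, rfl⟩ := D.exists_of_mem_coordinates hl
    exact D.pairing_integer h1 h2 hx
  H_separating := fun _ h => D.eq_zero_of_coordinates h
  θ_mem := fun g => neg_mem ⟨D.χCoeff _, LinearMap.ext fun w => (D.χ_eq_pairing _ w).symm⟩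
  ψ_map := fun g w hw hw0 => by
    rw [D.realMin_action U g w (pos_of_mem hw hw0)]
    rfl

end CuspData

end Cusp

/-! ### Smooth polarized subdivisions -/

section Smooth

variable {F : Type*} [Field F] [NumberField F] [NumberField.IsTotallyReal F]

namespace CuspData

variable {s : ℕ} (D : CuspData F s) {U : Subgroup (𝓞 F)ˣ} {S : Set (Set (V F))}

theorem tr_emb_mul (ξ : F) (q : V F) : tr (emb ξ * q) = ∑ τ : F →+* ℝ, τ ξ * q τ := rfl

theorem χ_add_tr_sub_realMin (β : D.Bs) (ξ : F) {w : W F s} (hw : ∀ τ, 0 < w.1 τ) :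
    D.χ β w + tr (emb ξ * w.1) - D.realMin w =
      ∑ i, ∑ τ : F →+* ℝ, w.1 τ * τ (D.μ i) * (τ (β i : F) + w.2 i τ / w.1 τ) ^ 2 +
        ∑ τ : F →+* ℝ, τ ξ * w.1 τ := by
  rw [D.χ_eq_square_add_realMin β w hw, tr_emb_mul]
  ring

theorem square_nonneg (β : D.Bs) {w : W F s} (hw : ∀ τ, 0 < w.1 τ) (i : Fin s) (τ : F →+* ℝ) :
    0 ≤ w.1 τ * τ (D.μ i) * (τ (β i : F) + w.2 i τ / w.1 τ) ^ 2 :=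
  mul_nonneg (mul_pos (hw τ) (D.μ_pos i τ)).le (sq_nonneg _)

theorem sub_realMin_nonneg (β : D.Bs) {ξ : F} (hξ : ∀ τ : F →+* ℝ, 0 < τ ξ) {w : W F s}
    (hw : ∀ τ, 0 < w.1 τ) : 0 ≤ D.χ β w + tr (emb ξ * w.1) - D.realMin w := by
  rw [D.χ_add_tr_sub_realMin β ξ hw]
  exact add_nonneg (Finset.sum_nonneg fun i _ => Finset.sum_nonneg fun τ _ =>
    D.square_nonneg β hw i τ) (Finset.sum_nonneg fun τ _ => (mul_pos (hξ τ) (hw τ)).le)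

/-- The function `χ_β - realMin`, augmented by a positive functional of `q`, bounds all linear
functions. -/
theorem exists_pairing_le (β : D.Bs) {ξ : F} (hξ : ∀ τ : F →+* ℝ, 0 < τ ξ)
    (p : F × (Fin s → F)) : ∃ K : ℝ, 0 < K ∧ ∀ w : W F s, (∀ τ, 0 < w.1 τ) →
      pairing p.1 p.2 w ≤ K * (D.χ β w + tr (emb ξ * w.1) - D.realMin w) := by
  -- With `y = τ(β) + l/q`, each `q` is at most `Q/τ(ξ)` and each `q y²` at most `Q/τ(μ)`. Since `l
  -- = q(y - τ(β))` and `|y| ≤ y² + 1`, these bounds control every term of the pairing.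
  let c : ℝ := ∑ τ : F →+* ℝ, |τ p.1| / τ ξ + ∑ i, ∑ τ : F →+* ℝ,
    (|τ (p.2 i)| / τ (D.μ i) + (|τ (p.2 i)| + |τ (p.2 i) * τ (β i : F)|) / τ ξ)
  have hc : 0 ≤ c := add_nonneg
    (Finset.sum_nonneg fun τ _ => div_nonneg (abs_nonneg _) (hξ τ).le)
    (Finset.sum_nonneg fun i _ => Finset.sum_nonneg fun τ _ => add_nonneg
      (div_nonneg (abs_nonneg _) (D.μ_pos i τ).le)
      (div_nonneg (add_nonneg (abs_nonneg _) (abs_nonneg _)) (hξ τ).le))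
  refine ⟨1 + c, by linarith, fun w hw => ?_⟩
  have hQ0 := D.sub_realMin_nonneg β hξ hw
  have hQ := D.χ_add_tr_sub_realMin β ξ hw
  set Q := D.χ β w + tr (emb ξ * w.1) - D.realMin w
  have h1 : 0 ≤ ∑ i, ∑ τ : F →+* ℝ,
      w.1 τ * τ (D.μ i) * (τ (β i : F) + w.2 i τ / w.1 τ) ^ 2 :=
    Finset.sum_nonneg fun i _ => Finset.sum_nonneg fun τ _ => D.square_nonneg β hw i τ
  have h2 : 0 ≤ ∑ τ : F →+* ℝ, τ ξ * w.1 τ :=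
    Finset.sum_nonneg fun τ _ => (mul_pos (hξ τ) (hw τ)).le
  have hq : ∀ τ, w.1 τ ≤ Q / τ ξ := fun τ => by
    rw [le_div_iff₀ (hξ τ), mul_comm]
    have h3 := Finset.single_le_sum (f := fun τ : F →+* ℝ => τ ξ * w.1 τ)
      (fun τ _ => (mul_pos (hξ τ) (hw τ)).le) (Finset.mem_univ τ)
    linarith
  have hy : ∀ i τ, w.1 τ * (τ (β i : F) + w.2 i τ / w.1 τ) ^ 2 ≤ Q / τ (D.μ i) := fun i τ => by
    rw [le_div_iff₀ (D.μ_pos i τ), mul_right_comm]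
    have h3 := Finset.single_le_sum (f := fun τ : F →+* ℝ =>
      w.1 τ * τ (D.μ i) * (τ (β i : F) + w.2 i τ / w.1 τ) ^ 2)
      (fun τ _ => D.square_nonneg β hw i τ) (Finset.mem_univ τ)
    have h4 := Finset.single_le_sum (f := fun i => ∑ τ : F →+* ℝ,
      w.1 τ * τ (D.μ i) * (τ (β i : F) + w.2 i τ / w.1 τ) ^ 2)
      (fun i _ => Finset.sum_nonneg fun τ _ => D.square_nonneg β hw i τ) (Finset.mem_univ i)
    linarith
  have hfst : ∀ τ : F →+* ℝ, τ p.1 * w.1 τ ≤ |τ p.1| / τ ξ * Q := fun τ =>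
    (mul_le_mul_of_nonneg_right (le_abs_self _) (hw τ).le).trans
      ((mul_le_mul_of_nonneg_left (hq τ) (abs_nonneg _)).trans (le_of_eq (by ring)))
  have hsnd : ∀ i (τ : F →+* ℝ), τ (p.2 i) * w.2 i τ ≤ (|τ (p.2 i)| / τ (D.μ i) +
      (|τ (p.2 i)| + |τ (p.2 i) * τ (β i : F)|) / τ ξ) * Q := by
    intro i τ
    have hy' := hy i τ
    set y := τ (β i : F) + w.2 i τ / w.1 τ with hydef
    have hl : w.2 i τ = w.1 τ * (y - τ (β i : F)) := by
      rw [hydef, add_sub_cancel_left, mul_div_cancel₀ _ (hw τ).ne']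
    have h3 : τ (p.2 i) * y ≤ |τ (p.2 i)| * (y ^ 2 + 1) := by
      refine (le_abs_self _).trans ?_
      rw [abs_mul]
      refine mul_le_mul_of_nonneg_left ?_ (abs_nonneg _)
      nlinarith [sq_abs y, sq_nonneg (|y| - 1)]
    have h4 : -(τ (p.2 i) * τ (β i : F)) ≤ |τ (p.2 i) * τ (β i : F)| := neg_le_abs _
    calc τ (p.2 i) * w.2 i τ
        = w.1 τ * (τ (p.2 i) * y + -(τ (p.2 i) * τ (β i : F))) := by rw [hl]; ring
      _ ≤ w.1 τ * (|τ (p.2 i)| * (y ^ 2 + 1) + |τ (p.2 i) * τ (β i : F)|) :=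
        mul_le_mul_of_nonneg_left (add_le_add h3 h4) (hw τ).le
      _ = |τ (p.2 i)| * (w.1 τ * y ^ 2) + (|τ (p.2 i)| + |τ (p.2 i) * τ (β i : F)|) * w.1 τ := by
        ring
      _ ≤ |τ (p.2 i)| * (Q / τ (D.μ i)) +
          (|τ (p.2 i)| + |τ (p.2 i) * τ (β i : F)|) * (Q / τ ξ) :=
        add_le_add (mul_le_mul_of_nonneg_left hy' (abs_nonneg _))
          (mul_le_mul_of_nonneg_left (hq τ) (add_nonneg (abs_nonneg _) (abs_nonneg _)))
      _ = _ := by ring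
  have h5 : pairing p.1 p.2 w ≤ c * Q := by
    rw [add_mul, Finset.sum_mul, Finset.sum_mul]
    refine add_le_add (Finset.sum_le_sum fun τ _ => hfst τ) (Finset.sum_le_sum fun i _ => ?_)
    rw [Finset.sum_mul]
    exact Finset.sum_le_sum fun τ _ => hsnd i τ
  linarith

/-- The mean of the functions `χ_β` for `β ∈ A`, augmented by `q ↦ Tr (ξ q)`. -/
def meanL (A : Finset D.Bs) (ξ : F) : W F s →ₗ[ℝ] ℝ :=
  pairL ((A.card : ℚ)⁻¹ • ∑ β ∈ A, D.χCoeff β + (ξ, 0))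

theorem meanL_apply (A : Finset D.Bs) (ξ : F) (w : W F s) :
    D.meanL A ξ w = (A.card : ℝ)⁻¹ * ∑ β ∈ A, D.χ β w + tr (emb ξ * w.1) := by
  rw [meanL, map_add, map_smul, LinearMap.add_apply, LinearMap.smul_apply, pairL_apply,
    pairL_apply, pairing_zero_right, D.pairing_sum_χCoeff, Rat.smul_def]
  push_cast
  rfl

/-- All summands of the mean are nonnegative after subtraction of `ψ`, so a single `β` suffices for
the domination, at the cost of the factor `|A|`. -/
theorem good_meanL {A : Finset D.Bs} (hA : A.Nonempty) {ξ : F} (hξ : ∀ τ : F →+* ℝ, 0 < τ ξ) :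
    (D.twistedCone U).Good 1 (D.meanL A ξ) := by
  refine ⟨⟨_, rfl⟩, ?_⟩
  rintro _ ⟨p, rfl⟩
  obtain ⟨β, hβ⟩ := hA
  obtain ⟨K, hK, H⟩ := D.exists_pairing_le β hξ p
  have hcard : (0 : ℝ) < A.card := by exact_mod_cast Finset.card_pos.2 ⟨β, hβ⟩
  refine ⟨K * A.card, mul_pos hK hcard, fun w hw hw0 => ?_⟩
  have hpos := pos_of_mem hw hw0
  rw [pairL_apply]
  refine (H w hpos).trans ?_
  rw [mul_assoc]
  refine mul_le_mul_of_nonneg_left ?_ hK.le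
  have h1 : A.card * (D.meanL A ξ w - (1 : ℕ) * (D.twistedCone U).ψ w) =
      ∑ β ∈ A, (D.χ β w + tr (emb ξ * w.1) - D.realMin w) := by
    rw [Finset.sum_sub_distrib, Finset.sum_add_distrib, Finset.sum_const, Finset.sum_const,
      meanL_apply, nsmul_eq_mul, nsmul_eq_mul]
    change A.card * (_ - (1 : ℕ) * D.realMin w) = _
    field_simp
    push_cast
    ring
  rw [h1]
  exact Finset.single_le_sum (f := fun β => D.χ β w + tr (emb ξ * w.1) - D.realMin w)
    (fun β _ => D.sub_realMin_nonneg β hξ hpos) hβ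

theorem mem_cone_of_mem_coneTilde {w : W F s} (hw : w ∈ coneTilde F s) : w.1 ∈ cone F := by
  rcases hw with rfl | hw
  · exact Or.inl rfl
  · exact Or.inr hw

/-- The mean of the `χ_β` supports `φ` and `ξ` supports the minimum over the family. Equality in the
sum means equality in both parts, hence membership in the cone, with no condition left over the
base. -/
theorem exists_good_of_mem_tildeFan (hS : D.IsBaseFan U S) {Ξ : Set F} (hΞ : IsFamily U Ξ)
    (hR : D.Refines S Ξ) {τ : Set (W F s)} (hτ : τ ∈ D.tildeFan (refineFan S Ξ)) :
    ∃ L, (D.twistedCone U).Good 1 L ∧ ∀ w ∈ coneTilde F s, D.φ w + famMin Ξ w.1 ≤ L w ∧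
      (L w = D.φ w + famMin Ξ w.1 ↔ w ∈ τ) := by
  obtain ⟨ρ, hρ, A, hA, rfl⟩ := hτ
  obtain ⟨ξ, hξ, H⟩ := D.exists_strict_functional hS hΞ hR hρ
  refine ⟨_, D.good_meanL hA hξ, fun w hw => ?_⟩
  obtain ⟨h1, h2⟩ := H w.1 (mem_cone_of_mem_coneTilde hw)
  have hcard : (0 : ℝ) < A.card := by exact_mod_cast Finset.card_pos.2 hA
  have h3 : D.φ w ≤ (A.card : ℝ)⁻¹ * ∑ β ∈ A, D.χ β w := by
    rw [le_inv_mul_iff₀ hcard, ← nsmul_eq_mul, ← Finset.sum_const]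
    exact Finset.sum_le_sum fun β _ => D.φ_le hw β
  have h4 : (A.card : ℝ)⁻¹ * ∑ β ∈ A, D.χ β w = D.φ w ↔ ∀ β ∈ A, D.χ β w = D.φ w := by
    rw [inv_mul_eq_iff_eq_mul₀ hcard.ne', eq_comm, D.sum_χ_eq_iff hw]
  rw [meanL_apply]
  refine ⟨add_le_add h3 h1, fun h => ?_, fun h => ?_⟩
  · exact ⟨hw, h2.1 (by linarith), h4.1 (by linarith)⟩
  · rw [h4.2 h.2.2, h2.2 h.2.1]

theorem twistedCone_exists_nsmul_integer {L : W F s →ₗ[ℝ] ℝ} (hL : L ∈ (D.twistedCone U).R) :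
    ∃ n : ℕ, 0 < n ∧ ∃ p : F × (Fin s → F), p.1 ∈ D.X ∧ (∀ i, p.2 i ∈ D.a) ∧
      ∀ w, n * L w = pairing p.1 p.2 w := by
  obtain ⟨p, rfl⟩ := hL
  obtain ⟨n, hn, h1, h2⟩ := D.exists_nsmul_mem_lattices p
  exact ⟨n, hn, n • p, h1, h2, fun w => (pairing_nsmul n p w).symm⟩

/-- `φ` alone is strictly convex only over the base, so the base is first refined and `φ` is
corrected by the minimum over the refining family. The correction is invariant under the group and
does not disturb the twist. Subdivision then starts from this absolutely strict function. -/
theorem exists_smooth_polarized (hS : D.IsBaseFan U S) : ∃ (S' : Set (Set (W F s))) (k : ℕ)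
    (f : W F s → ℝ), 1 ≤ k ∧ D.IsTotalFan U S' ∧ IsSubdivision S' (D.tildeFan S) ∧
      IsSmooth D.latticeTilde S' ∧ D.IsTwistedPolarization U k S S' f := by
  classical
  obtain ⟨Ξ, hΞ, hR⟩ := D.exists_refines hS
  have hS₁ := D.isBaseFan_refineFan hS hΞ
  obtain ⟨K₀, st₀, hK₀⟩ := TwistedCone.exists_state (T := D.twistedCone U) (k := 1)
    (f := fun w => D.φ w + famMin Ξ w.1) (D.isTotalFan_tildeFan hS₁) one_pos
    (fun g w hw => by
      have h1 := D.φ_action (U := U) g hw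
      have h2 := famMin_unitAction hΞ g.right (mem_cone_of_mem_coneTilde hw)
      change D.φ (D.action U g w) + famMin Ξ (unitAction U g.right w.1) =
        D.φ w + famMin Ξ w.1 + (1 : ℕ) * -D.χ ((g.right : (𝓞 F)ˣ) • g.left.toAdd) w
      rw [h1, h2, Nat.cast_one]
      ring)
    (fun τ hτ => D.exists_good_of_mem_tildeFan hS hΞ hR hτ)
  obtain ⟨k₁, K₁, h₁, st₁, fin₁, simp₁⟩ := st₀.exists_simplicial
  obtain ⟨k, K, h, st, fin₂, hK, hm⟩ := st₁.exists_unimodular simp₁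
  have hfan : D.IsTotalFan U (TwistedCone.fanOf K) := st.isCompleteAdmissibleFan_fanOf hK
  have hle : ∀ B ∈ K, ∃ σ ∈ S, ∃ A : Finset D.Bs, A.Nonempty ∧
      (PointedCone.hull ℝ (B : Set (W F s)) : Set (W F s)) ⊆ D.tau σ A := by
    intro B hB
    obtain ⟨B₁, hB₁, h1⟩ := fin₂ B hB
    obtain ⟨B₀, hB₀, h0⟩ := fin₁ B₁ hB₁
    obtain ⟨τ, hτ, hBτ⟩ := hK₀ B₀ hB₀
    obtain ⟨P, rfl⟩ := (D.isTotalFan_tildeFan hS₁).isFan.exists_coe hτ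
    have hsub : PointedCone.hull ℝ (B : Set (W F s)) ≤ P :=
      (Submodule.span_le.2 h1).trans ((Submodule.span_le.2 h0).trans (Submodule.span_le.2 hBτ))
    obtain ⟨ρ, hρ, A, hA, hPA⟩ := hτ
    obtain ⟨σ, hσ, hρσ⟩ := (D.isSubdivision_refineFan hS hΞ).1 ρ hρ
    refine ⟨σ, hσ, A, hA, fun x hx => ?_⟩
    have hxP : x ∈ D.tau ρ A := hPA ▸ hsub hx
    exact ⟨hxP.1, hρσ hxP.2.1, hxP.2.2⟩
  obtain ⟨n, hn, hint⟩ := st.exists_integral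
    (fun L hL => by
      obtain ⟨n, hn, p, h1, h2, hp⟩ := D.twistedCone_exists_nsmul_integer hL
      exact ⟨n, hn, fun x hx => by rw [hp]; exact D.pairing_integer h1 h2 hx⟩)
    (fun g x hx => by
      obtain ⟨z, hz⟩ := D.pairing_integer (D.χCoeff_fst_mem ((g.right : (𝓞 F)ˣ) • g.left.toAdd))
        (D.χCoeff_snd_mem _) hx
      refine ⟨-z, ?_⟩
      change -D.χ ((g.right : (𝓞 F)ˣ) • g.left.toAdd) x = _
      rw [D.χ_eq_pairing, hz, Int.cast_neg])
  have hn' : (0 : ℝ) < n := by exact_mod_cast hn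
  have hmap : ∀ (g : D.Gp U), ∀ w ∈ coneTilde F s, TwistedCone.pl K h (D.action U g w) =
      TwistedCone.pl K h w + k * -D.χ ((g.right : (𝓞 F)ˣ) • g.left.toAdd) w :=
    fun g w hw => st.pl_map g hw
  have hconc : ConcaveOn ℝ (coneTilde F s) fun w => n * TwistedCone.pl K h w :=
    st.concaveOn_pl.smul hn'.le
  refine ⟨TwistedCone.fanOf K, n * k, fun w => n * TwistedCone.pl K h w,
    Nat.mul_pos hn st.pos, hfan, ⟨?_, ?_⟩, st.isSmooth_fanOf hK hm, ?_⟩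
  · rintro _ ⟨B, hB, rfl⟩
    obtain ⟨σ, hσ, A, hA, hsub⟩ := hle B hB
    exact ⟨_, ⟨σ, hσ, A, hA, rfl⟩, hsub⟩
  · rw [hfan.complete, (D.isTotalFan_tildeFan hS).complete]
  · refine ⟨⟨continuousOn_of_concaveOn hconc, hconc, fun w hw hwN => hint w hw hwN, ?_, ?_, ?_,
      ?_⟩, ?_⟩
    · rintro _ ⟨B, hB, rfl⟩
      obtain ⟨L, hL⟩ := st.strict B hB
      exact ⟨(n : ℝ) • L, fun w hw => congrArg ((n : ℝ) * ·) (st.pl_eq_of_mem_hull hB hL hw)⟩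
    · intro w hw r hr
      simp only [st.pl_smul hw hr]
      ring
    · intro u w hw
      have h0 : D.χ 0 w = 0 := by simp [χ_eq_sum]
      have h1 := hmap (SemidirectProduct.inr u) w hw
      have h2 : (((SemidirectProduct.inr u : D.Gp U).right : (𝓞 F)ˣ) •
          (SemidirectProduct.inr u : D.Gp U).left.toAdd : D.Bs) = 0 := smul_zero _
      simp only [h1, h2, h0, neg_zero, mul_zero, add_zero]
    · intro β w hw
      have h1 := hmap (SemidirectProduct.inl (Multiplicative.ofAdd β)) w hw
      have h2 : (((SemidirectProduct.inl (Multiplicative.ofAdd β) : D.Gp U).right : (𝓞 F)ˣ) •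
          (SemidirectProduct.inl (Multiplicative.ofAdd β) : D.Gp U).left.toAdd : D.Bs) = β :=
        one_smul _ _
      simp only [h1, h2]
      push_cast
      ring
    · rintro _ ⟨B, hB, rfl⟩
      obtain ⟨L, hL⟩ := st.strict B hB
      obtain ⟨σ, hσ, A, hA, hsub⟩ := hle B hB
      -- The support functional of the cell is cleared of denominators by `m`, and `n` is the factor
      -- that makes the piecewise linear function integral; the equality set is the cone itself, so
      -- any base cone that contains its projection will do.
      obtain ⟨m, hm', p, h1, h2, hp⟩ := D.twistedCone_exists_nsmul_integer hL.1.1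
      refine ⟨σ, hσ, m, hm', n • p.1, nsmul_mem (show p.1 ∈ (D.X : Submodule (𝓞 F) F) from h1) n,
        n • p.2, fun i => nsmul_mem (show p.2 i ∈ (D.a : Submodule (𝓞 F) F) from h2 i) n, ?_⟩
      have key : ∀ w : W F s, pairing (n • p.1) (n • p.2) w = m * (n * L w) := fun w => by
        rw [mul_left_comm, hp]
        exact pairing_nsmul n p w
      have hm0 : (m : ℝ) ≠ 0 := by exact_mod_cast Nat.pos_iff_ne_zero.1 hm'
      ext w
      refine ⟨fun hw => ⟨(hsub hw).1, (hsub hw).2.1, ?_⟩, fun hw => ?_⟩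
      · rw [key, st.pl_eq_of_mem_hull hB hL hw]
      · refine (st.mem_hull_iff hB hL hw.1).2 ?_
        have h3 := hw.2.2
        rw [key] at h3
        exact mul_left_cancel₀ hn'.ne' (mul_left_cancel₀ hm0 h3)

end CuspData

end Smooth

end VoronoiDelaunay

end

theorem mainTheorem5 {F : Type*} [Field F] [NumberField F] [NumberField.IsTotallyReal F]
    {s : ℕ} (hs : 1 ≤ s) (D : CuspData F s) (U : Subgroup (𝓞 F)ˣ) (hU : U.FiniteIndex) :
    -- the minimum that defines `φ` is attained
    (∀ w ∈ coneTilde F s, IsLeast (Set.range fun β : D.Bs => D.χ β w) (D.φ w)) ∧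
    (∀ S : Set (Set (V F)), D.IsBaseFan U S →
      D.IsTotalFan U (D.tildeFan S) ∧
      LiesOver S (D.tildeFan S) ∧
      D.IsTwistedPolarization U 1 S (D.tildeFan S) D.φ ∧
      (D.IsDelaunayConstant S → IsEquidimensional S (D.tildeFan S)) ∧
      (∃ (S' : Set (Set (W F s))) (k : ℕ) (f : W F s → ℝ), 1 ≤ k ∧
        D.IsTotalFan U S' ∧ IsSubdivision S' (D.tildeFan S) ∧ IsSmooth D.latticeTilde S' ∧
        D.IsTwistedPolarization U k S S' f)) ∧
    -- every base fan can be refined so that the decomposition becomes equidimensional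
    (∀ S : Set (Set (V F)), D.IsBaseFan U S →
      ∃ S₁ : Set (Set (V F)), D.IsBaseFan U S₁ ∧ IsSubdivision S₁ S ∧
        D.IsDelaunayConstant S₁ ∧ IsEquidimensional S₁ (D.tildeFan S₁)) := by
  refine ⟨fun w hw => D.isLeast_φ hw, fun S hS => ⟨D.isTotalFan_tildeFan hS,
    D.liesOver_tildeFan, D.isTwistedPolarization_φ, D.isEquidimensional_tildeFan hS, ?_⟩,
    fun S hS => D.exists_delaunayConstant_subdivision hS⟩
  exact D.exists_smooth_polarized hS
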